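/- Let $\phi=\frac{1+\sqrt5}{2}$ and let $\Delta\subset(\mathbb R^3)^*$ be the regular dodecahedron with vertices $(\pm1,\pm1,\pm1)$, $(0,\pm\phi,\pm\frac1\phi)$, $(\pm\frac1\phi,0,\pm\phi)$, $(\pm\phi,\pm\frac1\phi,0)$. Put $$Y_1=(\tfrac1{\phi^2},\tfrac1\phi,0),\ Y_2=(0,\tfrac1{\phi^2},\tfrac1\phi),\ Y_3=(\tfrac1\phi,0,\tfrac1{\phi^2}),\ Y_4=(-\tfrac1{\phi^2},\tfrac1\phi,0),\ Y_5=(0,-\tfrac1{\phi^2},\tfrac1\phi),\ Y_6=(\tfrac1\phi,0,-\tfrac1{\phi^2}),$$ let $P$ be the subgroup of $\mathbb R^3$ generated by $Y_1,\dots,Y_6$, and put $X_i=Y_i$, $X_{6+i}=-Y_i$ for $i=1,\dots,6$. Definitions. A quasilattice is the $\mathbb Z$-span of finitely many vectors spanning $\mathbb R^3$ over $\mathbb R$; a lattice is the $\mathbb Z$-span of a basis. A polytope with $d$ facets is quasirational with respect to $Q$ if it is an intersection of $d$ half-spaces $\{\mu\mid\langle\mu,Z_j\rangle\ge\lambda_j\}$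 with all $Z_j\in Q$, and rational if it is quasirational with respect to some lattice. A quasifold is a space with an atlas of charts $V/\Gamma\cong U$, where $U$ is open, $V$ is an open, connected, simply connected subset of a vector space, and $\Gamma$ is a countable discrete group acting on $V$ by diffeomorphisms (biholomorphisms, in the complex case), freely on a connected dense set; changes of charts, and diffeomorphisms of quasifolds, lift locally to diffeomorphisms (biholomorphisms for changes of complex charts) of the domains $V$. For $\mathbb K=\mathbb R,\mathbb C$ let $\pi_{\mathbb K}:\mathbb K^{12}\to\mathbb K^3$, $e_j\mapsto X_j$, $\pi=\pi_{\mathbb R}$; let $N$ and $N_{\mathbb C}$ be the kernels of the induced maps $\mathbb R^{12}/\mathbb Z^{12}\to\mathbb R^3/P$ and $\mathbb C^{12}/\mathbb Z^{12}\to\mathbb C^3/P$. They act on $\mathbb C^{12}$ by $[\theta]\cdot z=(e^{2\pi i\theta_j}z_j)_j$. Let $\Psi(z)\in(\ker\pi)^*$ be the restriction to $\ker\pi$ of $\sum_j(|z_j|^2-1)e_j^*$. For $\mu\in\Delta$ let $I_\mu=\{j\mid\langle\mu,X_j\rangle=-1\}$, and let $\mathbb C^{12}_\Delta=\bigcup_{\mu\in\Delta}\{z\mid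 z_j\ne0\text{ if }j\notin I_\mu\}$. Let $M_\Delta=\Psi^{-1}(0)/N$ and $X_\Delta=\mathbb C^{12}_\Delta/N_{\mathbb C}$, with the quotient topologies. Then the following hold. 1. $\Delta$ is a simple convex polytope with $20$ vertices (the points listed) and $12$ facets, and it is not rational. $P$ is a quasilattice, $\Delta$ is quasirational with respect to $P$, and $\Delta=\bigcap_{j=1}^{12}\{\mu\mid\langle\mu,X_j\rangle\ge-1\}$. 2. The Lie algebra of $N$ is $\mathfrak n=\ker\pi$. It has dimension $9$ and is spanned by $e_i+e_{6+i}$ $(i=1,\dots,6)$, $e_1+e_2-\phi(e_3+e_4)$, $e_2+e_3-\phi(e_1+e_5)$, $e_1+e_3-\phi(e_2+e_6)$; and $N=\exp(\mathfrak n)$. 3. $\Psi^{-1}(0)$ is compact and is the set of all $z$ with $|z_i|^2+|z_{6+i}|^2=2$ $(i=1,\dots,6)$, $|z_1|^2+|z_2|^2-\phi(|z_3|^2+|z_4|^2)=-\frac2\phi$, $|z_2|^2+|z_3|^2-\phi(|z_1|^2+|z_5|^2)=-\frac2\phi$, $|z_1|^2+|z_3|^2-\phi(|z_2|^2+|z_6|^2)=-\frac2\phi$.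 It is contained in $\mathbb C^{12}_\Delta$, which is open and is the union of the $20$ sets $\{z\mid z_j\ne0\text{ if }j\notin I_\nu\}$, $\nu$ a vertex. 4. The actions of $\mathbb R^{12}/\mathbb Z^{12}$ and $\mathbb C^{12}/\mathbb Z^{12}$ induce actions of $\mathbb R^3/P$ on $M_\Delta$ and of $\mathbb C^3/P$ on $X_\Delta$. $M_\Delta$ has an atlas of $20$ charts, one for each vertex $\nu$, making it a symplectic quasifold (of dimension $6$) on which $\mathbb R^3/P$ acts smoothly; the charts are $z\mapsto[s_\nu(z)]$ for smooth maps $s_\nu$ into $\Psi^{-1}(0)$ whose coordinates with index in $I_\nu$ are $z_1,z_2,z_3$ and whose other coordinates are positive, and the symplectic form is, in each chart, the pullback by $s_\nu$ of $\frac1{2\pi i}\sum_j dz_j\wedge d\bar z_j$. The points $[s_\nu(0)]$ are pairwise different and are exactly the fixed points of $\mathbb R^3/P$. 5. $X_\Delta$ has an atlas of $20$ charts, one for each vertex $\nu$, making it a complex quasifold of dimension $3$ on which $\mathbb C^3/P$ acts holomorphically with a dense open orbit. The chart at $\nu$ has $V=\mathbb C^3$ and sends $z$ to the class of the point whose coordinates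 with index in $I_\nu$ are $z_1,z_2,z_3$ and whose other coordinates are $1$. The images of $0$ in these charts are pairwise different and are exactly the fixed points of $\mathbb C^3/P$. 6. For $\nu=(-1,-1,-1)$ one has $I_\nu=\{1,2,3\}$. The slice $\tilde\tau(z_1,z_2,z_3)=(z_1,z_2,z_3,1,\dots,1)$ is transversal to the $N_{\mathbb C}$-orbits (at each of its points, its tangent space and that of the orbit are complementary), and it induces a homeomorphism $\mathbb C^3/\Gamma\to U$, $[z]\mapsto[\tilde\tau(z)]$, onto the open set $U=\{w\in\mathbb C^{12}_\Delta\mid w_i\ne0,\ i=4,\dots,12\}/N_{\mathbb C}$ of $X_\Delta$, where $$\Gamma=\{(e^{2\pi i\phi(h+l)},e^{2\pi i\phi(h+k)},e^{2\pi i\phi(k+l)})\mid h,k,l\in\mathbb Z\}$$ acts on $\mathbb C^3$ componentwise. This is the chart at $\nu$ of the atlas in 5. 7. The inclusion $\Psi^{-1}(0)\subset\mathbb C^{12}_\Delta$ induces a homeomorphism $\chi:M_\Delta\to X_\Delta$ that is a diffeomorphism of quasifolds for the atlases in 4 and 5 and is equivariant with respect to the actions of $\mathbb R^3/P$ and $\mathbb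 C^3/P$. -/

import Mathlib

open Set Topology
open scoped ContDiff Matrix goldenRatio

noncomputable section

/-! ### Convex polytopes in `(ℝⁿ)*`, written in coordinates -/

/-- The intersection of the half-spaces `⟨μ, X_j⟩ ≥ λ_j`. -/
def polyhedron {n d : ℕ} (X : Fin d → Fin n → ℝ) (lam : Fin d → ℝ) : Set (Fin n → ℝ) :=
  {μ | ∀ j, lam j ≤ μ ⬝ᵥ X j}

/-- A convex polytope of full dimension `n`. -/
def IsConvexPolytope {n : ℕ} (Δ : Set (Fin n → ℝ)) : Prop :=
  (∃ s : Finset (Fin n → ℝ), Δ = convexHull ℝ (s : Set (Fin n → ℝ))) ∧ (interior Δ).Nonempty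

/-- A facet of an `n`-dimensional polytope: an exposed face of dimension `n - 1`. -/
def IsFacet {n : ℕ} (Δ F : Set (Fin n → ℝ)) : Prop :=
  F.Nonempty ∧ IsExposed ℝ Δ F ∧ Module.finrank ℝ (vectorSpan ℝ F) + 1 = n

/-- Every vertex lies in exactly `n` facets. -/
def IsSimplePolytope {n : ℕ} (Δ : Set (Fin n → ℝ)) : Prop :=
  ∀ v ∈ Δ.extremePoints ℝ, {F | IsFacet Δ F ∧ v ∈ F}.ncard = n

/-- A quasilattice: the `ℤ`-span of finitely many `ℝ`-spanning vectors. -/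
def IsQuasilattice {n : ℕ} (Q : AddSubgroup (Fin n → ℝ)) : Prop :=
  ∃ (q : ℕ) (Y : Fin q → Fin n → ℝ),
    Submodule.span ℝ (range Y) = ⊤ ∧ Q = AddSubgroup.closure (range Y)

/-- A lattice: the `ℤ`-span of a basis. -/
def IsLatticeIn {n : ℕ} (L : AddSubgroup (Fin n → ℝ)) : Prop :=
  ∃ b : Module.Basis (Fin n) ℝ (Fin n → ℝ), L = AddSubgroup.closure (range b)

/-- `Δ` is quasirational with respect to `Q`: it is cut out by `d` half-spaces with normals in
`Q`, where `d` is its number of facets. -/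
def IsQuasirational {n : ℕ} (Δ : Set (Fin n → ℝ)) (Q : AddSubgroup (Fin n → ℝ)) : Prop :=
  ∃ (X : Fin {F | IsFacet Δ F}.ncard → Fin n → ℝ) (lam : Fin {F | IsFacet Δ F}.ncard → ℝ),
    (∀ j, X j ∈ Q) ∧ Δ = polyhedron X lam

/-- `Δ` is rational: it is quasirational with respect to a lattice. -/
def IsRationalPolytope {n : ℕ} (Δ : Set (Fin n → ℝ)) : Prop :=
  ∃ L : AddSubgroup (Fin n → ℝ), IsLatticeIn L ∧ IsQuasirational Δ L

/-! ### Quasifolds -/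

/-- The data of a quasifold chart on `X` with model `V/Γ`, where `V ⊆ E` and `Γ` acts on `V`.
Nothing is required of the action off `V` (any action on `V` extends by the identity), nor of the
values of `σ` off `V`. On `V`, `σ` is the composite of `V → V/Γ` with the chart `V/Γ → X`. -/
structure QuasifoldChart (E X : Type) where
  V : Set E
  Γ : Type
  [group : Group Γ]
  [action : MulAction Γ E]
  σ : E → X

attribute [instance] QuasifoldChart.group QuasifoldChart.action

namespace QuasifoldChart

/-- Two points of `V` are equivalent if they lie in the same `Γ`-orbit. -/
def setoid {E X : Type} (c : QuasifoldChart E X) : Setoid c.V where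
  r x y := ∃ γ : c.Γ, γ • (x : E) = y
  iseqv :=
    { refl := fun _ => ⟨1, one_smul _ _⟩
      symm := by
        rintro _ _ ⟨γ, h⟩
        exact ⟨γ⁻¹, by rw [← h, inv_smul_smul]⟩
      trans := by
        rintro _ _ _ ⟨γ, h⟩ ⟨δ, k⟩
        exact ⟨δ * γ, by rw [mul_smul, h, k]⟩ }

/-- The model `V/Γ`, with the quotient topology. -/
abbrev Model {E X : Type} (c : QuasifoldChart E X) : Type := Quotient c.setoid

variable (𝕜 : Type) [RCLike 𝕜] {E X Y : Type} [NormedAddCommGroup E] [NormedSpace 𝕜 E]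
  [TopologicalSpace X] [TopologicalSpace Y]

/-- `c` is a quasifold chart (smooth for `𝕜 = ℝ`, complex for `𝕜 = ℂ`): `V` is open, connected and
simply connected, the discrete (that is, countable) group `Γ` acts on `V` by diffeomorphisms
(biholomorphisms), the set of points where the action is free is connected and dense, and `σ`
induces a homeomorphism of `V/Γ` onto an open subset of `X`. -/
structure IsChart (c : QuasifoldChart E X) : Prop where
  isOpen : IsOpen c.V
  simplyConnected : SimplyConnectedSpace c.V
  countable : Countable c.Γ
  mapsTo : ∀ γ : c.Γ, ∀ x ∈ c.V, γ • x ∈ c.V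
  smooth : ∀ γ : c.Γ, ContDiffOn 𝕜 ∞ (fun x => γ • x) c.V
  connected_free : IsConnected {x ∈ c.V | ∀ γ : c.Γ, γ • x = x → γ = 1}
  dense_free : c.V ⊆ closure {x ∈ c.V | ∀ γ : c.Γ, γ • x = x → γ = 1}
  homeo : ∃ τ : c.Model → X, IsOpenEmbedding τ ∧ ∀ x : c.V, τ (Quotient.mk _ x) = c.σ x

/-- The open subset of `X` covered by the chart. -/
def image (c : QuasifoldChart E X) : Set X := c.σ '' c.V

/-- `h` is a local diffeomorphism (biholomorphism) between the domains `V` of the two charts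
that lifts the map `f`. -/
structure IsLocalLift (c : QuasifoldChart E X) (c' : QuasifoldChart E Y) (f : X → Y)
    (h : OpenPartialHomeomorph E E) : Prop where
  source_subset : h.source ⊆ c.V
  target_subset : h.target ⊆ c'.V
  smooth : ContDiffOn 𝕜 ∞ h h.source
  smooth_symm : ContDiffOn 𝕜 ∞ h.symm h.target
  lift : ∀ u ∈ h.source, c'.σ (h u) = f (c.σ u)

end QuasifoldChart

/-- A quasifold atlas on `X`: the charts cover `X`, and the changes of charts are diffeomorphisms
(biholomorphisms) of models, that is, they lift to local diffeomorphisms (biholomorphisms)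
between any two points of the domains `V` that represent the same point of `X`. -/
structure IsQuasifoldAtlas (𝕜 : Type) [RCLike 𝕜] {E X ι : Type} [NormedAddCommGroup E]
    [NormedSpace 𝕜 E] [TopologicalSpace X] (A : ι → QuasifoldChart E X) : Prop where
  isChart : ∀ a, (A a).IsChart 𝕜
  cover : ⋃ a, (A a).image = univ
  compatible : ∀ a b, ∀ x ∈ (A a).V, ∀ y ∈ (A b).V, (A a).σ x = (A b).σ y →
    ∃ h : OpenPartialHomeomorph E E,
      (A a).IsLocalLift 𝕜 (A b) id h ∧ x ∈ h.source ∧ h x = y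

/-- A diffeomorphism (biholomorphism) of quasifolds: a homeomorphism with local diffeomorphic
(biholomorphic) lifts in charts. -/
def IsQuasifoldDiffeo (𝕜 : Type) [RCLike 𝕜] {E X Y ι κ : Type} [NormedAddCommGroup E]
    [NormedSpace 𝕜 E] [TopologicalSpace X] [TopologicalSpace Y] (A : ι → QuasifoldChart E X)
    (B : κ → QuasifoldChart E Y) (f : X ≃ₜ Y) : Prop :=
  ∀ a b, ∀ x ∈ (A a).V, ∀ y ∈ (B b).V, f ((A a).σ x) = (B b).σ y →
    ∃ h : OpenPartialHomeomorph E E,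
      (A a).IsLocalLift 𝕜 (B b) f h ∧ x ∈ h.source ∧ h x = y

/-- `η` (one differential 2-form on the domain of each chart) is a symplectic form on the quasifold
with atlas `A`: each `η a` is smooth, closed, nondegenerate and `Γ`-invariant, and the changes of
charts have local lifts that respect the forms. -/
structure IsQuasifoldSymplecticForm {E X ι : Type} [NormedAddCommGroup E] [NormedSpace ℝ E]
    [TopologicalSpace X] (A : ι → QuasifoldChart E X) (η : ι → E → E [⋀^Fin 2]→L[ℝ] ℝ) :
    Prop where
  smooth : ∀ a, ContDiffOn ℝ ∞ (η a) (A a).V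
  closed : ∀ a, ∀ x ∈ (A a).V, extDeriv (η a) x = 0
  nondegenerate : ∀ a, ∀ x ∈ (A a).V, ∀ u, (∀ v, η a x ![u, v] = 0) → u = 0
  invariant : ∀ a, ∀ γ : (A a).Γ, ∀ x ∈ (A a).V,
    (η a (γ • x)).compContinuousLinearMap (fderiv ℝ (fun u => γ • u) x) = η a x
  compatible : ∀ a b, ∀ x ∈ (A a).V, ∀ y ∈ (A b).V, (A a).σ x = (A b).σ y →
    ∃ h : OpenPartialHomeomorph E E,
      (A a).IsLocalLift ℝ (A b) id h ∧ x ∈ h.source ∧ h x = y ∧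
      ∀ u ∈ h.source, (η b (h u)).compContinuousLinearMap (fderiv ℝ h u) = η a u

/-- An action of the quasitorus `𝕜³/Q` on a quasifold is smooth (holomorphic): the action map
`𝕜³/Q × X → X` has smooth (holomorphic) local lifts. -/
def IsSmoothQuasitorusAction (𝕜 : Type) [RCLike 𝕜] {E X ι : Type} [NormedAddCommGroup E]
    [NormedSpace 𝕜 E] {Q : AddSubgroup (Fin 3 → 𝕜)}
    [AddAction ((Fin 3 → 𝕜) ⧸ Q) X] (A : ι → QuasifoldChart E X) : Prop :=
  ∀ (a b : ι) (ξ : Fin 3 → 𝕜), ∀ x ∈ (A a).V, ∀ y ∈ (A b).V,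
    (QuotientAddGroup.mk ξ : (Fin 3 → 𝕜) ⧸ Q) +ᵥ (A a).σ x = (A b).σ y →
    ∃ (O : Set ((Fin 3 → 𝕜) × E)) (h : (Fin 3 → 𝕜) × E → E),
      IsOpen O ∧ (ξ, x) ∈ O ∧ ContDiffOn 𝕜 ∞ h O ∧ h (ξ, x) = y ∧
      ∀ p ∈ O, p.2 ∈ (A a).V ∧ h p ∈ (A b).V ∧
        (QuotientAddGroup.mk p.1 : (Fin 3 → 𝕜) ⧸ Q) +ᵥ (A a).σ p.2 = (A b).σ (h p)

/-! ### The torus `T^d = ℝ^d/ℤ^d`, its complexification `ℂ^d/ℤ^d`, and their actions on `ℂ^d` -/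

/-- `ℤ^d` inside `𝕜^d`. -/
def intLattice (𝕜 : Type) [RCLike 𝕜] (d : ℕ) : AddSubgroup (Fin d → 𝕜) :=
  ((Int.castAddHom 𝕜).compLeft (Fin d)).range

/-- `𝕜^d/ℤ^d`: the torus `T^d` for `𝕜 = ℝ`, its complexification for `𝕜 = ℂ`. -/
abbrev Torus (𝕜 : Type) [RCLike 𝕜] (d : ℕ) : Type := (Fin d → 𝕜) ⧸ intLattice 𝕜 d

section Torus

variable {𝕜 : Type} [RCLike 𝕜] [Algebra 𝕜 ℂ] {d : ℕ}

/-- The vector `(e^{2πiθ_1}, …, e^{2πiθ_d})`. -/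
def expVec (θ : Fin d → 𝕜) : Fin d → ℂ :=
  fun j => Complex.exp (2 * Real.pi * Complex.I * algebraMap 𝕜 ℂ (θ j))

theorem expVec_add (θ η : Fin d → 𝕜) : expVec (θ + η) = expVec θ * expVec η := by
  funext j
  simp [expVec, mul_add, Complex.exp_add]

theorem expVec_of_mem {θ : Fin d → 𝕜} (h : θ ∈ intLattice 𝕜 d) : expVec θ = 1 := by
  obtain ⟨m, rfl⟩ := h
  funext j
  have : (2 * Real.pi * Complex.I * algebraMap 𝕜 ℂ ((m j : ℤ) : 𝕜) : ℂ)
      = (m j : ℤ) * (2 * Real.pi * Complex.I) := by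
    rw [map_intCast]; ring
  change Complex.exp (2 * Real.pi * Complex.I * algebraMap 𝕜 ℂ ((m j : ℤ) : 𝕜)) = 1
  rw [this, Complex.exp_int_mul_two_pi_mul_I]

/-- The action of the torus on `ℂ^d`: `[θ] · z = (e^{2πiθ_1} z_1, …, e^{2πiθ_d} z_d)`. -/
instance torusAction : AddAction (Torus 𝕜 d) (Fin d → ℂ) where
  vadd t z := Quotient.liftOn' t (fun θ => expVec θ * z) (by
    intro θ η h
    have h1 : expVec (-θ + η) = 1 := expVec_of_mem (QuotientAddGroup.leftRel_apply.1 h)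
    have h2 : expVec η = expVec θ := by
      have := expVec_add θ (-θ + η)
      rwa [add_neg_cancel_left, h1, mul_one] at this
    simp only [h2])
  zero_vadd z := by
    change expVec (0 : Fin d → 𝕜) * z = z
    rw [expVec_of_mem (zero_mem _), one_mul]
  add_vadd s t z := by
    refine Quotient.inductionOn₂' s t fun θ η => ?_
    change expVec (θ + η) * z = expVec θ * (expVec η * z)
    rw [expVec_add, mul_assoc]

/-- Two points of `S` are equivalent if they lie in the same `N`-orbit. -/
def orbitSetoid (N : AddSubgroup (Torus 𝕜 d)) (S : Set (Fin d → ℂ)) : Setoid S where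
  r z w := ∃ t ∈ N, t +ᵥ (z : Fin d → ℂ) = w
  iseqv :=
    { refl := fun _ => ⟨0, N.zero_mem, zero_vadd _ _⟩
      symm := by
        rintro _ _ ⟨t, ht, h⟩
        exact ⟨-t, N.neg_mem ht, by rw [← h, neg_vadd_vadd]⟩
      trans := by
        rintro _ _ _ ⟨s, hs, h⟩ ⟨t, ht, k⟩
        exact ⟨t + s, N.add_mem ht hs, by rw [add_vadd, h, k]⟩ }

end Torus

/-- The standard symplectic form `(1/2πi) ∑ dz_j ∧ dz̄_j` on `ℂ^d`, that is,
`(u, v) ↦ (1/2πi) ∑ (u_j v̄_j - v_j ū_j) = (1/π) ∑ Im (u_j v̄_j)`. -/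
def standardForm (d : ℕ) : (Fin d → ℂ) [⋀^Fin 2]→L[ℝ] ℝ where
  toFun v := (1 / Real.pi) * ∑ j, ((v 0 j).im * (v 1 j).re - (v 0 j).re * (v 1 j).im)
  map_update_add' v i x y := by
    rw [← mul_add, ← Finset.sum_add_distrib]
    congr 1
    refine Finset.sum_congr rfl fun j _ => ?_
    fin_cases i <;> simp [Function.update] <;> ring
  map_update_smul' v i c x := by
    rw [smul_eq_mul, mul_left_comm c, Finset.mul_sum (a := c)]
    refine congrArg (fun t : ℝ => 1 / Real.pi * t) (Finset.sum_congr rfl fun j _ => ?_)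
    fin_cases i <;> simp [Function.update] <;> ring
  cont := by fun_prop
  map_eq_zero_of_eq' v i j h hij := by
    have h01 : v 0 = v 1 := by
      fin_cases i <;> fin_cases j <;> simp_all
    have : ∀ j, (v 0 j).im * (v 1 j).re - (v 0 j).re * (v 1 j).im = 0 := by
      intro j; rw [h01]; ring
    simp [this]

/-! ### The symplectic and complex toric quasifolds of `(Δ, Q, {X_1, …, X_d})` -/

/-- A subgroup `Q` of `ℝ³`, vectors `X_1, …, X_d` in `Q` and numbers `λ_1, …, λ_d`. -/
structure ToricData (d : ℕ) where
  Q : AddSubgroup (Fin 3 → ℝ)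
  X : Fin d → Fin 3 → ℝ
  lam : Fin d → ℝ
  mem : ∀ j, X j ∈ Q

namespace ToricData

variable {d : ℕ} (D : ToricData d)

/-- The polytope `Δ = ⋂ {μ | ⟨μ, X_j⟩ ≥ λ_j}`. -/
def polytope : Set (Fin 3 → ℝ) := polyhedron D.X D.lam

/-- The set `I_F` of indices for the open face `F` that contains `μ`. -/
def activeSet (μ : Fin 3 → ℝ) : Set (Fin d) := {j | μ ⬝ᵥ D.X j = D.lam j}

section Field

variable (𝕜 : Type) [RCLike 𝕜]

/-- `Q` as a subgroup of `𝕜³` (of `ℝ³` or of `ℂ³`). -/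
def quasilattice : AddSubgroup (Fin 3 → 𝕜) :=
  D.Q.map ((algebraMap ℝ 𝕜).toAddMonoidHom.compLeft (Fin 3))

/-- The linear mapping `𝕜^d → 𝕜³`, `e_j ↦ X_j`. -/
def piMap : (Fin d → 𝕜) →ₗ[𝕜] (Fin 3 → 𝕜) :=
  Fintype.linearCombination 𝕜 (fun j i => (algebraMap ℝ 𝕜 (D.X j i)))

/-- The quasitorus `D³ = ℝ³/Q`, or its complexification `ℂ³/Q`. -/
abbrev Quasitorus : Type := (Fin 3 → 𝕜) ⧸ D.quasilattice 𝕜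

theorem intLattice_le :
    intLattice 𝕜 d ≤ (D.quasilattice 𝕜).comap (D.piMap 𝕜).toAddMonoidHom := by
  rintro _ ⟨m, rfl⟩
  refine ⟨∑ j, m j • D.X j, D.Q.sum_mem fun j _ => D.Q.zsmul_mem (D.mem j) _, ?_⟩
  funext i
  simp [piMap, Fintype.linearCombination_apply]

/-- The homomorphism `𝕜^d/ℤ^d → 𝕜³/Q` induced by `e_j ↦ X_j`. -/
def bigPi : Torus 𝕜 d →+ D.Quasitorus 𝕜 :=
  QuotientAddGroup.map _ _ (D.piMap 𝕜).toAddMonoidHom (D.intLattice_le 𝕜)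

/-- The group `N` (for `𝕜 = ℝ`), or `N_ℂ` (for `𝕜 = ℂ`). -/
def N : AddSubgroup (Torus 𝕜 d) := (D.bigPi 𝕜).ker

end Field

/-- The Lie algebra of `N`: the vectors in `ℝ^d = Lie(T^d)` whose one-parameter subgroup lies
in `N`. -/
def lieAlgebraN : Set (Fin d → ℝ) :=
  {v | ∀ t : ℝ, (QuotientAddGroup.mk (t • v) : Torus ℝ d) ∈ D.N ℝ}

/-- The moment mapping `J(z) = ∑ (|z_j|² + λ_j) e_j*` of the torus action on `ℂ^d`. -/
def J (z : Fin d → ℂ) : Module.Dual ℝ (Fin d → ℝ) :=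
  Fintype.linearCombination ℝ (fun j => ‖z j‖ ^ 2 + D.lam j)

/-- The moment mapping `Ψ = i* ∘ J` of the `N`-action, with values in the dual of `ker π`. -/
def Ψ (z : Fin d → ℂ) : Module.Dual ℝ (LinearMap.ker (D.piMap ℝ)) :=
  (D.J z).domRestrict (LinearMap.ker (D.piMap ℝ))

/-- The level set `Ψ⁻¹(0)`. -/
def levelSet : Set (Fin d → ℂ) := {z | D.Ψ z = 0}

/-- The orbit space `M_Δ = Ψ⁻¹(0)/N`. -/
abbrev M : Type := Quotient (orbitSetoid (D.N ℝ) D.levelSet)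

/-- `ℂ^d_Δ`: the union over the open faces `F` of `Δ` of the sets
`{z | z_j ≠ 0 if j ∉ I_F}`. -/
def openSet : Set (Fin d → ℂ) :=
  {z | ∃ μ ∈ D.polytope, ∀ j, j ∉ D.activeSet μ → z j ≠ 0}

/-- The orbit space `X_Δ = ℂ^d_Δ/N_ℂ`. -/
abbrev XΔ : Type := Quotient (orbitSetoid (D.N ℂ) D.openSet)

/-- The class in `M_Δ` of a point of `Ψ⁻¹(0)`. -/
def mkM (z : D.levelSet) : D.M := Quotient.mk _ z

/-- The class in `X_Δ` of a point of `ℂ^d_Δ`. -/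
def mkX (z : D.openSet) : D.XΔ := Quotient.mk _ z

/-- The tangent space at `w` of the `N_ℂ`-orbit through `w`, that is, the space of all
`(2πi θ_j w_j)_j` with `θ` in the Lie algebra `ker π_ℂ`. -/
def orbitTangent (w : Fin d → ℂ) : Submodule ℂ (Fin d → ℂ) :=
  (LinearMap.ker (D.piMap ℂ)).map
    (LinearMap.pi fun j => (2 * Real.pi * Complex.I * w j) • LinearMap.proj j)

end ToricData

/-! ### The regular dodecahedron -/

/-- The 20 points `(±1,±1,±1)`, `(0,±φ,±1/φ)`, `(±1/φ,0,±φ)`, `(±φ,±1/φ,0)`. -/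
def dodecahedronVertices : Set (Fin 3 → ℝ) :=
  {v | ∃ a ∈ ({1, -1} : Set ℝ), ∃ b ∈ ({1, -1} : Set ℝ), ∃ c ∈ ({1, -1} : Set ℝ),
    v = ![a, b, c] ∨ v = ![0, a * φ, b / φ] ∨ v = ![a / φ, 0, b * φ] ∨ v = ![a * φ, b / φ, 0]}

/-- The regular dodecahedron. -/
def dodecahedron : Set (Fin 3 → ℝ) := convexHull ℝ dodecahedronVertices

/-- The vectors `Y_1, …, Y_6`. -/
def icosahedralY : Fin 6 → Fin 3 → ℝ :=
  ![![1 / φ ^ 2, 1 / φ, 0], ![0, 1 / φ ^ 2, 1 / φ], ![1 / φ, 0, 1 / φ ^ 2],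
    ![-(1 / φ ^ 2), 1 / φ, 0], ![0, -(1 / φ ^ 2), 1 / φ], ![1 / φ, 0, -(1 / φ ^ 2)]]

/-- The simple icosahedral quasilattice `P`, generated by `Y_1, …, Y_6`. -/
def icosahedralP : AddSubgroup (Fin 3 → ℝ) := AddSubgroup.closure (range icosahedralY)

/-- The normals `X_i = Y_i`, `X_{6+i} = -Y_i`. -/
def dodecahedronNormals : Fin 12 → Fin 3 → ℝ :=
  ![icosahedralY 0, icosahedralY 1, icosahedralY 2, icosahedralY 3, icosahedralY 4,
    icosahedralY 5, -icosahedralY 0, -icosahedralY 1, -icosahedralY 2, -icosahedralY 3,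
    -icosahedralY 4, -icosahedralY 5]

/-- The data `(P, X_1, …, X_12)`, with all `λ_j = -1`. -/
def dodecahedronData : ToricData 12 where
  Q := icosahedralP
  X := dodecahedronNormals
  lam := fun _ => -1
  mem := by
    have h : ∀ i, icosahedralY i ∈ icosahedralP := fun i =>
      AddSubgroup.subset_closure (mem_range_self i)
    intro j
    fin_cases j
    exacts [h 0, h 1, h 2, h 3, h 4, h 5, neg_mem (h 0), neg_mem (h 1), neg_mem (h 2),
      neg_mem (h 3), neg_mem (h 4), neg_mem (h 5)]

/-- The nine vectors of `ℝ¹²` that span the Lie algebra of `N`. -/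
def dodecahedronKernelVectors : Fin 9 → Fin 12 → ℝ :=
  let e : Fin 12 → Fin 12 → ℝ := fun j => Pi.single j 1
  ![e 0 + e 6, e 1 + e 7, e 2 + e 8, e 3 + e 9, e 4 + e 10, e 5 + e 11,
    e 0 + e 1 - φ • (e 2 + e 3), e 1 + e 2 - φ • (e 0 + e 4), e 0 + e 2 - φ • (e 1 + e 5)]

/-- The slice `(z_1, z_2, z_3) ↦ (z_1, z_2, z_3, 1, …, 1)`. -/
def dodecahedronSlice (z : Fin 3 → ℂ) : Fin 12 → ℂ :=
  ![z 0, z 1, z 2, 1, 1, 1, 1, 1, 1, 1, 1, 1]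

theorem dodecahedronSlice_mem (z : Fin 3 → ℂ) :
    dodecahedronSlice z ∈ dodecahedronData.openSet := by
  have hpos : 0 < φ := Real.goldenRatio_pos
  have gen : ∀ x : ℝ, 0 < x → x ^ 2 = x + 1 → 1 / x ^ 2 + 1 / x = 1 := by
    intro x hx h
    field_simp
    linarith
  have key : 1 / φ ^ 2 + 1 / φ = 1 := gen φ hpos Real.goldenRatio_sq
  have h1 : 0 < 1 / φ ^ 2 := by positivity
  have h2 : 0 < 1 / φ := by positivity
  refine ⟨![-1, -1, -1], ?_, ?_⟩
  · intro j
    change (-1 : ℝ) ≤ ![-1, -1, -1] ⬝ᵥ dodecahedronNormals j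
    fin_cases j <;>
      simp only [dodecahedronNormals, icosahedralY, dotProduct, Fin.sum_univ_three, Pi.neg_apply,
        Fin.zero_eta, Fin.mk_one, Fin.reduceFinMk, Fin.isValue, Matrix.cons_val] <;>
      linarith
  · intro j hj
    have hact : ∀ i : Fin 12, i = 0 ∨ i = 1 ∨ i = 2 →
        i ∈ dodecahedronData.activeSet ![-1, -1, -1] := by
      intro i hi
      change ![-1, -1, -1] ⬝ᵥ dodecahedronNormals i = (-1 : ℝ)
      rcases hi with rfl | rfl | rfl <;>
        simp only [dodecahedronNormals, icosahedralY, dotProduct, Fin.sum_univ_three,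
          Fin.isValue, Matrix.cons_val] <;>
        linarith
    fin_cases j
    · exact absurd (hact 0 (by simp)) hj
    · exact absurd (hact 1 (by simp)) hj
    · exact absurd (hact 2 (by simp)) hj
    all_goals exact one_ne_zero

/-- The group `Γ` of all `(e^{2πiφ(h+l)}, e^{2πiφ(h+k)}, e^{2πiφ(k+l)})`, `h, k, l ∈ ℤ`. It acts on
`ℂ³` by componentwise multiplication. -/
def dodecahedronΓ : Subgroup (Fin 3 → Circle) where
  carrier := {t | ∃ h k l : ℤ, t = ![Circle.exp (2 * Real.pi * (φ * (h + l))),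
    Circle.exp (2 * Real.pi * (φ * (h + k))), Circle.exp (2 * Real.pi * (φ * (k + l)))]}
  mul_mem' := by
    rintro _ _ ⟨h, k, l, rfl⟩ ⟨h', k', l', rfl⟩
    refine ⟨h + h', k + k', l + l', ?_⟩
    funext i
    fin_cases i <;> simp [← Circle.exp_add] <;> congr 1 <;> ring
  one_mem' := ⟨0, 0, 0, by funext i; fin_cases i <;> simp⟩
  inv_mem' := by
    rintro _ ⟨h, k, l, rfl⟩
    refine ⟨-h, -k, -l, ?_⟩
    funext i
    fin_cases i <;> simp [← Circle.exp_neg] <;> congr 1 <;> ring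

/-- The chart with model `ℂ³/Γ` that is induced by the slice. -/
def dodecahedronChart : QuasifoldChart (Fin 3 → ℂ) dodecahedronData.XΔ where
  V := univ
  Γ := dodecahedronΓ
  σ := fun z => dodecahedronData.mkX ⟨dodecahedronSlice z, dodecahedronSlice_mem z⟩

end

/-! ### Frames of a vertex and the projection `π` -/

namespace ToricData

section Frame

variable {d : ℕ} (D : ToricData d)

/-! The toric part works at one vertex at a time. There the three active normals form a basis of
`ℝ³` (a frame), so the phases of `θ` off the frame can be prescribed at will and the three phases on
the frame are then fixed by `π(θ)` (`adjust`). Hence a point whose coordinates off the frame are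
nonzero can be normalized there: to `1` under `N_ℂ`, to positive reals under `N`. The normalized
points form a slice parametrized by its frame coordinates. For `Ψ⁻¹(0)` the other coordinates are
square roots of affine functions of the `|z_i|²`, because a point is in the level set iff `|z_j|² +
λ_j = ⟨μ, X_j⟩` for some `μ` (`mem_levelSet_iff`). Two points of a slice lie in one orbit iff they
differ by the countable `chartGroup`. The real and the complex case run in parallel through
`IsPhaseSection` and `IsSlice`.

Changes of charts and the map `χ` come from one construction, `IsSlice.exists_lift`: near a given
identification, logarithms of coordinate ratios give a smooth choice of group element moving points
into the target slice (`IsSlice.exists_retraction`), and the inverse function theorem applies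
because the source slice is transversal to the `N_ℂ`-orbits. For the level slice this transversality
comes from positivity of `∑ (Im θ_j)² |z_j|²`; it makes `M_Δ → X_Δ` a local diffeomorphism. The same
retraction, with `π(θ)` as a free parameter, gives smoothness of the quasitorus actions. Fixed
points are found by comparing the countable chart group with the uncountable circle.

Each level slice pulls the standard form back to the standard form, its coordinates off the frame
being real. Changes of charts preserve the form because the derivative of the moment equations kills
the terms containing the derivative of the phases (`standardForm_comp_of_lift`).

Bijectivity of `χ` is a Kempf–Ness argument. Along the imaginary directions of `ker π` the squared
moduli are monotone, so two points of the level set in one `N_ℂ`-orbit differ by `N`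
(`exists_real_of_complex`). A convex function, coercive on `ker π`, has a minimum, and its critical
equation is the moment equation, so every `N_ℂ`-orbit in the open set meets the level set
(`exists_expVec_mul_mem_levelSet`).

For the dodecahedron, incidences and determinants are finite checks in `ℤ[φ]`. Its half-space
description views it as a cube with six roofs. Facets are controlled by one point in the relative
interior of each. Non-rationality follows from the relations among the normals: a product of
coefficients unaffected by rescaling the normals equals `(φ - 1)² = 2 - φ`, which is irrational. -/

/-- The matrix with rows `X_{e 0}, X_{e 1}, X_{e 2}`. -/
def frameMatrix (e : Fin 3 → Fin d) : Matrix (Fin 3) (Fin 3) ℝ := Matrix.of fun i => D.X (e i)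

variable {D} in
theorem injective_of_det_frameMatrix {e : Fin 3 → Fin d} (he : (D.frameMatrix e).det ≠ 0) :
    Function.Injective e := by
  intro i j h
  by_contra hij
  exact he (Matrix.det_zero_of_row_eq hij (by funext k; simp [frameMatrix, h]))

variable (𝕜 : Type) [RCLike 𝕜]

theorem piMap_apply (θ : Fin d → 𝕜) (k : Fin 3) :
    D.piMap 𝕜 θ k = ∑ j, θ j * algebraMap ℝ 𝕜 (D.X j k) := by
  simp [piMap, Fintype.linearCombination_apply]

/-- The matrix of a frame, with entries in `𝕜`. -/
noncomputable def frameMatrixOver (e : Fin 3 → Fin d) : Matrix (Fin 3) (Fin 3) 𝕜 :=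
  (D.frameMatrix e).map (algebraMap ℝ 𝕜)

variable {D} in
theorem isUnit_det_frameMatrixOver {e : Fin 3 → Fin d} (he : (D.frameMatrix e).det ≠ 0) :
    IsUnit (D.frameMatrixOver 𝕜 e).det := by
  have : (D.frameMatrixOver 𝕜 e).det = algebraMap ℝ 𝕜 (D.frameMatrix e).det :=
    (RingHom.map_det (algebraMap ℝ 𝕜) (D.frameMatrix e)).symm
  rw [this]
  exact (isUnit_iff_ne_zero.2 he).map _

/-- The linear section of `π` with values supported on the range of `e`. -/
noncomputable def frameSection (e : Fin 3 → Fin d) : (Fin 3 → 𝕜) →ₗ[𝕜] (Fin d → 𝕜) :=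
  (Fintype.linearCombination 𝕜 fun i => (Pi.single (e i) 1 : Fin d → 𝕜)) ∘ₗ
    (D.frameMatrixOver 𝕜 e)⁻¹.vecMulLinear

theorem frameSection_apply (e : Fin 3 → Fin d) (ξ : Fin 3 → 𝕜) (j : Fin d) :
    D.frameSection 𝕜 e ξ j
      = ∑ i, (ξ ᵥ* (D.frameMatrixOver 𝕜 e)⁻¹) i * (Pi.single (e i) 1 : Fin d → 𝕜) j := by
  simp [frameSection, Fintype.linearCombination_apply]

variable {D 𝕜}

theorem frameSection_of_notMem {e : Fin 3 → Fin d} (ξ : Fin 3 → 𝕜) {j : Fin d}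
    (hj : j ∉ range e) : D.frameSection 𝕜 e ξ j = 0 := by
  rw [frameSection_apply]
  refine Finset.sum_eq_zero fun i _ => ?_
  rw [Pi.single_eq_of_ne, mul_zero]
  rintro rfl
  exact hj ⟨i, rfl⟩

theorem frameSection_frame {e : Fin 3 → Fin d} (he : Function.Injective e) (ξ : Fin 3 → 𝕜)
    (i : Fin 3) : D.frameSection 𝕜 e ξ (e i) = (ξ ᵥ* (D.frameMatrixOver 𝕜 e)⁻¹) i := by
  rw [frameSection_apply, Finset.sum_eq_single i]
  · simp
  · intro k _ hk
    rw [Pi.single_eq_of_ne (fun h => hk (he h.symm)), mul_zero]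
  · simp

theorem piMap_eq_vecMul {e : Fin 3 → Fin d} (he : Function.Injective e) {θ : Fin d → 𝕜}
    (hθ : ∀ j ∉ range e, θ j = 0) :
    D.piMap 𝕜 θ = (θ ∘ e) ᵥ* D.frameMatrixOver 𝕜 e := by
  funext k
  rw [piMap_apply, Matrix.vecMul, dotProduct]
  refine (Fintype.sum_of_injective e he _ _ (fun j hj => ?_) (fun i => ?_)).symm
  · rw [hθ j hj, zero_mul]
  · simp [frameMatrixOver, frameMatrix]

theorem piMap_frameSection {e : Fin 3 → Fin d} (he : (D.frameMatrix e).det ≠ 0)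
    (ξ : Fin 3 → 𝕜) : D.piMap 𝕜 (D.frameSection 𝕜 e ξ) = ξ := by
  have hi := injective_of_det_frameMatrix he
  rw [piMap_eq_vecMul hi fun j hj => frameSection_of_notMem ξ hj]
  have : D.frameSection 𝕜 e ξ ∘ e = ξ ᵥ* (D.frameMatrixOver 𝕜 e)⁻¹ :=
    funext fun i => frameSection_frame hi ξ i
  rw [this, Matrix.vecMul_vecMul,
    Matrix.nonsing_inv_mul _ (isUnit_det_frameMatrixOver 𝕜 he), Matrix.vecMul_one]

theorem eq_frameSection {e : Fin 3 → Fin d} (he : (D.frameMatrix e).det ≠ 0) {θ : Fin d → 𝕜}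
    (hθ : ∀ j ∉ range e, θ j = 0) : θ = D.frameSection 𝕜 e (D.piMap 𝕜 θ) := by
  have hi := injective_of_det_frameMatrix he
  funext j
  by_cases hj : j ∈ range e
  · obtain ⟨i, rfl⟩ := hj
    rw [frameSection_frame hi, piMap_eq_vecMul hi hθ, Matrix.vecMul_vecMul,
      Matrix.mul_nonsing_inv _ (isUnit_det_frameMatrixOver 𝕜 he), Matrix.vecMul_one]
    rfl
  · rw [hθ j hj, frameSection_of_notMem _ hj]

/-- A frame is linearly independent, so `ker π` meets the coordinate subspace of the frame only in
`0`. The transversality arguments end here. -/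
theorem eq_zero_of_piMap_eq_zero {e : Fin 3 → Fin d} (he : (D.frameMatrix e).det ≠ 0)
    {θ : Fin d → 𝕜} (hθ : ∀ j ∉ range e, θ j = 0) (h : D.piMap 𝕜 θ = 0) : θ = 0 := by
  rw [eq_frameSection he hθ, h, map_zero]

/-- Replace the coordinates of `c` with index in the frame such that the image under `π`
becomes `ξ`. -/
noncomputable def adjust (D : ToricData d) (e : Fin 3 → Fin d) (ξ : Fin 3 → 𝕜) (c : Fin d → 𝕜) : Fin d → 𝕜 :=
  c + D.frameSection 𝕜 e (ξ - D.piMap 𝕜 c)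

theorem piMap_adjust {e : Fin 3 → Fin d} (he : (D.frameMatrix e).det ≠ 0) (ξ : Fin 3 → 𝕜)
    (c : Fin d → 𝕜) : D.piMap 𝕜 (D.adjust e ξ c) = ξ := by
  rw [adjust, map_add, piMap_frameSection he, add_sub_cancel]

theorem adjust_of_notMem {e : Fin 3 → Fin d} (ξ : Fin 3 → 𝕜) (c : Fin d → 𝕜) {j : Fin d}
    (hj : j ∉ range e) : D.adjust e ξ c j = c j := by
  rw [adjust, Pi.add_apply, frameSection_of_notMem _ hj, add_zero]

theorem adjust_piMap (e : Fin 3 → Fin d) (c : Fin d → 𝕜) :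
    D.adjust e (D.piMap 𝕜 c) c = c := by
  rw [adjust, sub_self, map_zero, add_zero]

theorem piMap_algebraMap (θ : Fin d → ℝ) :
    D.piMap 𝕜 (fun j => algebraMap ℝ 𝕜 (θ j)) = fun k => algebraMap ℝ 𝕜 (D.piMap ℝ θ k) := by
  funext k
  rw [piMap_apply, piMap_apply, map_sum]
  simp

theorem mem_quasilattice {ξ : Fin 3 → 𝕜} :
    ξ ∈ D.quasilattice 𝕜 ↔ ∃ q ∈ D.Q, ξ = fun k => algebraMap ℝ 𝕜 (q k) := by
  constructor
  · rintro ⟨q, hq, rfl⟩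
    exact ⟨q, hq, rfl⟩
  · rintro ⟨q, hq, rfl⟩
    exact ⟨q, hq, rfl⟩

theorem mk_mem_N {θ : Fin d → 𝕜} :
    (QuotientAddGroup.mk θ : Torus 𝕜 d) ∈ D.N 𝕜 ↔ D.piMap 𝕜 θ ∈ D.quasilattice 𝕜 := by
  rw [N, AddMonoidHom.mem_ker]
  change (QuotientAddGroup.mk (D.piMap 𝕜 θ) : D.Quasitorus 𝕜) = 0 ↔ _
  rw [QuotientAddGroup.eq_zero_iff]

end Frame

/-! ### Orbits -/

section Orbit

variable {𝕜 : Type} [RCLike 𝕜] [NormedAlgebra 𝕜 ℂ] {d : ℕ}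

theorem expVec_ne_zero (θ : Fin d → 𝕜) (j : Fin d) : expVec θ j ≠ 0 := Complex.exp_ne_zero _

theorem exists_int_of_exp_eq_one {t : 𝕜}
    (h : Complex.exp (2 * Real.pi * Complex.I * algebraMap 𝕜 ℂ t) = 1) : ∃ n : ℤ, t = n := by
  obtain ⟨n, hn⟩ := Complex.exp_eq_one_iff.1 h
  refine ⟨n, FaithfulSMul.algebraMap_injective 𝕜 ℂ ?_⟩
  rw [map_intCast]
  exact mul_left_cancel₀ Complex.two_pi_I_ne_zero (by rw [hn]; ring)

variable {D : ToricData d} {S : Set (Fin d → ℂ)}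

theorem mk_eq_mk_iff {z w : S} :
    (Quotient.mk (orbitSetoid (D.N 𝕜) S) z = Quotient.mk _ w) ↔
      ∃ θ : Fin d → 𝕜, D.piMap 𝕜 θ ∈ D.quasilattice 𝕜 ∧ expVec θ * z.1 = w.1 := by
  rw [Quotient.eq]
  constructor
  · rintro ⟨t, ht, h⟩
    obtain ⟨θ, rfl⟩ := QuotientAddGroup.mk_surjective t
    exact ⟨θ, mk_mem_N.1 ht, h⟩
  · rintro ⟨θ, h, h'⟩
    exact ⟨QuotientAddGroup.mk θ, mk_mem_N.2 h, h'⟩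

end Orbit

/-! ### The group of a chart -/

section ChartGroup

variable {d : ℕ} (D : ToricData d)

/-- The group of all `(e^{2πi a_k})_k` with `∑ a_k X_{e k} ∈ Q`. -/
def chartGroup (e : Fin 3 → Fin d) : Subgroup (Fin 3 → Circle) where
  carrier := {t | ∃ a : Fin 3 → ℝ, ∑ i, a i • D.X (e i) ∈ D.Q ∧
    t = fun i => Circle.exp (2 * Real.pi * a i)}
  mul_mem' := by
    rintro _ _ ⟨a, ha, rfl⟩ ⟨b, hb, rfl⟩
    refine ⟨a + b, ?_, ?_⟩
    · simpa [add_smul, Finset.sum_add_distrib] using D.Q.add_mem ha hb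
    · funext i
      simp [mul_add, Circle.exp_add]
  one_mem' := ⟨0, by simp [D.Q.zero_mem], by funext i; simp⟩
  inv_mem' := by
    rintro _ ⟨a, ha, rfl⟩
    refine ⟨-a, ?_, ?_⟩
    · simpa using D.Q.neg_mem ha
    · funext i
      simp [Circle.exp_neg]

theorem countable_Q (hQ : D.Q = AddSubgroup.closure (range D.X)) :
    (D.Q : Set (Fin 3 → ℝ)).Countable := by
  have : D.Q ≤ (Fintype.linearCombination ℤ D.X).toAddMonoidHom.range := by
    rw [hQ, AddSubgroup.closure_le]
    rintro _ ⟨j, rfl⟩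
    exact ⟨Pi.single j 1, by simp⟩
  exact (countable_range (Fintype.linearCombination ℤ D.X)).mono this

variable {D} {e : Fin 3 → Fin d}

theorem frameSection_real (he : (D.frameMatrix e).det ≠ 0) (𝕜 : Type) [RCLike 𝕜]
    (ξ : Fin 3 → ℝ) :
    D.frameSection 𝕜 e (fun k => algebraMap ℝ 𝕜 (ξ k))
      = fun j => algebraMap ℝ 𝕜 (D.frameSection ℝ e ξ j) := by
  refine Eq.trans ?_ (eq_frameSection (𝕜 := 𝕜) he fun j hj => ?_).symm
  · rw [piMap_algebraMap, piMap_frameSection he]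
  · rw [frameSection_of_notMem _ hj, map_zero]

theorem sum_smul_eq_piMap (hi : Function.Injective e) {θ : Fin d → ℝ}
    (hθ : ∀ j ∉ range e, θ j = 0) : ∑ i, θ (e i) • D.X (e i) = D.piMap ℝ θ := by
  rw [piMap_eq_vecMul hi hθ]
  funext k
  simp [Matrix.vecMul, dotProduct, frameMatrixOver, frameMatrix]

/-- A frame is a basis, so the vector `∑ a_k X_{e k}` of the countable group `Q` recovers the `a_k`.
-/
theorem countable_chartGroup (hQ : D.Q = AddSubgroup.closure (range D.X))
    (he : (D.frameMatrix e).det ≠ 0) : Countable (D.chartGroup e) := by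
  have hi := injective_of_det_frameMatrix he
  have : (D.chartGroup e : Set (Fin 3 → Circle)) ⊆
      (fun q i => Circle.exp (2 * Real.pi * D.frameSection ℝ e q (e i))) '' (D.Q : Set (Fin 3 → ℝ)) := by
    rintro _ ⟨a, ha, rfl⟩
    refine ⟨_, ha, ?_⟩
    obtain ⟨θ, hθ0, rfl⟩ : ∃ θ : Fin d → ℝ, (∀ j ∉ range e, θ j = 0) ∧ a = θ ∘ e :=
      ⟨Function.extend e a 0, fun j hj => Function.extend_apply' _ _ _ hj,
        (Function.extend_comp hi _ _).symm⟩
    simp only [Function.comp_apply]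
    rw [sum_smul_eq_piMap hi hθ0, ← eq_frameSection he hθ0]
  exact ((D.countable_Q hQ).image _).mono this

variable {𝕜 : Type} [RCLike 𝕜] [NormedAlgebra 𝕜 ℂ] [IsScalarTower ℝ 𝕜 ℂ]

theorem sum_int_smul_mem (m : Fin d → ℤ) : ∑ j, m j • D.X j ∈ D.Q :=
  D.Q.sum_mem fun j _ => D.Q.zsmul_mem (D.mem j) _

/-- Trivial phases off the frame mean that `θ_j` is an integer there. Subtracting the integral
combination of normals, which lies in `Q`, leaves a vector supported on the frame whose image is a
real vector of `Q`. Its coordinates are therefore real even for `𝕜 = ℂ`, which is why `M_Δ` and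
`X_Δ` have the same chart groups. -/
theorem exists_chartGroup_of_expVec (he : (D.frameMatrix e).det ≠ 0) {θ : Fin d → 𝕜}
    (h : D.piMap 𝕜 θ ∈ D.quasilattice 𝕜) (hθ : ∀ j ∉ range e, expVec θ j = 1) :
    ∃ γ : D.chartGroup e, ∀ i, expVec θ (e i) = (γ.1 i : ℂ) := by
  have hi := injective_of_det_frameMatrix he
  -- An integer is attached to every index. On the frame it is arbitrary and drops out at the end
  -- because `e^{2πin} = 1`.
  have hint : ∀ j, ∃ n : ℤ, j ∉ range e → θ j = n := by
    intro j
    by_cases hj : j ∈ range e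
    · exact ⟨0, fun h => absurd hj h⟩
    · obtain ⟨n, hn⟩ := exists_int_of_exp_eq_one (hθ j hj)
      exact ⟨n, fun _ => hn⟩
  choose n hn using hint
  obtain ⟨q, hq, hqe⟩ := mem_quasilattice.1 h
  let m : Fin d → 𝕜 := fun j => algebraMap ℝ 𝕜 (n j : ℝ)
  have hm : D.piMap 𝕜 m = fun k => algebraMap ℝ 𝕜 ((∑ j, n j • D.X j) k) := by
    rw [piMap_algebraMap (fun j => (n j : ℝ))]
    funext k
    rw [piMap_apply]
    simp
  have hq' := D.Q.sub_mem hq (sum_int_smul_mem n)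
  set q' := q - ∑ j, n j • D.X j with hq'def
  have h0 : ∀ j ∉ range e, (θ - m) j = 0 := by
    intro j hj
    simp [m, hn j hj]
  have h1 := eq_frameSection he h0
  have h2 : D.piMap 𝕜 (θ - m) = fun k => algebraMap ℝ 𝕜 (q' k) := by
    rw [map_sub, hm, hqe]
    funext k
    simp [hq'def]
  rw [h2, frameSection_real he] at h1
  refine ⟨⟨_, fun i => D.frameSection ℝ e q' (e i), ?_, rfl⟩, fun i => ?_⟩
  · rw [sum_smul_eq_piMap hi fun j hj => frameSection_of_notMem _ hj, piMap_frameSection he]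
    exact hq'
  · have h3 : θ (e i) = algebraMap ℝ 𝕜 (D.frameSection ℝ e q' (e i)) + (n (e i) : 𝕜) := by
      have := congrFun h1 (e i)
      rw [← this]
      simp [m]
    have h4 : expVec θ (e i) = Complex.exp (2 * Real.pi * Complex.I *
        (D.frameSection ℝ e q' (e i) : ℝ)) * Complex.exp ((n (e i) : ℤ) * (2 * Real.pi * Complex.I)) := by
      rw [expVec, h3, map_add, map_intCast, ← IsScalarTower.algebraMap_apply, ← Complex.exp_add]
      congr 1
      simp only [Complex.coe_algebraMap]
      ring
    rw [h4, Complex.exp_int_mul_two_pi_mul_I, mul_one, Circle.coe_exp]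
    congr 1
    push_cast
    ring

theorem exists_expVec_of_chartGroup (he : (D.frameMatrix e).det ≠ 0) (γ : D.chartGroup e) :
    ∃ θ : Fin d → 𝕜, D.piMap 𝕜 θ ∈ D.quasilattice 𝕜 ∧ (∀ j ∉ range e, expVec θ j = 1) ∧
      ∀ i, expVec θ (e i) = (γ.1 i : ℂ) := by
  have hi := injective_of_det_frameMatrix he
  obtain ⟨γ, a, ha, rfl⟩ := γ
  let θ : Fin d → ℝ := Function.extend e a 0
  have h0 : ∀ j ∉ range e, θ j = 0 := fun j hj => Function.extend_apply' _ _ _ hj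
  have ha' : ∀ i, θ (e i) = a i := fun i => hi.extend_apply _ _ _
  refine ⟨fun j => algebraMap ℝ 𝕜 (θ j), ?_, fun j hj => ?_, fun i => ?_⟩
  · rw [piMap_algebraMap, mem_quasilattice]
    refine ⟨_, ?_, rfl⟩
    rw [← sum_smul_eq_piMap hi h0]
    simpa [ha'] using ha
  · simp [expVec, h0 j hj]
  · rw [expVec, ← IsScalarTower.algebraMap_apply, ha', Circle.coe_exp]
    congr 1
    simp only [Complex.coe_algebraMap]
    push_cast
    ring

end ChartGroup

end ToricData

/-! ### Slices for the orbits of `N` and of `N_ℂ` -/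

/-- A continuous linear projection `p : ℂ → 𝕜` of logarithmic phases and a section `C ⊆ ℂˣ` for the
multiplication by the numbers `e^{2πit}`, `t ∈ 𝕜`. -/
structure IsPhaseSection {𝕜 : Type} [RCLike 𝕜] [NormedAlgebra 𝕜 ℂ] (p : ℂ →L[𝕜] 𝕜) (C : Set ℂ) :
    Prop where
  ne_zero : ∀ x ∈ C, x ≠ 0
  one_mem : 1 ∈ C
  normalize : ∀ x ∈ C, ∀ r : ℂ, r ≠ 0 → Complex.exp (2 * Real.pi * Complex.I *
    algebraMap 𝕜 ℂ (-p (Complex.log r / (2 * Real.pi * Complex.I)))) * (r * x) ∈ C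
  eq_one : ∀ x ∈ C, ∀ t : 𝕜, Complex.exp (2 * Real.pi * Complex.I * algebraMap 𝕜 ℂ t) * x ∈ C →
    Complex.exp (2 * Real.pi * Complex.I * algebraMap 𝕜 ℂ t) = 1

/-- The complex torus scales any nonzero number to exactly `1`, so the whole logarithm counts as
phase. -/
theorem isPhaseSection_complex : IsPhaseSection (ContinuousLinearMap.id ℂ ℂ) {1} where
  ne_zero := by simp
  one_mem := by simp
  normalize := by
    rintro _ rfl r hr
    have h : (2 * Real.pi * Complex.I *
        algebraMap ℂ ℂ (-(ContinuousLinearMap.id ℂ ℂ) (Complex.log r / (2 * Real.pi * Complex.I))) : ℂ)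
        = -Complex.log r := by
      have := Complex.two_pi_I_ne_zero
      simp only [Algebra.algebraMap_self, RingHom.id_apply, ContinuousLinearMap.id_apply]
      field_simp
    rw [h, Complex.exp_neg, Complex.exp_log hr, mul_one, mem_singleton_iff, inv_mul_cancel₀ hr]
  eq_one := by
    rintro _ rfl t h
    simpa using h

/-- The compact torus changes arguments only. The real part of `log r / (2πi)` is `arg r / (2π)`,
and removing it leaves a positive number. -/
theorem isPhaseSection_real :
    IsPhaseSection Complex.reCLM {x | ∃ r : ℝ, 0 < r ∧ x = r} where
  ne_zero := by
    rintro _ ⟨r, hr, rfl⟩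
    exact_mod_cast hr.ne'
  one_mem := ⟨1, one_pos, by simp⟩
  normalize := by
    rintro _ ⟨x, hx, rfl⟩ r hr
    refine ⟨‖r‖ * x, by positivity, ?_⟩
    have h : (2 * Real.pi * Complex.I *
        algebraMap ℝ ℂ (-Complex.reCLM (Complex.log r / (2 * Real.pi * Complex.I))) : ℂ)
        = -(r.arg * Complex.I) := by
      have h1 : (Complex.log r / (2 * Real.pi * Complex.I)).re = r.arg / (2 * Real.pi) := by
        have : Complex.log r / (2 * Real.pi * Complex.I)
            = ((1 / (2 * Real.pi) : ℝ) : ℂ) * (-Complex.I * Complex.log r) := by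
          have := Complex.two_pi_I_ne_zero
          have hp : (Real.pi : ℂ) ≠ 0 := by exact_mod_cast Real.pi_ne_zero
          push_cast
          field_simp
          linear_combination Complex.log r * Complex.I_sq
        rw [this, Complex.re_ofReal_mul]
        simp [Complex.log_im]
        ring
      rw [Complex.reCLM_apply, h1, Complex.coe_algebraMap]
      have hp : (Real.pi : ℂ) ≠ 0 := by exact_mod_cast Real.pi_ne_zero
      push_cast
      field_simp
    rw [h, Complex.exp_neg]
    have := Complex.norm_mul_exp_arg_mul_I r
    have h2 := Complex.exp_ne_zero (r.arg * Complex.I)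
    rw [inv_mul_eq_iff_eq_mul₀ h2]
    nth_rewrite 1 [← this]
    push_cast
    ring
  eq_one := by
    rintro _ ⟨r, hr, rfl⟩ t ⟨r', hr', h⟩
    have h1 : ‖Complex.exp (2 * Real.pi * Complex.I * algebraMap ℝ ℂ t)‖ = 1 := by
      have : (2 * Real.pi * Complex.I * algebraMap ℝ ℂ t : ℂ) = ((2 * Real.pi * t : ℝ) : ℂ) * Complex.I := by
        simp only [Complex.coe_algebraMap]; push_cast; ring
      rw [this, Complex.norm_exp_ofReal_mul_I]
    have h2 := congrArg norm h
    rw [norm_mul, h1, one_mul, Complex.norm_real, Complex.norm_real, Real.norm_of_nonneg hr.le,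
      Real.norm_of_nonneg hr'.le] at h2
    subst h2
    have : (r : ℂ) ≠ 0 := by exact_mod_cast hr.ne'
    exact mul_right_cancel₀ this (by rw [h, one_mul])

/-- A slice, over `V ⊆ ℂ³`, for the action on `S` of the subgroup `N` of the torus over `𝕜`: its
coordinates with index in the frame are `z_1, z_2, z_3`, its other coordinates are in `C`. -/
structure ToricData.IsSlice {d : ℕ} (D : ToricData d) (𝕜 : Type) [RCLike 𝕜] [NormedAlgebra 𝕜 ℂ]
    (e : Fin 3 → Fin d) (S : Set (Fin d → ℂ)) (C : Set ℂ) (V : Set (Fin 3 → ℂ))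
    (s : (Fin 3 → ℂ) → Fin d → ℂ) : Prop where
  domain : ∃ K : Set (Fin 3 → ℝ), IsOpen K ∧ Convex ℝ K ∧ 0 ∈ K ∧ V = {z | (fun i => ‖z i‖ ^ 2) ∈ K}
  smooth : ContDiffOn 𝕜 ∞ s V
  mem : ∀ z, s z ∈ S
  apply_frame : ∀ z ∈ V, ∀ i, s z (e i) = z i
  normal : ∀ z ∈ V, ∀ j ∉ range e, s z j ∈ C
  exhausts : ∀ w ∈ S, (∀ j ∉ range e, w j ∈ C) → ∃ z ∈ V, s z = w
  transverse : ∀ z ∈ V, ∀ v, fderiv ℝ s z v ∈ D.orbitTangent (s z) → v = 0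

namespace ToricData

theorem contDiff_adjust {d : ℕ} {D : ToricData d} {𝕜 : Type} [RCLike 𝕜] (e : Fin 3 → Fin d) :
    ContDiff 𝕜 ∞ fun q : (Fin 3 → 𝕜) × (Fin d → 𝕜) => D.adjust e q.1 q.2 := by
  have h1 := (LinearMap.toContinuousLinearMap (D.frameSection 𝕜 e)).contDiff (n := ∞)
  have h2 := (LinearMap.toContinuousLinearMap (D.piMap 𝕜)).contDiff (n := ∞)
  exact contDiff_snd.add (h1.comp (contDiff_fst.sub (h2.comp contDiff_snd)))

section Slice

variable {d : ℕ} {D : ToricData d} {𝕜 : Type} [RCLike 𝕜] [NormedAlgebra 𝕜 ℂ]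
  {e : Fin 3 → Fin d} {S : Set (Fin d → ℂ)} {C : Set ℂ} {V : Set (Fin 3 → ℂ)}
  {s : (Fin 3 → ℂ) → Fin d → ℂ} {p : ℂ →L[𝕜] 𝕜}

theorem IsSlice.isOpen (hs : D.IsSlice 𝕜 e S C V s) : IsOpen V := by
  obtain ⟨K, hK, -, -, rfl⟩ := hs.domain
  exact hK.preimage (by fun_prop)

theorem IsSlice.zero_mem (hs : D.IsSlice 𝕜 e S C V s) : (0 : Fin 3 → ℂ) ∈ V := by
  obtain ⟨K, -, -, h0, rfl⟩ := hs.domain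
  simpa [← Pi.zero_def] using h0

theorem IsSlice.eq_apply_frame (hs : D.IsSlice 𝕜 e S C V s) {w : Fin d → ℂ} (hw : w ∈ S)
    (hC : ∀ j ∉ range e, w j ∈ C) : (fun i => w (e i)) ∈ V ∧ s (fun i => w (e i)) = w := by
  obtain ⟨z, hz, rfl⟩ := hs.exhausts w hw hC
  have : (fun i => s z (e i)) = z := funext (hs.apply_frame z hz)
  rw [this]
  exact ⟨hz, rfl⟩

/-- Phases off the frame are dictated by logarithms; those on the frame remain free and are spent on
`π(θ) = ξ`. -/
theorem exists_normalized (hp : IsPhaseSection p C) (he : (D.frameMatrix e).det ≠ 0)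
    (ξ : Fin 3 → 𝕜) {w : Fin d → ℂ} (hw : ∀ j ∉ range e, w j ≠ 0) :
    ∃ θ : Fin d → 𝕜, D.piMap 𝕜 θ = ξ ∧ ∀ j ∉ range e, (expVec θ * w) j ∈ C := by
  refine ⟨D.adjust e ξ fun j => -p (Complex.log (w j) / (2 * Real.pi * Complex.I)),
    piMap_adjust he _ _, fun j hj => ?_⟩
  have := hp.normalize 1 hp.one_mem (w j) (hw j hj)
  rw [Pi.mul_apply, expVec, adjust_of_notMem _ _ hj]
  rwa [mul_one] at this

theorem contDiff_expVec : ContDiff 𝕜 ∞ (expVec : (Fin d → 𝕜) → Fin d → ℂ) := by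
  refine contDiff_pi.2 fun j => ?_
  have h : ContDiff 𝕜 ∞ fun θ : Fin d → 𝕜 =>
      (2 * Real.pi * Complex.I * algebraMap 𝕜 ℂ (θ j) : ℂ) := by
    have : ContDiff 𝕜 ∞ fun θ : Fin d → 𝕜 => algebraMap 𝕜 ℂ (θ j) :=
      (Algebra.linearMap 𝕜 ℂ).toContinuousLinearMap.contDiff.comp (contDiff_apply 𝕜 𝕜 j)
    exact contDiff_const.mul this
  exact h.cexp

/-- A smooth local choice of the group element that carries points near `w₀` into the slice, with
`adjust` enforcing the prescribed value of `π`. That value stays a parameter: it is held constant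
for changes of charts and varies for the quasitorus action. -/
theorem IsSlice.exists_retraction (hp : IsPhaseSection p C) (hs : D.IsSlice 𝕜 e S C V s)
    (hS : ∀ (θ : Fin d → 𝕜), ∀ w ∈ S, expVec θ * w ∈ S) (he : (D.frameMatrix e).det ≠ 0)
    {θ₀ : Fin d → 𝕜} {w₀ : Fin d → ℂ} {y : Fin 3 → ℂ} (hy : y ∈ V)
    (h : expVec θ₀ * w₀ = s y) :
    ∃ (O : Set ((Fin 3 → 𝕜) × (Fin d → ℂ))) (Θ : (Fin 3 → 𝕜) × (Fin d → ℂ) → Fin d → 𝕜),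
      IsOpen O ∧ (D.piMap 𝕜 θ₀, w₀) ∈ O ∧ ContDiffOn 𝕜 ∞ Θ O ∧ Θ (D.piMap 𝕜 θ₀, w₀) = θ₀ ∧
      ∀ q ∈ O, D.piMap 𝕜 (Θ q) = q.1 ∧ (q.2 ∈ S →
        (fun i => (expVec (Θ q) * q.2) (e i)) ∈ V ∧
        s (fun i => (expVec (Θ q) * q.2) (e i)) = expVec (Θ q) * q.2) := by
  classical
  have hw₀ : ∀ j ∉ range e, w₀ j ≠ 0 := by
    intro j hj h0
    have := hp.ne_zero _ (hs.normal y hy j hj)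
    rw [← h, Pi.mul_apply, h0, mul_zero] at this
    exact this rfl
  -- Logarithms are taken of the ratios `w j / w₀ j`, equal to `1` at the base point, so the
  -- principal branch is smooth nearby whatever the argument of `w₀ j` is.
  let c : (Fin d → ℂ) → Fin d → 𝕜 := fun w j =>
    if j ∈ range e then θ₀ j else
      θ₀ j - p (Complex.log (w j / w₀ j) / (2 * Real.pi * Complex.I))
  let O : Set ((Fin 3 → 𝕜) × (Fin d → ℂ)) :=
    {q | ∀ j, j ∉ range e → q.2 j / w₀ j ∈ Complex.slitPlane}
  have hc₀ : c w₀ = θ₀ := by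
    funext j
    by_cases hj : j ∈ range e
    · simp only [c, if_pos hj]
    · simp only [c, if_neg hj, div_self (hw₀ j hj), Complex.log_one, zero_div, map_zero, sub_zero]
  refine ⟨O, fun q => D.adjust e q.1 (c q.2), ?_, ?_, ?_, ?_, ?_⟩
  · have : O = ⋂ j, ⋂ (_ : j ∉ range e),
        (fun q : (Fin 3 → 𝕜) × (Fin d → ℂ) => q.2 j / w₀ j) ⁻¹' Complex.slitPlane := by
      ext q
      simp [O]
    rw [this]
    refine isOpen_iInter_of_finite fun j => isOpen_iInter_of_finite fun _ => ?_
    exact Complex.isOpen_slitPlane.preimage (by fun_prop)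
  · intro j hj
    simp [div_self (hw₀ j hj)]
  · have hc : ContDiffOn 𝕜 ∞ (fun q : (Fin 3 → 𝕜) × (Fin d → ℂ) => c q.2) O := by
      refine contDiffOn_pi.2 fun j => ?_
      by_cases hj : j ∈ range e
      · simp only [c, if_pos hj]
        exact contDiffOn_const
      · simp only [c, if_neg hj]
        refine contDiffOn_const.sub (p.contDiff.comp_contDiffOn ?_)
        have h1 : ContDiff 𝕜 ∞ fun q : (Fin 3 → 𝕜) × (Fin d → ℂ) => q.2 j / w₀ j :=
          ((contDiff_apply 𝕜 ℂ j).comp contDiff_snd).div_const _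
        refine ContDiffOn.div_const ?_ _
        intro q hq
        exact (((Complex.contDiffAt_log (hq j hj)).restrict_scalars 𝕜).comp q
          h1.contDiffAt).contDiffWithinAt
    exact (contDiff_adjust e).comp_contDiffOn (contDiffOn_fst.prodMk hc)
  · simp only [hc₀]
    exact adjust_piMap e θ₀
  · rintro ⟨ξ, w⟩ hq
    refine ⟨piMap_adjust he _ _, fun hw => hs.eq_apply_frame (hS _ _ hw) fun j hj => ?_⟩
    have hr : w j / w₀ j ≠ 0 := Complex.slitPlane_ne_zero (hq j hj)
    have h1 := hp.normalize _ (hs.normal y hy j hj) _ hr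
    have h2 : w j / w₀ j * s y j = expVec θ₀ j * w j := by
      rw [← h, Pi.mul_apply]
      field_simp [hw₀ j hj]
    rw [h2, ← mul_assoc] at h1
    simp only [Pi.mul_apply, expVec, adjust_of_notMem _ _ hj, c, if_neg hj]
    rw [sub_eq_add_neg, map_add, mul_add, Complex.exp_add, mul_comm (Complex.exp _) (Complex.exp _)]
    exact h1

end Slice

end ToricData

/-! ### Local diffeomorphisms -/

/-- The inverse function theorem gives smoothness of the inverse at a single point. Shrinking to the
open set where the derivative is still invertible gives it on the whole target. -/
theorem exists_openPartialHomeomorph_of_contDiffOn {𝕜 E : Type} [RCLike 𝕜] [NormedAddCommGroup E]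
    [NormedSpace 𝕜 E] [FiniteDimensional 𝕜 E] {f : E → E} {O : Set E} (hO : IsOpen O)
    (hf : ContDiffOn 𝕜 ∞ f O) {x : E} (hx : x ∈ O) (hinj : ∀ v, fderiv 𝕜 f x v = 0 → v = 0) :
    ∃ h : OpenPartialHomeomorph E E, h.source ⊆ O ∧ x ∈ h.source ∧ (∀ u, h u = f u) ∧
      ContDiffOn 𝕜 ∞ h h.source ∧ ContDiffOn 𝕜 ∞ h.symm h.target := by
  have : CompleteSpace E := FiniteDimensional.complete 𝕜 E
  have hfx : ContDiffAt 𝕜 ∞ f x := hf.contDiffAt (hO.mem_nhds hx)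
  have hker : LinearMap.ker (fderiv 𝕜 f x : E →ₗ[𝕜] E) = ⊥ :=
    LinearMap.ker_eq_bot'.2 hinj
  let f' : E ≃L[𝕜] E := (LinearEquiv.ofInjectiveEndo (fderiv 𝕜 f x : E →ₗ[𝕜] E)
    (LinearMap.ker_eq_bot.1 hker)).toContinuousLinearEquiv
  have hf' : HasFDerivAt f (f' : E →L[𝕜] E) x := by
    have : (f' : E →L[𝕜] E) = fderiv 𝕜 f x := by ext v; rfl
    rw [this]
    exact (hfx.differentiableAt (by simp)).hasFDerivAt
  let h₀ := hfx.toOpenPartialHomeomorph f hf' (by simp)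
  have h₀c : ∀ u, h₀ u = f u := fun u => rfl
  let W : Set E := O ∩ (fderiv 𝕜 f) ⁻¹' (range ((↑) : (E ≃L[𝕜] E) → E →L[𝕜] E))
  have hW : IsOpen W :=
    ((hf.continuousOn_fderiv_of_isOpen hO (by simp)).isOpen_inter_preimage hO
      ContinuousLinearEquiv.isOpen)
  have hxW : x ∈ W := ⟨hx, f', hf'.fderiv.symm⟩
  let h := h₀.restrOpen W hW
  have hsrc : h.source = h₀.source ∩ W := rfl
  refine ⟨h, fun u hu => hu.2.1, ⟨hfx.mem_toOpenPartialHomeomorph_source hf' (by simp), hxW⟩,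
    fun u => rfl, ?_, ?_⟩
  · exact (hf.mono fun u hu => hu.2.1).congr fun u _ => rfl
  · intro y hy
    have hu := h.map_target hy
    obtain ⟨g, hg⟩ := hu.2.2
    have hc : ContDiffAt 𝕜 ∞ f (h.symm y) := hf.contDiffAt (hO.mem_nhds hu.2.1)
    refine (h.contDiffAt_symm (f₀' := g) hy ?_ hc).contDiffWithinAt
    have := (hc.differentiableAt (by simp)).hasFDerivAt
    rw [← hg] at this
    exact this

namespace ToricData

/-! ### Lifts of maps between slices -/

section Lift

variable {d : ℕ} {D : ToricData d} {𝕜 𝕜' : Type} [RCLike 𝕜] [NormedAlgebra 𝕜 ℂ] [RCLike 𝕜']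
  [NormedAlgebra 𝕜' ℂ] {e e' : Fin 3 → Fin d} {S S' : Set (Fin d → ℂ)} {C C' : Set ℂ}
  {V V' : Set (Fin 3 → ℂ)} {s s' : (Fin 3 → ℂ) → Fin d → ℂ} {p : ℂ →L[𝕜] 𝕜}

/-- The derivative of `e^{2πiϑ} s'` is the exponential times `ds'(v) + 2πi dϑ(v) s'`. If it
vanishes, `ds'(v)` is tangent to the orbit, because `π ∘ ϑ` is locally constant and so `π(dϑ(v)) =
0`. Transversality gives `v = 0`. -/
theorem IsSlice.eq_zero_of_fderiv_exp_mul (hs : D.IsSlice 𝕜' e' S' C' V' s') {x : Fin 3 → ℂ}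
    (hx : x ∈ V') (hsd : DifferentiableAt ℝ s' x) {ϑ g : (Fin 3 → ℂ) → Fin d → ℂ}
    (hϑ : DifferentiableAt ℝ ϑ x)
    (hg : ∀ᶠ u in 𝓝 x, g u = fun j => Complex.exp (2 * Real.pi * Complex.I * ϑ u j) * s' u j)
    {ξ : Fin 3 → ℂ} (hπ : ∀ᶠ u in 𝓝 x, D.piMap ℂ (ϑ u) = ξ) {v : Fin 3 → ℂ}
    (hv : fderiv ℝ g x v = 0) : v = 0 := by
  refine hs.transverse x hx v ⟨-fderiv ℝ ϑ x v, ?_, ?_⟩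
  · have h1 : HasFDerivAt (fun u => D.piMap ℂ (ϑ u))
        (((LinearMap.toContinuousLinearMap (D.piMap ℂ)).restrictScalars ℝ).comp (fderiv ℝ ϑ x)) x :=
      (((LinearMap.toContinuousLinearMap (D.piMap ℂ)).restrictScalars ℝ).hasFDerivAt).comp x
        hϑ.hasFDerivAt
    have h2 : HasFDerivAt (fun u => D.piMap ℂ (ϑ u)) (0 : (Fin 3 → ℂ) →L[ℝ] (Fin 3 → ℂ)) x :=
      (hasFDerivAt_const ξ x).congr_of_eventuallyEq hπ
    have h3 := congrArg (fun L => L v) (h1.unique h2)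
    change D.piMap ℂ (-fderiv ℝ ϑ x v) = 0
    rw [map_neg, neg_eq_zero]
    exact h3
  · funext j
    have h1 := (hasFDerivAt_pi'.1 hϑ.hasFDerivAt j).const_mul (2 * Real.pi * Complex.I : ℂ)
    have h2 := h1.cexp.mul (hasFDerivAt_pi'.1 hsd.hasFDerivAt j)
    have hgd : HasFDerivAt g (fderiv ℝ g x) x := by
      refine DifferentiableAt.hasFDerivAt (DifferentiableAt.congr_of_eventuallyEq ?_ hg)
      refine differentiableAt_pi.2 fun j => ?_
      exact ((((hasFDerivAt_pi'.1 hϑ.hasFDerivAt j).const_mul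
        (2 * Real.pi * Complex.I : ℂ)).cexp).mul (hasFDerivAt_pi'.1 hsd.hasFDerivAt j)).differentiableAt
    have h3 := (hasFDerivAt_pi'.1 hgd j).congr_of_eventuallyEq
      (hg.mono fun u hu => (congrFun hu j).symm)
    have h4 := congrArg (fun L => L v) (h2.unique h3)
    have hE := Complex.exp_ne_zero (2 * Real.pi * Complex.I * ϑ x j)
    simp only [_root_.add_apply, _root_.smul_apply,
      ContinuousLinearMap.comp_apply, ContinuousLinearMap.proj_apply, smul_eq_mul, hv,
      Pi.zero_apply] at h4
    simp only [LinearMap.pi_apply, LinearMap.smul_apply, LinearMap.proj_apply, smul_eq_mul,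
      Pi.neg_apply]
    apply mul_left_cancel₀ hE
    linear_combination -h4

variable [NormedAlgebra 𝕜' 𝕜] [IsScalarTower 𝕜' 𝕜 ℂ] [IsScalarTower ℝ 𝕜 ℂ] [IsScalarTower ℝ 𝕜' ℂ]

/-- A map between two slices, given at one point by an element of the quasitorus, extends to a local
diffeomorphism. -/
theorem IsSlice.exists_lift (hp : IsPhaseSection p C) (hs : D.IsSlice 𝕜 e S C V s)
    (hS : ∀ (θ : Fin d → 𝕜), ∀ w ∈ S, expVec θ * w ∈ S) (he : (D.frameMatrix e).det ≠ 0)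
    (hs' : D.IsSlice 𝕜' e' S' C' V' s') (hSS : S' ⊆ S) {x y : Fin 3 → ℂ} (hx : x ∈ V') (hy : y ∈ V)
    {θ₀ : Fin d → 𝕜} (h : expVec θ₀ * s' x = s y) :
    ∃ (f : OpenPartialHomeomorph (Fin 3 → ℂ) (Fin 3 → ℂ)) (Θ : (Fin 3 → ℂ) → Fin d → 𝕜),
      f.source ⊆ V' ∧ f.target ⊆ V ∧ x ∈ f.source ∧ f x = y ∧ ContDiffOn 𝕜' ∞ f f.source ∧
      ContDiffOn 𝕜' ∞ f.symm f.target ∧ ContDiffOn 𝕜' ∞ Θ f.source ∧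
      ∀ u ∈ f.source, D.piMap 𝕜 (Θ u) = D.piMap 𝕜 θ₀ ∧ s (f u) = expVec (Θ u) * s' u := by
  have : FiniteDimensional 𝕜' (Fin 3 → ℂ) := Module.Finite.of_restrictScalars_finite ℝ 𝕜' _
  obtain ⟨O, Θ, hO, hmem, hΘ, hΘ₀, hR⟩ := hs.exists_retraction hp hS he hy h
  set ξ := D.piMap 𝕜 θ₀ with hξ
  have hcont : ContinuousOn (fun u => (ξ, s' u)) V' :=
    continuousOn_const.prodMk hs'.smooth.continuousOn
  let W : Set (Fin 3 → ℂ) := V' ∩ (fun u => (ξ, s' u)) ⁻¹' O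
  have hW : IsOpen W := hcont.isOpen_inter_preimage hs'.isOpen hO
  have hxW : x ∈ W := ⟨hx, hmem⟩
  have hsW : ContDiffOn 𝕜' ∞ s' W := hs'.smooth.mono inter_subset_left
  have hΘ' : ContDiffOn 𝕜' ∞ (fun u => Θ (ξ, s' u)) W :=
    (hΘ.restrict_scalars 𝕜').comp (contDiffOn_const.prodMk hsW) fun u hu => hu.2
  have hexp : ContDiffOn 𝕜' ∞ (fun u => expVec (Θ (ξ, s' u)) * s' u) W := by
    refine contDiffOn_pi.2 fun j => ContDiffOn.mul ?_ (contDiffOn_pi.1 hsW j)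
    have := (((contDiff_expVec (𝕜 := 𝕜) (d := d)).restrict_scalars 𝕜').comp_contDiffOn hΘ')
    exact contDiffOn_pi.1 this j
  let F : (Fin 3 → ℂ) → Fin 3 → ℂ := fun u i => (expVec (Θ (ξ, s' u)) * s' u) (e i)
  have hF : ContDiffOn 𝕜' ∞ F W := contDiffOn_pi.2 fun i => contDiffOn_pi.1 hexp (e i)
  have hFs : ∀ u ∈ W, F u ∈ V ∧ s (F u) = expVec (Θ (ξ, s' u)) * s' u :=
    fun u hu => (hR _ hu.2).2 (hSS (hs'.mem u))
  have hWx := hW.mem_nhds hxW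
  have hFx : F x = y := by
    funext i
    simp only [F]
    rw [hΘ₀, h, hs.apply_frame y hy i]
  have hsd : DifferentiableAt ℝ s' x :=
    ((hsW.contDiffAt hWx).differentiableAt (by simp)).restrictScalars ℝ
  have hFd : DifferentiableAt 𝕜' F x := (hF.contDiffAt hWx).differentiableAt (by simp)
  -- Injectivity of `dF`: a vector killed by `dF` is killed by the derivative of `s ∘ F = e^{2πiΘ}
  -- s'`, hence is zero by transversality of the source slice. This is done over `ℝ`, so that a
  -- source smooth over `ℝ` can be combined with a group over `ℂ`.
  obtain ⟨f, hfW, hxf, hfF, hfs, hfs'⟩ :=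
    exists_openPartialHomeomorph_of_contDiffOn hW hF hxW (by
      intro v hv
      have hϑ : DifferentiableAt ℝ (fun u j => algebraMap 𝕜 ℂ (Θ (ξ, s' u) j)) x := by
        have h1 : DifferentiableAt ℝ (fun u => Θ (ξ, s' u)) x :=
          ((hΘ'.contDiffAt hWx).differentiableAt (by simp)).restrictScalars ℝ
        refine differentiableAt_pi.2 fun j => ?_
        have h2 := ((Algebra.linearMap 𝕜 ℂ).toContinuousLinearMap.restrictScalars ℝ).differentiableAt
          (x := Θ (ξ, s' x) j)
        exact h2.comp x (differentiableAt_pi.1 h1 j)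
      refine hs'.eq_zero_of_fderiv_exp_mul hx hsd hϑ (g := fun u => s (F u))
        (ξ := fun k => algebraMap 𝕜 ℂ (ξ k)) ?_ ?_ ?_
      · filter_upwards [hWx] with u hu
        rw [(hFs u hu).2]
        rfl
      · filter_upwards [hWx] with u hu
        have : D.piMap 𝕜 (Θ (ξ, s' u)) = ξ := (hR _ hu.2).1
        funext k
        rw [← congrFun this k, piMap_apply, piMap_apply, map_sum]
        simp only [map_mul, ← IsScalarTower.algebraMap_apply]
      · have h3 : DifferentiableAt ℝ s (F x) := by
          rw [hFx]
          exact ((hs.smooth.contDiffAt (hs.isOpen.mem_nhds hy)).differentiableAt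
            (by simp)).restrictScalars ℝ
        have h4 : DifferentiableAt ℝ F x := hFd.restrictScalars ℝ
        have h5 : fderiv ℝ F x v = 0 := by
          rw [hFd.fderiv_restrictScalars ℝ]
          exact hv
        have h6 : fderiv ℝ (fun u => s (F u)) x = (fderiv ℝ s (F x)).comp (fderiv ℝ F x) :=
          fderiv_comp x h3 h4
        rw [h6, ContinuousLinearMap.comp_apply, h5, map_zero])
  refine ⟨f, fun u => Θ (ξ, s' u), fun u hu => (hfW hu).1, fun u hu => ?_, hxf, ?_, hfs, hfs',
    hΘ'.mono hfW, fun u hu => ⟨(hR _ (hfW hu).2).1, ?_⟩⟩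
  · rw [← f.right_inv hu, hfF]
    exact (hFs _ (hfW (f.map_target hu))).1
  · rw [hfF, hFx]
  · rw [hfF]
    exact (hFs u (hfW hu)).2

end Lift

end ToricData

/-! ### Multicircular domains in `ℂ³` -/

/-- Polar coordinates with squared radii: the set is the image of the convex set `(K ∩ {r > 0}) ×
ℝ³` under `(r, t) ↦ √r e^{it}`. A group of componentwise rotations acts freely at its points. -/
theorem isConnected_multicircular {K : Set (Fin 3 → ℝ)} (hK : IsOpen K) (hc : Convex ℝ K)
    (h0 : 0 ∈ K) : IsConnected {z : Fin 3 → ℂ | (fun i => ‖z i‖ ^ 2) ∈ K ∧ ∀ i, z i ≠ 0} := by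
  let P : Set ((Fin 3 → ℝ) × (Fin 3 → ℝ)) := (K ∩ {r | ∀ i, 0 < r i}) ×ˢ univ
  let f : (Fin 3 → ℝ) × (Fin 3 → ℝ) → Fin 3 → ℂ := fun q i =>
    (Real.sqrt (q.1 i) : ℂ) * Complex.exp (q.2 i * Complex.I)
  have hP : Convex ℝ P := by
    refine (hc.inter ?_).prod convex_univ
    intro a ha b hb x y hx hy hxy i
    have h1 := ha i
    have h2 := hb i
    simp only [Pi.add_apply, Pi.smul_apply, smul_eq_mul]
    rcases hx.eq_or_lt with rfl | hx'
    · have : y = 1 := by linarith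
      subst this
      simpa using h2
    · have := mul_pos hx' h1
      have := mul_nonneg hy h2.le
      linarith
  -- `K` is a neighbourhood of `0`, so it contains `(t, t, t)` for some small `t > 0`.
  have hne : P.Nonempty := by
    have h1 : Filter.Tendsto (fun t : ℝ => (fun _ => t : Fin 3 → ℝ)) (𝓝[>] 0) (𝓝 0) := by
      have : Continuous fun t : ℝ => (fun _ => t : Fin 3 → ℝ) := by fun_prop
      exact (this.tendsto' 0 0 rfl).mono_left nhdsWithin_le_nhds
    obtain ⟨t, ht, ht'⟩ := ((h1.eventually (hK.mem_nhds h0)).and self_mem_nhdsWithin).exists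
    exact ⟨(fun _ => t, 0), ⟨ht, fun _ => ht'⟩, mem_univ _⟩
  have hf : Continuous f := by fun_prop
  have him : {z : Fin 3 → ℂ | (fun i => ‖z i‖ ^ 2) ∈ K ∧ ∀ i, z i ≠ 0} = f '' P := by
    ext z
    constructor
    · rintro ⟨hz, hz0⟩
      refine ⟨(fun i => ‖z i‖ ^ 2, fun i => (z i).arg), ⟨⟨hz, fun i => ?_⟩, mem_univ _⟩, ?_⟩
      · have := norm_pos_iff.2 (hz0 i)
        positivity
      · funext i
        simp only [f]
        rw [Real.sqrt_sq (norm_nonneg _), Complex.norm_mul_exp_arg_mul_I]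
    · rintro ⟨⟨r, t⟩, ⟨⟨hr, hr0⟩, -⟩, rfl⟩
      have hn : ∀ i, ‖f (r, t) i‖ ^ 2 = r i := by
        intro i
        simp only [f]
        rw [norm_mul, Complex.norm_exp_ofReal_mul_I, mul_one, Complex.norm_real,
          Real.norm_of_nonneg (Real.sqrt_nonneg _), Real.sq_sqrt (hr0 i).le]
      refine ⟨by simpa only [hn] using hr, fun i h => ?_⟩
      have h1 := hn i
      rw [h] at h1
      have h2 := hr0 i
      simp only [norm_zero] at h1
      simp only at h2
      linarith
  rw [him]
  exact ⟨hne.image f, hP.isPreconnected.image f hf.continuousOn⟩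

theorem dense_forall_ne_zero {ι : Type} [Finite ι] : Dense {z : ι → ℂ | ∀ i, z i ≠ 0} := by
  have : {z : ι → ℂ | ∀ i, z i ≠ 0} = Set.pi univ fun _ => {0}ᶜ := by
    ext z
    simp
  rw [this]
  exact dense_pi univ fun i _ => dense_compl_singleton 0

/-- Scaling `z` by `a ∈ [0, 1]` scales the squared moduli by `a²`, so the set is star-shaped about
`0` and hence contractible. -/
theorem simplyConnectedSpace_multicircular {K : Set (Fin 3 → ℝ)} (hc : Convex ℝ K)
    (h0 : 0 ∈ K) : SimplyConnectedSpace {z : Fin 3 → ℂ | (fun i => ‖z i‖ ^ 2) ∈ K} := by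
  have hs : StarConvex ℝ (0 : Fin 3 → ℂ) {z : Fin 3 → ℂ | (fun i => ‖z i‖ ^ 2) ∈ K} := by
    rw [starConvex_zero_iff]
    intro z hz a ha ha1
    have h := hc.starConvex h0
    rw [starConvex_zero_iff] at h
    have := h hz (a := a ^ 2) (by positivity) (by nlinarith)
    have h2 : (fun i => ‖(a • z) i‖ ^ 2) = a ^ 2 • fun i => ‖z i‖ ^ 2 := by
      funext i
      simp [mul_pow]
    change (fun i => ‖(a • z) i‖ ^ 2) ∈ K
    rwa [h2]
  have := hs.contractibleSpace ⟨0, by simpa [← Pi.zero_def] using h0⟩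
  infer_instance

namespace ToricData

/-! ### The charts of slices -/

/-- The chart with model `V/G` induced by a map `s` into `S`. -/
noncomputable def sliceChart {d : ℕ} (D : ToricData d) (𝕜 : Type) [RCLike 𝕜] [Algebra 𝕜 ℂ]
    (S : Set (Fin d → ℂ)) (V : Set (Fin 3 → ℂ)) (G : Subgroup (Fin 3 → Circle))
    (s : (Fin 3 → ℂ) → Fin d → ℂ) (hs : ∀ z, s z ∈ S) :
    QuasifoldChart (Fin 3 → ℂ) (Quotient (orbitSetoid (D.N 𝕜) S)) where
  V := V
  Γ := G
  σ := fun z => Quotient.mk _ ⟨s z, hs z⟩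

theorem circle_smul_apply {G : Subgroup (Fin 3 → Circle)} (γ : G) (z : Fin 3 → ℂ) (i : Fin 3) :
    (γ • z) i = (γ.1 i : ℂ) * z i := rfl

section Chart

variable {d : ℕ} {D : ToricData d} {𝕜 : Type} [RCLike 𝕜] [NormedAlgebra 𝕜 ℂ]
  {e : Fin 3 → Fin d} {S : Set (Fin d → ℂ)} {C : Set ℂ}
  {V : Set (Fin 3 → ℂ)} {s : (Fin 3 → ℂ) → Fin d → ℂ} {p : ℂ →L[𝕜] 𝕜}

/-- Openness of the projection restricted to the slice. The retraction with `π(θ)` held at its value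
in `Q` moves all nearby points of `S` into `W` by elements of `N`. -/
theorem IsSlice.eventually_exists (hp : IsPhaseSection p C) (hs : D.IsSlice 𝕜 e S C V s)
    (hS : ∀ (θ : Fin d → 𝕜), ∀ w ∈ S, expVec θ * w ∈ S) (he : (D.frameMatrix e).det ≠ 0)
    {W : Set (Fin 3 → ℂ)} (hW : IsOpen W) (hWV : W ⊆ V) {z : Fin 3 → ℂ} (hz : z ∈ W)
    {w : Fin d → ℂ} {θ₀ : Fin d → 𝕜} (hθ₀ : D.piMap 𝕜 θ₀ ∈ D.quasilattice 𝕜)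
    (h : expVec θ₀ * w = s z) :
    ∀ᶠ w' in 𝓝 w, w' ∈ S → ∃ z' ∈ W, ∃ θ : Fin d → 𝕜,
      D.piMap 𝕜 θ ∈ D.quasilattice 𝕜 ∧ expVec θ * w' = s z' := by
  obtain ⟨O, Θ, hO, hmem, hΘ, hΘ₀, hR⟩ := hs.exists_retraction hp hS he (hWV hz) h
  set ξ := D.piMap 𝕜 θ₀
  have hcont : ContinuousAt (fun w' => Θ (ξ, w')) w :=
    (hΘ.continuousOn.continuousAt (hO.mem_nhds hmem)).comp
      (f := fun w' => (ξ, w')) (by fun_prop)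
  have h1 : ContinuousAt (fun w' i => (expVec (Θ (ξ, w')) * w') (e i)) w := by
    have h2 : ContinuousAt (fun w' => expVec (Θ (ξ, w')) * w') w :=
      (((contDiff_expVec (𝕜 := 𝕜) (d := d)).continuous.continuousAt).comp hcont).mul continuousAt_id
    exact continuousAt_pi.2 fun i => continuousAt_pi.1 h2 (e i)
  have h3 : (fun i => (expVec (Θ (ξ, w)) * w) (e i)) = z := by
    funext i
    rw [hΘ₀, h, hs.apply_frame z (hWV hz)]
  have h4 := h1.eventually (hW.mem_nhds (h3 ▸ hz :))
  have h5 : ∀ᶠ w' in 𝓝 w, (ξ, w') ∈ O :=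
    (Continuous.prodMk_right ξ).continuousAt.eventually (hO.mem_nhds hmem)
  filter_upwards [h4, h5] with w' h6 h7 hw'
  refine ⟨_, h6, Θ (ξ, w'), ?_, ((hR _ h7).2 hw').2.symm⟩
  rw [(hR _ h7).1]
  exact hθ₀

theorem IsSlice.isOpen_image (hp : IsPhaseSection p C) (hs : D.IsSlice 𝕜 e S C V s)
    (hS : ∀ (θ : Fin d → 𝕜), ∀ w ∈ S, expVec θ * w ∈ S) (he : (D.frameMatrix e).det ≠ 0)
    {W : Set (Fin 3 → ℂ)} (hW : IsOpen W) (hWV : W ⊆ V) :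
    IsOpen ((fun z => Quotient.mk (orbitSetoid (D.N 𝕜) S) ⟨s z, hs.mem z⟩) '' W) := by
  rw [← isQuotientMap_quotient_mk'.isOpen_preimage, isOpen_iff_mem_nhds]
  rintro w ⟨z, hz, hzw⟩
  obtain ⟨θ, hθ, h⟩ := ToricData.mk_eq_mk_iff.1 hzw.symm
  have := hs.eventually_exists hp hS he hW hWV hz hθ h
  filter_upwards [continuous_subtype_val.continuousAt.eventually this] with w' hw'
  obtain ⟨z', hz', θ', hθ', h'⟩ := hw' w'.2
  exact ⟨z', hz', (ToricData.mk_eq_mk_iff.2 ⟨θ', hθ', h'⟩).symm⟩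

theorem IsSlice.mem_image_sliceChart (hp : IsPhaseSection p C) (hs : D.IsSlice 𝕜 e S C V s)
    (hS : ∀ (θ : Fin d → 𝕜), ∀ w ∈ S, expVec θ * w ∈ S) (he : (D.frameMatrix e).det ≠ 0)
    {G : Subgroup (Fin 3 → Circle)} (w : S) (hw : ∀ j ∉ range e, w.1 j ≠ 0) :
    Quotient.mk (orbitSetoid (D.N 𝕜) S) w ∈ (D.sliceChart 𝕜 S V G s hs.mem).image := by
  obtain ⟨θ, hθ, h⟩ := exists_normalized (D := D) hp he 0 hw
  obtain ⟨z, hz, hz'⟩ := hs.exhausts _ (hS θ w w.2) h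
  refine ⟨z, hz, (ToricData.mk_eq_mk_iff.2 ⟨θ, ?_, hz'.symm⟩).symm⟩
  rw [hθ]
  exact (D.quasilattice 𝕜).zero_mem

variable [IsScalarTower ℝ 𝕜 ℂ]

/-- A group element relating two points of the slice has trivial phases off the frame, since `C`
contains at most one representative of each phase class. What remains is its action on the frame
coordinates, an element of `chartGroup`. -/
theorem IsSlice.mk_eq_mk_iff (hp : IsPhaseSection p C) (hs : D.IsSlice 𝕜 e S C V s)
    (hS : ∀ (θ : Fin d → 𝕜), ∀ w ∈ S, expVec θ * w ∈ S) (he : (D.frameMatrix e).det ≠ 0)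
    {z z' : Fin 3 → ℂ} (hz : z ∈ V) (hz' : z' ∈ V) :
    (Quotient.mk (orbitSetoid (D.N 𝕜) S) ⟨s z, hs.mem z⟩ = Quotient.mk _ ⟨s z', hs.mem z'⟩) ↔
      ∃ γ : D.chartGroup e, γ • z = z' := by
  rw [ToricData.mk_eq_mk_iff]
  constructor
  · rintro ⟨θ, hθ, h⟩
    simp only at h
    have h1 : ∀ j ∉ range e, expVec θ j = 1 := fun j hj =>
      hp.eq_one _ (hs.normal z hz j hj) _ (by
        have := hs.normal z' hz' j hj
        rw [← h] at this
        exact this)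
    obtain ⟨γ, hγ⟩ := exists_chartGroup_of_expVec he hθ h1
    refine ⟨γ, funext fun i => ?_⟩
    rw [circle_smul_apply, ← hγ, ← hs.apply_frame z hz i, ← hs.apply_frame z' hz' i, ← h,
      Pi.mul_apply]
  · rintro ⟨γ, rfl⟩
    obtain ⟨θ, hθ, h1, h2⟩ := exists_expVec_of_chartGroup (𝕜 := 𝕜) he γ
    refine ⟨θ, hθ, ?_⟩
    have := hs.eq_apply_frame (hS θ _ (hs.mem z)) (fun j hj => by
      rw [Pi.mul_apply, h1 j hj, one_mul]
      exact hs.normal z hz j hj)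
    have h3 : (fun i => (expVec θ * s z) (e i)) = γ • z := by
      funext i
      rw [Pi.mul_apply, h2, hs.apply_frame z hz, circle_smul_apply]
    rw [h3] at this
    exact this.2.symm

theorem IsSlice.isChart (hQ : D.Q = AddSubgroup.closure (range D.X)) (hp : IsPhaseSection p C)
    (hs : D.IsSlice 𝕜 e S C V s) (hS : ∀ (θ : Fin d → 𝕜), ∀ w ∈ S, expVec θ * w ∈ S)
    (he : (D.frameMatrix e).det ≠ 0) :
    (D.sliceChart 𝕜 S V (D.chartGroup e) s hs.mem).IsChart 𝕜 := by
  obtain ⟨K, hK, hc, h0, hV⟩ := hs.domain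
  let c := D.sliceChart 𝕜 S V (D.chartGroup e) s hs.mem
  have hdense : V ⊆ closure (V ∩ {z | ∀ i, z i ≠ 0}) :=
    dense_forall_ne_zero.open_subset_closure_inter hs.isOpen
  have hVe : V ∩ {z | ∀ i, z i ≠ 0} = {z | (fun i => ‖z i‖ ^ 2) ∈ K ∧ ∀ i, z i ≠ 0} := by
    rw [hV]; rfl
  have hsub : V ∩ {z | ∀ i, z i ≠ 0} ⊆
      {x ∈ V | ∀ γ : D.chartGroup e, γ • x = x → γ = 1} := by
    rintro z ⟨hz, hz0⟩
    refine ⟨hz, fun γ hγ => Subtype.ext (funext fun i => Circle.ext ?_)⟩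
    have := congrFun hγ i
    rw [circle_smul_apply] at this
    simpa [hz0 i] using this
  refine ⟨hs.isOpen, ?_, countable_chartGroup hQ he, ?_, ?_, ?_, ?_, ?_⟩
  · change SimplyConnectedSpace V
    rw [hV]
    exact simplyConnectedSpace_multicircular hc h0
  · intro (γ : D.chartGroup e) x hx
    change γ • x ∈ V
    have hx' : x ∈ V := hx
    have : (fun i => ‖(γ • x) i‖ ^ 2) = fun i => ‖x i‖ ^ 2 := by
      funext i
      rw [circle_smul_apply, norm_mul, Circle.norm_coe, one_mul]
    rw [Set.ext_iff] at hV
    refine (hV _).2 ?_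
    change (fun i => ‖(γ • x) i‖ ^ 2) ∈ K
    rw [this]
    exact (hV x).1 hx'
  · intro γ
    refine ContDiff.contDiffOn (contDiff_pi.2 fun i => ?_)
    change ContDiff 𝕜 ∞ fun x : Fin 3 → ℂ => (γ.1 i : ℂ) * x i
    exact contDiff_const.mul (contDiff_apply 𝕜 ℂ i)
  · have h1 := isConnected_multicircular hK hc h0
    rw [← hVe] at h1
    -- A set between a connected set and its closure is connected; here the connected set is the
    -- part of `V` with no zero coordinate.
    refine ⟨h1.nonempty.mono hsub, h1.isPreconnected.subset_closure hsub fun x hx => hdense hx.1⟩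
  · exact fun x hx => closure_mono hsub (hdense hx)
  · let τ : c.Model → Quotient (orbitSetoid (D.N 𝕜) S) :=
      Quotient.lift (fun z : V => Quotient.mk _ ⟨s z, hs.mem z⟩) fun z z' h =>
        (hs.mk_eq_mk_iff hp hS he z.2 z'.2).2 h
    refine ⟨τ, .of_continuous_injective_isOpenMap ?_ ?_ ?_, fun x => rfl⟩
    · refine Continuous.quotient_lift ?_ _
      refine continuous_quotient_mk'.comp (Continuous.subtype_mk ?_ _)
      exact continuousOn_iff_continuous_domRestrict.1 hs.smooth.continuousOn
    · intro x y
      refine Quotient.inductionOn₂ x y fun z z' h => Quotient.sound ?_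
      exact (hs.mk_eq_mk_iff hp hS he z.2 z'.2).1 h
    · intro U hU
      have h1 : IsOpen (Subtype.val '' (Quotient.mk c.setoid ⁻¹' U) : Set (Fin 3 → ℂ)) :=
        hs.isOpen.isOpenMap_subtype_val _ (hU.preimage continuous_quotient_mk')
      have h2 := hs.isOpen_image hp hS he h1 (by rintro _ ⟨z, -, rfl⟩; exact z.2)
      convert h2 using 1
      ext m
      constructor
      · rintro ⟨x, hx, rfl⟩
        obtain ⟨z, rfl⟩ := Quotient.exists_rep x
        exact ⟨z, ⟨z, hx, rfl⟩, rfl⟩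
      · rintro ⟨_, ⟨z, hz, rfl⟩, rfl⟩
        exact ⟨_, hz, rfl⟩

variable {e' : Fin 3 → Fin d} {V' : Set (Fin 3 → ℂ)} {s' : (Fin 3 → ℂ) → Fin d → ℂ}

/-- The phases `Θ` and the constancy of `π ∘ Θ` are retained along with the lift because
compatibility of the symplectic form is deduced from them. -/
theorem IsSlice.exists_isLocalLift (hp : IsPhaseSection p C) (hs : D.IsSlice 𝕜 e S C V s)
    (hS : ∀ (θ : Fin d → 𝕜), ∀ w ∈ S, expVec θ * w ∈ S) (he : (D.frameMatrix e).det ≠ 0)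
    (hs' : D.IsSlice 𝕜 e' S C V' s') {G G' : Subgroup (Fin 3 → Circle)} {x y : Fin 3 → ℂ}
    (hx : x ∈ V') (hy : y ∈ V)
    (h : (D.sliceChart 𝕜 S V' G' s' hs'.mem).σ x = (D.sliceChart 𝕜 S V G s hs.mem).σ y) :
    ∃ (f : OpenPartialHomeomorph (Fin 3 → ℂ) (Fin 3 → ℂ)) (Θ : (Fin 3 → ℂ) → Fin d → 𝕜),
      (D.sliceChart 𝕜 S V' G' s' hs'.mem).IsLocalLift 𝕜 (D.sliceChart 𝕜 S V G s hs.mem) id f ∧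
      x ∈ f.source ∧ f x = y ∧ ContDiffOn 𝕜 ∞ Θ f.source ∧
      ∃ ξ, ∀ u ∈ f.source, D.piMap 𝕜 (Θ u) = ξ ∧ s (f u) = expVec (Θ u) * s' u := by
  obtain ⟨θ, hθ, h⟩ := ToricData.mk_eq_mk_iff.1 h
  obtain ⟨f, Θ, h1, h2, h3, h4, h5, h6, h7, h8⟩ :=
    hs.exists_lift hp hS he hs' subset_rfl hx hy h
  refine ⟨f, Θ, ⟨h1, h2, h5, h6, fun u hu => ?_⟩, h3, h4, h7, _, h8⟩
  refine (ToricData.mk_eq_mk_iff.2 ⟨Θ u, ?_, (h8 u hu).2.symm⟩).symm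
  rw [(h8 u hu).1]
  exact hθ

theorem isQuasifoldAtlas_sliceChart {ι : Type} {e : ι → Fin 3 → Fin d} {V : ι → Set (Fin 3 → ℂ)}
    {s : ι → (Fin 3 → ℂ) → Fin d → ℂ} (hQ : D.Q = AddSubgroup.closure (range D.X))
    (hp : IsPhaseSection p C) (hs : ∀ a, D.IsSlice 𝕜 (e a) S C (V a) (s a))
    (hS : ∀ (θ : Fin d → 𝕜), ∀ w ∈ S, expVec θ * w ∈ S) (he : ∀ a, (D.frameMatrix (e a)).det ≠ 0)
    (hcov : ∀ w ∈ S, ∃ a, ∀ j ∉ range (e a), w j ≠ 0) :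
    IsQuasifoldAtlas 𝕜 fun a => D.sliceChart 𝕜 S (V a) (D.chartGroup (e a)) (s a) (hs a).mem where
  isChart a := (hs a).isChart hQ hp hS (he a)
  cover := by
    refine eq_univ_of_forall fun m => ?_
    obtain ⟨w, rfl⟩ := Quotient.exists_rep m
    obtain ⟨a, ha⟩ := hcov w w.2
    exact mem_iUnion.2 ⟨a, (hs a).mem_image_sliceChart hp hS (he a) w ha⟩
  compatible a b x hx y hy h := by
    obtain ⟨f, Θ, h1, h2, h3, -⟩ := (hs b).exists_isLocalLift hp hS (he b) (hs a) hx hy h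
    exact ⟨f, h1, h2, h3⟩

end Chart

end ToricData

namespace ToricData

/-! ### The action of the quasitorus -/

section Action

variable {d : ℕ} {D : ToricData d} {𝕜 : Type} [RCLike 𝕜]

theorem exists_piMap_eq {e : Fin 3 → Fin d} (he : (D.frameMatrix e).det ≠ 0)
    (q : D.Quasitorus 𝕜) :
    ∃ θ : Fin d → 𝕜, (QuotientAddGroup.mk (D.piMap 𝕜 θ) : D.Quasitorus 𝕜) = q := by
  obtain ⟨ξ, rfl⟩ := QuotientAddGroup.mk_surjective q
  exact ⟨D.frameSection 𝕜 e ξ, by rw [piMap_frameSection he]⟩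

/-- An element of `𝕜^d` that represents an element of the quasitorus. -/
noncomputable def representative {e : Fin 3 → Fin d} (he : (D.frameMatrix e).det ≠ 0)
    (q : D.Quasitorus 𝕜) : Fin d → 𝕜 :=
  (exists_piMap_eq he q).choose

theorem mk_piMap_representative {e : Fin 3 → Fin d} (he : (D.frameMatrix e).det ≠ 0)
    (q : D.Quasitorus 𝕜) :
    (QuotientAddGroup.mk (D.piMap 𝕜 (representative he q)) : D.Quasitorus 𝕜) = q :=
  (exists_piMap_eq he q).choose_spec

variable [NormedAlgebra 𝕜 ℂ] {S : Set (Fin d → ℂ)}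

/-- Two lifts with the same class in the quasitorus differ by an element of `N`. This makes the
action independent of the representatives chosen in its definition. -/
theorem mk_expVec_mul_eq (hS : ∀ (θ : Fin d → 𝕜), ∀ w ∈ S, expVec θ * w ∈ S) {θ η : Fin d → 𝕜}
    (h : (QuotientAddGroup.mk (D.piMap 𝕜 θ) : D.Quasitorus 𝕜) =
      QuotientAddGroup.mk (D.piMap 𝕜 η)) {z w : S}
    (hzw : Quotient.mk (orbitSetoid (D.N 𝕜) S) z = Quotient.mk _ w) :
    Quotient.mk (orbitSetoid (D.N 𝕜) S) ⟨expVec θ * z.1, hS θ z z.2⟩ =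
      Quotient.mk _ ⟨expVec η * w.1, hS η w w.2⟩ := by
  obtain ⟨ζ, hζ, hz⟩ := ToricData.mk_eq_mk_iff.1 hzw
  refine ToricData.mk_eq_mk_iff.2 ⟨-θ + η + ζ, ?_, ?_⟩
  · rw [map_add, map_add, map_neg]
    exact add_mem (QuotientAddGroup.eq.1 h) hζ
  · change expVec (-θ + η + ζ) * (expVec θ * z.1) = expVec η * w.1
    rw [← hz, ← mul_assoc, ← mul_assoc, ← expVec_add, ← expVec_add]
    congr 2
    abel

/-- The action of the quasitorus on the orbit space `S/N`. -/
@[reducible] noncomputable def quasitorusAction {e : Fin 3 → Fin d} (he : (D.frameMatrix e).det ≠ 0)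
    (hS : ∀ (θ : Fin d → 𝕜), ∀ w ∈ S, expVec θ * w ∈ S) :
    AddAction (D.Quasitorus 𝕜) (Quotient (orbitSetoid (D.N 𝕜) S)) where
  vadd q := Quotient.lift (fun z => Quotient.mk _
    ⟨expVec (representative he q) * z.1, hS _ z z.2⟩) fun z w h =>
      mk_expVec_mul_eq hS rfl (Quotient.sound h)
  zero_vadd m := by
    obtain ⟨z, rfl⟩ := Quotient.exists_rep m
    refine (mk_expVec_mul_eq hS (η := 0) ?_ rfl).trans ?_
    · rw [mk_piMap_representative, map_zero]
      rfl
    · congr 1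
      refine Subtype.ext ?_
      change expVec (0 : Fin d → 𝕜) * z.1 = z.1
      rw [expVec_of_mem (AddSubgroup.zero_mem _), one_mul]
  add_vadd q r m := by
    obtain ⟨z, rfl⟩ := Quotient.exists_rep m
    refine (mk_expVec_mul_eq hS (η := representative he q + representative he r) ?_ rfl).trans ?_
    · rw [mk_piMap_representative, map_add, QuotientAddGroup.mk_add, mk_piMap_representative,
        mk_piMap_representative]
    · congr 1
      refine Subtype.ext ?_
      change expVec (_ + _) * z.1 = expVec _ * (expVec _ * z.1)
      rw [expVec_add, mul_assoc]

theorem bigPi_vadd_mk {e : Fin 3 → Fin d} (he : (D.frameMatrix e).det ≠ 0)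
    (hS : ∀ (θ : Fin d → 𝕜), ∀ w ∈ S, expVec θ * w ∈ S) (t : Torus 𝕜 d) (z w : S)
    (h : w.1 = t +ᵥ z.1) :
    (quasitorusAction he hS).toVAdd.vadd (D.bigPi 𝕜 t) (Quotient.mk (orbitSetoid (D.N 𝕜) S) z) =
      Quotient.mk _ w := by
  obtain ⟨θ, rfl⟩ := QuotientAddGroup.mk_surjective t
  refine (mk_expVec_mul_eq hS (η := θ) ?_ rfl).trans ?_
  · rw [mk_piMap_representative]
    rfl
  · congr 1
    exact Subtype.ext h.symm

end Action

section ActionCharts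

variable {d : ℕ} {D : ToricData d} {𝕜 : Type} [RCLike 𝕜] [NormedAlgebra 𝕜 ℂ]
  {S : Set (Fin d → ℂ)} {C : Set ℂ} {p : ℂ →L[𝕜] 𝕜}
  [AddAction (D.Quasitorus 𝕜) (Quotient (orbitSetoid (D.N 𝕜) S))] {ι : Type}
  {e : ι → Fin 3 → Fin d} {V : ι → Set (Fin 3 → ℂ)} {s : ι → (Fin 3 → ℂ) → Fin d → ℂ}

theorem mk_vadd_mk (hS : ∀ (θ : Fin d → 𝕜), ∀ w ∈ S, expVec θ * w ∈ S)
    (hact : ∀ (t : Torus 𝕜 d) (z w : S), w.1 = t +ᵥ z.1 →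
      D.bigPi 𝕜 t +ᵥ Quotient.mk (orbitSetoid (D.N 𝕜) S) z = Quotient.mk _ w)
    (θ : Fin d → 𝕜) (z : S) :
    (QuotientAddGroup.mk (D.piMap 𝕜 θ) : D.Quasitorus 𝕜) +ᵥ
      Quotient.mk (orbitSetoid (D.N 𝕜) S) z = Quotient.mk _ ⟨expVec θ * z.1, hS θ z z.2⟩ :=
  hact (QuotientAddGroup.mk θ) z _ rfl

theorem isSmoothQuasitorusAction_sliceChart (hp : IsPhaseSection p C)
    (hs : ∀ a, D.IsSlice 𝕜 (e a) S C (V a) (s a))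
    (hS : ∀ (θ : Fin d → 𝕜), ∀ w ∈ S, expVec θ * w ∈ S) (he : ∀ a, (D.frameMatrix (e a)).det ≠ 0)
    (hact : ∀ (t : Torus 𝕜 d) (z w : S), w.1 = t +ᵥ z.1 →
      D.bigPi 𝕜 t +ᵥ Quotient.mk (orbitSetoid (D.N 𝕜) S) z = Quotient.mk _ w) :
    IsSmoothQuasitorusAction 𝕜 (Q := D.quasilattice 𝕜) fun a =>
      D.sliceChart 𝕜 S (V a) (D.chartGroup (e a)) (s a) (hs a).mem := by
  intro a b ξ x hx y hy h
  change x ∈ V a at hx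
  change y ∈ V b at hy
  have key : ∀ ξ' : Fin 3 → 𝕜, ∀ u, (QuotientAddGroup.mk ξ' : D.Quasitorus 𝕜) +ᵥ
      (D.sliceChart 𝕜 S (V a) (D.chartGroup (e a)) (s a) (hs a).mem).σ u =
      Quotient.mk _ ⟨_, hS (D.frameSection 𝕜 (e a) ξ') _ ((hs a).mem u)⟩ := by
    intro ξ' u
    have := mk_vadd_mk hS hact (D.frameSection 𝕜 (e a) ξ') ⟨s a u, (hs a).mem u⟩
    rw [piMap_frameSection (he a)] at this
    exact this
  rw [key] at h
  obtain ⟨θ, hθ, h⟩ := ToricData.mk_eq_mk_iff.1 h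
  change expVec θ * (expVec (D.frameSection 𝕜 (e a) ξ) * s a x) = s b y at h
  rw [← mul_assoc, ← expVec_add] at h
  obtain ⟨O, Θ, hO, hmem, hΘ, hΘ₀, hR⟩ := (hs b).exists_retraction hp hS (he b) hy h
  rw [map_add, piMap_frameSection (he a)] at hmem hΘ₀
  set q := D.piMap 𝕜 θ
  -- The parameter of the retraction is `q + ξ`: the acting vector `ξ` varies, while `q`,
  -- contributed by the element of `N` in the given identification, stays fixed in `Q`.
  let g : (Fin 3 → 𝕜) × (Fin 3 → ℂ) → (Fin 3 → 𝕜) × (Fin d → ℂ) := fun r => (q + r.1, s a r.2)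
  have hsa : ContDiffOn 𝕜 ∞ (fun r : (Fin 3 → 𝕜) × (Fin 3 → ℂ) => s a r.2) (univ ×ˢ V a) :=
    (hs a).smooth.comp contDiffOn_snd fun r hr => hr.2
  have hg : ContDiffOn 𝕜 ∞ g (univ ×ˢ V a) :=
    (contDiffOn_const.add contDiffOn_fst).prodMk hsa
  have hopen : IsOpen (univ ×ˢ V a : Set ((Fin 3 → 𝕜) × (Fin 3 → ℂ))) :=
    isOpen_univ.prod (hs a).isOpen
  let W := (univ ×ˢ V a) ∩ g ⁻¹' O
  have hWs : W ⊆ univ ×ˢ V a := inter_subset_left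
  have hΘg : ContDiffOn 𝕜 ∞ (fun r => Θ (g r)) W := hΘ.comp (hg.mono hWs) fun r hr => hr.2
  refine ⟨W, fun r i => (expVec (Θ (g r)) * s a r.2) (e b i),
    hg.continuousOn.isOpen_inter_preimage hopen hO, ⟨⟨mem_univ _, hx⟩, hmem⟩, ?_, ?_, ?_⟩
  · refine contDiffOn_pi.2 fun i => ContDiffOn.mul ?_ (contDiffOn_pi.1 (hsa.mono hWs) _)
    exact contDiffOn_pi.1 ((contDiff_expVec (𝕜 := 𝕜) (d := d)).comp_contDiffOn hΘg) _
  · funext i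
    change (expVec (Θ (q + ξ, s a x)) * s a x) (e b i) = y i
    rw [hΘ₀, h, (hs b).apply_frame y hy]
  · rintro ⟨ξ', u⟩ ⟨⟨-, hu⟩, hO'⟩
    have h1 := (hR _ hO').1
    obtain ⟨h2, h3⟩ := (hR _ hO').2 ((hs a).mem u)
    refine ⟨hu, h2, ?_⟩
    rw [key]
    refine ToricData.mk_eq_mk_iff.2 ⟨Θ (g (ξ', u)) - D.frameSection 𝕜 (e a) ξ', ?_, ?_⟩
    · rw [map_sub, h1, piMap_frameSection (he a)]
      change q + ξ' - ξ' ∈ _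
      rwa [add_sub_cancel_right]
    · change expVec (Θ (g (ξ', u)) - D.frameSection 𝕜 (e a) ξ') *
        (expVec (D.frameSection 𝕜 (e a) ξ') * s a u) = _
      rw [← mul_assoc, ← expVec_add, sub_add_cancel]
      exact h3.symm

variable [IsScalarTower ℝ 𝕜 ℂ]

/-- The centre of a chart is fixed because every element of the quasitorus has a representative
supported on the frame, where the centre has zero coordinates. Centres are distinguished by their
zero sets, which are constant on orbits. If a fixed point had a nonzero coordinate in a chart,
rotating that coordinate would make every element of the circle a component of an element of the
countable chart group. -/
theorem bijOn_fixedPoints (hQ : D.Q = AddSubgroup.closure (range D.X)) (hp : IsPhaseSection p C)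
    (hs : ∀ a, D.IsSlice 𝕜 (e a) S C (V a) (s a))
    (hS : ∀ (θ : Fin d → 𝕜), ∀ w ∈ S, expVec θ * w ∈ S) (he : ∀ a, (D.frameMatrix (e a)).det ≠ 0)
    (hact : ∀ (t : Torus 𝕜 d) (z w : S), w.1 = t +ᵥ z.1 →
      D.bigPi 𝕜 t +ᵥ Quotient.mk (orbitSetoid (D.N 𝕜) S) z = Quotient.mk _ w)
    (hcov : ∀ w ∈ S, ∃ a, ∀ j ∉ range (e a), w j ≠ 0)
    (hinj : ∀ a b, range (e a) = range (e b) → a = b) :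
    BijOn (fun a => (D.sliceChart 𝕜 S (V a) (D.chartGroup (e a)) (s a) (hs a).mem).σ 0) univ
      {m | ∀ ξ : D.Quasitorus 𝕜, ξ +ᵥ m = m} := by
  refine ⟨fun a _ ξ => ?_, fun a _ b _ h => hinj a b ?_, fun m hm => ?_⟩
  · obtain ⟨ξ, rfl⟩ := QuotientAddGroup.mk_surjective ξ
    have := mk_vadd_mk hS hact (D.frameSection 𝕜 (e a) ξ) ⟨s a 0, (hs a).mem 0⟩
    rw [piMap_frameSection (he a)] at this
    refine this.trans ?_
    change _ = Quotient.mk _ _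
    congr 1
    refine Subtype.ext (funext fun j => ?_)
    simp only [Pi.mul_apply]
    by_cases hj : j ∈ range (e a)
    · obtain ⟨i, rfl⟩ := hj
      rw [(hs a).apply_frame 0 (hs a).zero_mem]
      simp
    · simp [expVec, frameSection_of_notMem _ hj]
  · obtain ⟨θ, -, h⟩ := ToricData.mk_eq_mk_iff.1 h
    change expVec θ * s a 0 = s b 0 at h
    have hz : ∀ a j, j ∈ range (e a) ↔ s a 0 j = 0 := by
      intro a j
      constructor
      · rintro ⟨i, rfl⟩
        rw [(hs a).apply_frame 0 (hs a).zero_mem, Pi.zero_apply]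
      · intro h0
        by_contra hj
        exact hp.ne_zero _ ((hs a).normal 0 (hs a).zero_mem j hj) h0
    ext j
    rw [hz, hz, ← h]
    simp [expVec_ne_zero]
  · obtain ⟨w, rfl⟩ := Quotient.exists_rep m
    obtain ⟨a, ha⟩ := hcov w w.2
    obtain ⟨z, hz, hzw⟩ := (hs a).mem_image_sliceChart (G := D.chartGroup (e a)) hp hS (he a) w ha
    change z ∈ V a at hz
    refine ⟨a, mem_univ a, ?_⟩
    rw [← hzw] at hm ⊢
    suffices z = 0 by rw [this]
    by_contra hne
    obtain ⟨k, hk⟩ := Function.ne_iff.1 hne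
    rw [Pi.zero_apply] at hk
    have hcount := countable_chartGroup hQ (he a)
    have hall : ∀ c : Circle, ∃ γ : D.chartGroup (e a), γ.1 k = c := by
      intro c
      obtain ⟨t, rfl⟩ := Circle.exp_surjective c
      let θ : Fin d → 𝕜 := Pi.single (e a k) (algebraMap ℝ 𝕜 (t / (2 * Real.pi)))
      have hi := injective_of_det_frameMatrix (he a)
      have h1 : ∀ j ∉ range (e a), expVec θ j = 1 := by
        intro j hj
        have : θ j = 0 := Pi.single_eq_of_ne (fun h => hj ⟨k, h.symm⟩) _
        simp [expVec, this]
      have h2 := mk_vadd_mk hS hact θ ⟨s a z, (hs a).mem z⟩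
      have h3 : Quotient.mk (orbitSetoid (D.N 𝕜) S) ⟨s a z, (hs a).mem z⟩ =
          Quotient.mk _ ⟨expVec θ * s a z, hS θ _ ((hs a).mem z)⟩ :=
        (hm _).symm.trans h2
      obtain ⟨h4, h5⟩ := (hs a).eq_apply_frame (hS θ _ ((hs a).mem z)) (fun j hj => by
        rw [Pi.mul_apply, h1 j hj, one_mul]
        exact (hs a).normal z hz j hj)
      have h6 : (⟨expVec θ * s a z, hS θ _ ((hs a).mem z)⟩ : S) =
          ⟨s a (fun i => (expVec θ * s a z) (e a i)), (hs a).mem _⟩ := Subtype.ext h5.symm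
      rw [h6] at h3
      obtain ⟨γ, hγ⟩ := ((hs a).mk_eq_mk_iff hp hS (he a) hz h4).1 h3
      refine ⟨γ, Circle.ext ?_⟩
      have h7 := congrFun hγ k
      rw [circle_smul_apply, Pi.mul_apply, (hs a).apply_frame z hz] at h7
      rw [mul_right_cancel₀ hk h7, Circle.coe_exp, expVec]
      simp only [θ, Pi.single_eq_same]
      rw [← IsScalarTower.algebraMap_apply, Complex.coe_algebraMap]
      congr 1
      have hp : (Real.pi : ℂ) ≠ 0 := by exact_mod_cast Real.pi_ne_zero
      push_cast
      field_simp
    -- The contradiction: the circle would be countable, yet the argument puts it in bijection with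
    -- an interval.
    have hc : Countable Circle :=
      Function.Surjective.countable (f := fun γ : D.chartGroup (e a) => γ.1 k) hall
    have hR : Countable (Ioc (-Real.pi) Real.pi) := Circle.argEquiv.symm.injective.countable
    have h1 := Cardinal.mk_le_aleph0_iff.2 hR
    rw [Cardinal.mk_Ioc_real (by linarith [Real.pi_pos])] at h1
    exact absurd h1 (not_le.2 Cardinal.aleph0_lt_continuum)

end ActionCharts

section DenseOrbit

variable {d : ℕ} {D : ToricData d} {S : Set (Fin d → ℂ)}
  [AddAction (D.Quasitorus ℂ) (Quotient (orbitSetoid (D.N ℂ) S))]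

/-- Logarithms show that the orbit of the class of `(1, …, 1)` consists of the classes of points
without zero coordinates. These points form an open dense set saturated under `N_ℂ`. -/
theorem exists_dense_open_orbit (hSo : IsOpen S)
    (hS : ∀ (θ : Fin d → ℂ), ∀ w ∈ S, expVec θ * w ∈ S) (h1 : (1 : Fin d → ℂ) ∈ S)
    {e : Fin 3 → Fin d} (he : (D.frameMatrix e).det ≠ 0)
    (hact : ∀ (t : Torus ℂ d) (z w : S), w.1 = t +ᵥ z.1 →
      D.bigPi ℂ t +ᵥ Quotient.mk (orbitSetoid (D.N ℂ) S) z = Quotient.mk _ w) :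
    ∃ x : Quotient (orbitSetoid (D.N ℂ) S), IsOpen (AddAction.orbit (D.Quasitorus ℂ) x) ∧
      Dense (AddAction.orbit (D.Quasitorus ℂ) x) := by
  have horb : AddAction.orbit (D.Quasitorus ℂ) (Quotient.mk (orbitSetoid (D.N ℂ) S) ⟨1, h1⟩) =
      Quotient.mk _ '' {w : S | ∀ j, w.1 j ≠ 0} := by
    ext m
    constructor
    · rintro ⟨q, rfl⟩
      obtain ⟨θ, rfl⟩ := exists_piMap_eq he q
      refine ⟨⟨expVec θ * 1, hS θ 1 h1⟩, fun j => ?_, (mk_vadd_mk hS hact θ ⟨1, h1⟩).symm⟩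
      simp [expVec_ne_zero]
    · rintro ⟨w, hw, rfl⟩
      let θ : Fin d → ℂ := fun j => Complex.log (w.1 j) / (2 * Real.pi * Complex.I)
      refine ⟨QuotientAddGroup.mk (D.piMap ℂ θ), (mk_vadd_mk hS hact θ ⟨1, h1⟩).trans ?_⟩
      congr 1
      refine Subtype.ext (funext fun j => ?_)
      simp only [Pi.mul_apply, Pi.one_apply, mul_one, expVec, θ, Algebra.algebraMap_self,
        RingHom.id_apply]
      rw [mul_div_cancel₀ _ Complex.two_pi_I_ne_zero, Complex.exp_log (hw j)]
  refine ⟨Quotient.mk _ ⟨1, h1⟩, ?_, ?_⟩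
  · rw [horb, ← isQuotientMap_quotient_mk'.isOpen_preimage]
    have : Quotient.mk (orbitSetoid (D.N ℂ) S) ⁻¹' (Quotient.mk _ '' {w : S | ∀ j, w.1 j ≠ 0}) =
        {w : S | ∀ j, w.1 j ≠ 0} := by
      refine Subset.antisymm ?_ (subset_preimage_image _ _)
      rintro w ⟨w', hw', h⟩ j hj
      obtain ⟨θ, -, h⟩ := ToricData.mk_eq_mk_iff.1 h.symm
      refine hw' j ?_
      rw [← h, Pi.mul_apply, hj, mul_zero]
    change IsOpen (Quotient.mk (orbitSetoid (D.N ℂ) S) ⁻¹' _)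
    rw [this]
    have h2 : {w : S | ∀ j, w.1 j ≠ 0} = ⋂ j, {w : S | w.1 j ≠ 0} := by
      ext w
      simp
    rw [h2]
    refine isOpen_iInter_of_finite fun j => ?_
    exact isOpen_ne_fun ((continuous_apply j).comp continuous_subtype_val) continuous_const
  · rw [horb]
    refine Function.Surjective.denseRange Quotient.mk_surjective |>.dense_image
      continuous_quotient_mk' ?_
    exact dense_forall_ne_zero.preimage hSo.isOpenMap_subtype_val

end DenseOrbit

end ToricData

namespace ToricData

/-! ### The level set and the open set -/

section LevelSet

variable {d : ℕ} {D : ToricData d}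

theorem sum_mul_dotProduct (θ : Fin d → ℝ) (μ : Fin 3 → ℝ) :
    ∑ j, θ j * (μ ⬝ᵥ D.X j) = μ ⬝ᵥ D.piMap ℝ θ := by
  simp only [dotProduct, piMap_apply, Finset.mul_sum]
  rw [Finset.sum_comm]
  refine Finset.sum_congr rfl fun k _ => Finset.sum_congr rfl fun j _ => ?_
  simp only [Algebra.algebraMap_self, RingHom.id_apply]
  ring

theorem mem_levelSet_iff_forall {z : Fin d → ℂ} :
    z ∈ D.levelSet ↔ ∀ θ : Fin d → ℝ, D.piMap ℝ θ = 0 → ∑ j, θ j * (‖z j‖ ^ 2 + D.lam j) = 0 := by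
  constructor
  · intro h θ hθ
    have := LinearMap.congr_fun (show D.Ψ z = 0 from h) ⟨θ, hθ⟩
    simpa [Ψ, J, Fintype.linearCombination_apply] using this
  · intro h
    change D.Ψ z = 0
    ext ⟨θ, hθ⟩
    simpa [Ψ, J, Fintype.linearCombination_apply] using h θ hθ

/-- A functional that vanishes on `ker π` factors through `π`, so `J(z) = μ ∘ π`; evaluation on the
standard basis gives the equations. Moduli on the level set are thus governed by a single point `μ`.
-/
theorem mem_levelSet_iff {z : Fin d → ℂ} :
    z ∈ D.levelSet ↔ ∃ μ : Fin 3 → ℝ, ∀ j, ‖z j‖ ^ 2 + D.lam j = μ ⬝ᵥ D.X j := by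
  constructor
  · intro h
    have h1 : D.J z ∈ (LinearMap.ker (D.piMap ℝ)).dualAnnihilator := by
      rw [Submodule.mem_dualAnnihilator]
      intro θ hθ
      have := mem_levelSet_iff_forall.1 h θ hθ
      simpa [J, Fintype.linearCombination_apply] using this
    rw [← LinearMap.range_dualMap_eq_dualAnnihilator_ker] at h1
    obtain ⟨g, hg⟩ := h1
    refine ⟨fun k => g (Pi.single k 1), fun j => ?_⟩
    have h2 := LinearMap.congr_fun hg (Pi.single j 1)
    have h3 : D.piMap ℝ (Pi.single j 1) = D.X j := by
      funext k
      simp [piMap_apply, Pi.single_apply]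
    have h4 : D.J z (Pi.single j 1) = ‖z j‖ ^ 2 + D.lam j := by
      simp [J, Fintype.linearCombination_apply, Pi.single_apply]
    rw [LinearMap.dualMap_apply, h3, h4] at h2
    rw [← h2]
    conv_lhs => rw [LinearMap.pi_apply_eq_sum_univ g (D.X j)]
    simp only [dotProduct, smul_eq_mul]
    refine Finset.sum_congr rfl fun k _ => ?_
    rw [mul_comm]
    congr 2
    funext i
    simp [Pi.single_apply, eq_comm]
  · rintro ⟨μ, h⟩
    refine mem_levelSet_iff_forall.2 fun θ hθ => ?_
    simp only [h]
    rw [sum_mul_dotProduct, hθ, dotProduct_zero]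

/-- Squares are nonnegative, so the point `μ` belonging to `z` lies in the polytope, and `z_j` can
vanish only where the `j`-th inequality is active. -/
theorem levelSet_subset_openSet : D.levelSet ⊆ D.openSet := by
  intro z hz
  obtain ⟨μ, hμ⟩ := mem_levelSet_iff.1 hz
  refine ⟨μ, fun j => ?_, fun j hj h0 => hj ?_⟩
  · have := hμ j
    nlinarith [sq_nonneg ‖z j‖]
  · have := hμ j
    rw [h0] at this
    change μ ⬝ᵥ D.X j = D.lam j
    simpa using this.symm

theorem isOpen_openSet : IsOpen D.openSet := by
  have : D.openSet = ⋃ μ ∈ D.polytope, ⋂ j, ⋂ (_ : j ∉ D.activeSet μ), {z | z j ≠ 0} := by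
    ext z
    simp [openSet]
  rw [this]
  refine isOpen_biUnion fun μ _ => isOpen_iInter_of_finite fun j => isOpen_iInter_of_finite fun _ => ?_
  exact isOpen_ne_fun (by fun_prop) continuous_const

theorem norm_expVec (θ : Fin d → ℝ) (j : Fin d) : ‖expVec θ j‖ = 1 := by
  have : (2 * Real.pi * Complex.I * algebraMap ℝ ℂ (θ j) : ℂ) =
      ((2 * Real.pi * θ j : ℝ) : ℂ) * Complex.I := by
    simp only [Complex.coe_algebraMap]; push_cast; ring
  rw [expVec, this, Complex.norm_exp_ofReal_mul_I]

theorem expVec_mul_mem_levelSet (θ : Fin d → ℝ) (w : Fin d → ℂ) (hw : w ∈ D.levelSet) :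
    expVec θ * w ∈ D.levelSet := by
  obtain ⟨μ, hμ⟩ := mem_levelSet_iff.1 hw
  refine mem_levelSet_iff.2 ⟨μ, fun j => ?_⟩
  rw [← hμ, Pi.mul_apply, norm_mul, norm_expVec, one_mul]

theorem expVec_mul_mem_openSet (θ : Fin d → ℂ) (w : Fin d → ℂ) (hw : w ∈ D.openSet) :
    expVec θ * w ∈ D.openSet := by
  obtain ⟨μ, hμ, h⟩ := hw
  exact ⟨μ, hμ, fun j hj => mul_ne_zero (expVec_ne_zero θ j) (h j hj)⟩

/-- Half the derivative of the moment equation `∑ β_j (|f_j|² + λ_j) = 0`. Both the transversality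
of the level slice and the invariance of the symplectic form rest on it. -/
theorem sum_mul_re_fderiv_eq_zero {f : (Fin 3 → ℂ) → Fin d → ℂ} {x : Fin 3 → ℂ}
    (hf : DifferentiableAt ℝ f x) (hlev : ∀ᶠ u in 𝓝 x, f u ∈ D.levelSet) {β : Fin d → ℝ}
    (hβ : D.piMap ℝ β = 0) (v : Fin 3 → ℂ) :
    ∑ j, β j * (starRingEnd ℂ (f x j) * fderiv ℝ f x v j).re = 0 := by
  have h1 : HasFDerivAt (fun u => ∑ j, β j * (‖f u j‖ ^ 2 + D.lam j)) _ x :=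
    HasFDerivAt.fun_sum (u := Finset.univ) fun j _ =>
      (((hasFDerivAt_pi'.1 hf.hasFDerivAt j).norm_sq).add_const (D.lam j)).const_mul (β j)
  have h2 : HasFDerivAt (fun u => ∑ j, β j * (‖f u j‖ ^ 2 + D.lam j))
      (0 : (Fin 3 → ℂ) →L[ℝ] ℝ) x :=
    (hasFDerivAt_const (0 : ℝ) x).congr_of_eventuallyEq
      (hlev.mono fun u hu => mem_levelSet_iff_forall.1 hu β hβ)
  have h3 := congrArg (fun L => L v) (h1.unique h2)
  simp only [_root_.sum_apply, _root_.smul_apply, ContinuousLinearMap.comp_apply,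
    ContinuousLinearMap.proj_apply, innerSL_apply_apply, Complex.inner, smul_eq_mul,
    _root_.zero_apply] at h3
  have h4 : ∑ j, β j * (2 * (starRingEnd ℂ (f x j) * fderiv ℝ f x v j).re) = 0 := by
    rw [← h3]
    refine Finset.sum_congr rfl fun j _ => ?_
    rw [nsmul_eq_mul, mul_comm (starRingEnd ℂ (f x j))]
    push_cast
    ring
  have h5 : ∑ j, β j * (2 * (starRingEnd ℂ (f x j) * fderiv ℝ f x v j).re) =
      2 * ∑ j, β j * (starRingEnd ℂ (f x j) * fderiv ℝ f x v j).re := by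
    rw [Finset.mul_sum]
    exact Finset.sum_congr rfl fun j _ => by ring
  linarith

theorem piMap_im {θ : Fin d → ℂ} (h : D.piMap ℂ θ = 0) : D.piMap ℝ (fun j => (θ j).im) = 0 := by
  funext k
  have := congrArg Complex.im (congrFun h k)
  rw [piMap_apply, Complex.im_sum] at this
  rw [piMap_apply]
  simpa using this

end LevelSet

/-! ### The slices at a vertex -/

/-- The three facets through the vertex `ν` are those with index in the range of `e`. -/
structure IsVertexFrame {d : ℕ} (D : ToricData d) (ν : Fin 3 → ℝ) (e : Fin 3 → Fin d) : Prop where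
  mem : ν ∈ D.polytope
  range_eq : range e = D.activeSet ν
  det_ne_zero : (D.frameMatrix e).det ≠ 0

section VertexSlice

variable {d : ℕ} {D : ToricData d} {e : Fin 3 → Fin d} {ν : Fin 3 → ℝ}

theorem IsVertexFrame.injective (h : D.IsVertexFrame ν e) : Function.Injective e :=
  injective_of_det_frameMatrix h.det_ne_zero

theorem extend_one_mem_openSet (h : D.IsVertexFrame ν e) (z : Fin 3 → ℂ) :
    Function.extend e z (fun _ => 1) ∈ D.openSet := by
  refine ⟨ν, h.mem, fun j hj => ?_⟩
  rw [← h.range_eq] at hj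
  rw [Function.extend_apply' _ _ _ hj]
  exact one_ne_zero

theorem isSlice_extend_one (h : D.IsVertexFrame ν e) :
    D.IsSlice ℂ e D.openSet {1} univ (fun z => Function.extend e z fun _ => 1) where
  domain := ⟨univ, isOpen_univ, convex_univ, mem_univ _, by simp⟩
  smooth := by
    refine contDiffOn_pi.2 fun j => ?_
    by_cases hj : j ∈ range e
    · obtain ⟨i, rfl⟩ := hj
      simp only [h.injective.extend_apply]
      exact (contDiff_apply ℂ ℂ i).contDiffOn
    · simp only [Function.extend_apply' _ _ _ hj]
      exact contDiffOn_const
  mem := extend_one_mem_openSet h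
  apply_frame z _ i := h.injective.extend_apply _ _ _
  normal z _ j hj := Function.extend_apply' _ _ _ hj
  exhausts w _ hC := by
    refine ⟨w ∘ e, mem_univ _, funext fun j => ?_⟩
    by_cases hj : j ∈ range e
    · obtain ⟨i, rfl⟩ := hj
      exact h.injective.extend_apply _ _ _
    · rw [Function.extend_apply' _ _ _ hj]
      exact (hC j hj).symm
  transverse := by
    rintro z - v ⟨θ, hθ, hv⟩
    have hd : HasFDerivAt (fun z : Fin 3 → ℂ => Function.extend e z fun _ => (1 : ℂ))
        (ContinuousLinearMap.pi fun j => if hj : ∃ i, e i = j then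
          (ContinuousLinearMap.proj hj.choose : (Fin 3 → ℂ) →L[ℝ] ℂ) else 0) z := by
      refine hasFDerivAt_pi.2 fun j => ?_
      by_cases hj : ∃ i, e i = j
      · rw [dif_pos hj]
        obtain ⟨i, hi⟩ := id hj
        have : hj.choose = i := h.injective (hj.choose_spec.trans hi.symm)
        rw [this]
        subst hi
        simp only [h.injective.extend_apply]
        exact (ContinuousLinearMap.proj i : (Fin 3 → ℂ) →L[ℝ] ℂ).hasFDerivAt
      · rw [dif_neg hj]
        simp only [Function.extend_apply' _ _ _ hj]
        exact hasFDerivAt_const _ _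
    rw [hd.fderiv] at hv
    -- Off the frame this slice is constantly `1`, so an orbit direction tangent to it has `θ_j = 0`
    -- there.
    have h0 : ∀ j ∉ range e, θ j = 0 := by
      intro j hj
      have := congrFun hv j
      simp only [LinearMap.pi_apply, LinearMap.smul_apply, LinearMap.proj_apply, smul_eq_mul,
        ContinuousLinearMap.pi_apply, Function.extend_apply' _ _ _ hj, mul_one] at this
      rw [dif_neg (show ¬∃ i, e i = j from hj), _root_.zero_apply] at this
      exact (mul_eq_zero.1 this).resolve_left Complex.two_pi_I_ne_zero
    have h1 := eq_zero_of_piMap_eq_zero h.det_ne_zero h0 hθ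
    funext i
    have := congrFun hv (e i)
    have hex : ∃ i', e i' = e i := ⟨i, rfl⟩
    have hch : hex.choose = i := h.injective hex.choose_spec
    rw [h1, map_zero] at this
    simp only [ContinuousLinearMap.pi_apply] at this
    rw [dif_pos hex, hch] at this
    exact this.symm

/-- The point `μ` with `⟨μ, X_{e i}⟩ = λ_{e i} + r_i`. -/
noncomputable def framePoint (D : ToricData d) (e : Fin 3 → Fin d) (r : Fin 3 → ℝ) : Fin 3 → ℝ :=
  (D.frameMatrix e)⁻¹ *ᵥ fun i => D.lam (e i) + r i

theorem eq_framePoint_iff (he : (D.frameMatrix e).det ≠ 0) {μ r : Fin 3 → ℝ} :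
    μ = D.framePoint e r ↔ ∀ i, μ ⬝ᵥ D.X (e i) = D.lam (e i) + r i := by
  have hu := isUnit_iff_ne_zero.2 he
  have h1 : ∀ i, (D.frameMatrix e *ᵥ μ) i = μ ⬝ᵥ D.X (e i) := by
    intro i
    rw [Matrix.mulVec, dotProduct_comm]
    rfl
  constructor
  · rintro rfl i
    rw [← h1, framePoint, Matrix.mulVec_mulVec, Matrix.mul_nonsing_inv _ hu, Matrix.one_mulVec]
  · intro h
    have : (fun i => D.lam (e i) + r i) = D.frameMatrix e *ᵥ μ := by
      funext i
      rw [h1, h]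
    rw [framePoint, this, Matrix.mulVec_mulVec, Matrix.nonsing_inv_mul _ hu, Matrix.one_mulVec]

/-- Exhibits the pairing as an affine function of `r`, from which openness and convexity of
`frameCone` and smoothness of `levelSquare` are read off. -/
theorem framePoint_dotProduct (r : Fin 3 → ℝ) (x : Fin 3 → ℝ) :
    D.framePoint e r ⬝ᵥ x
      = ∑ i, (x ᵥ* (D.frameMatrix e)⁻¹) i * (D.lam (e i) + r i) := by
  rw [framePoint, dotProduct_comm, Matrix.dotProduct_mulVec]
  rfl

/-- The open set of all `r` such that `framePoint e r` satisfies the strict inequalities of the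
facets that are not in the frame. -/
def frameCone (D : ToricData d) (e : Fin 3 → Fin d) : Set (Fin 3 → ℝ) :=
  {r | ∀ j ∉ range e, D.lam j < D.framePoint e r ⬝ᵥ D.X j}

/-- The domain of the slice of the level set. -/
def levelDomain (D : ToricData d) (e : Fin 3 → Fin d) : Set (Fin 3 → ℂ) :=
  {z | (fun i => ‖z i‖ ^ 2) ∈ D.frameCone e}

/-- The moment coordinates of the slice of the level set. -/
noncomputable def levelSquare (D : ToricData d) (e : Fin 3 → Fin d) (z : Fin 3 → ℂ) (j : Fin d) : ℝ :=
  (D.framePoint e fun i => ‖z i‖ ^ 2) ⬝ᵥ D.X j - D.lam j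

open Classical in
/-- The slice of the level set; off its domain it is constant. -/
noncomputable def levelSlice (D : ToricData d) (e : Fin 3 → Fin d) (z : Fin 3 → ℂ) : Fin d → ℂ :=
  if z ∈ D.levelDomain e then Function.extend e z fun j => (Real.sqrt (D.levelSquare e z j) : ℂ)
  else Function.extend e 0 fun j => (Real.sqrt (D.levelSquare e 0 j) : ℂ)

theorem levelSlice_of_mem {z : Fin 3 → ℂ} (hz : z ∈ D.levelDomain e) :
    D.levelSlice e z = Function.extend e z fun j => (Real.sqrt (D.levelSquare e z j) : ℂ) :=
  if_pos hz

theorem contDiff_levelSquare (j : Fin d) : ContDiff ℝ ∞ fun z => D.levelSquare e z j := by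
  unfold levelSquare
  simp only [framePoint_dotProduct]
  refine ContDiff.sub (ContDiff.sum fun i _ => ?_) contDiff_const
  exact contDiff_const.mul (contDiff_const.add ((contDiff_apply ℝ ℂ i).norm_sq ℝ))

theorem isOpen_frameCone : IsOpen (D.frameCone e) := by
  have : D.frameCone e = ⋂ j, ⋂ (_ : j ∉ range e), {r | D.lam j < D.framePoint e r ⬝ᵥ D.X j} := by
    ext r
    simp [frameCone]
  rw [this]
  refine isOpen_iInter_of_finite fun j => isOpen_iInter_of_finite fun _ => ?_
  simp only [framePoint_dotProduct]
  exact isOpen_lt continuous_const (by fun_prop)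

theorem convex_frameCone : Convex ℝ (D.frameCone e) := by
  intro a ha b hb x y hx hy hxy j hj
  have h1 := ha j hj
  have h2 := hb j hj
  have h3 : D.framePoint e (x • a + y • b) ⬝ᵥ D.X j =
      x * (D.framePoint e a ⬝ᵥ D.X j) + y * (D.framePoint e b ⬝ᵥ D.X j) := by
    simp only [framePoint_dotProduct]
    rw [Finset.mul_sum, Finset.mul_sum, ← Finset.sum_add_distrib]
    refine Finset.sum_congr rfl fun i _ => ?_
    simp only [Pi.add_apply, Pi.smul_apply, smul_eq_mul]
    linear_combination (-(D.X j ᵥ* (D.frameMatrix e)⁻¹) i * D.lam (e i)) * hxy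
  rw [h3]
  rcases hx.eq_or_lt with rfl | hx'
  · have : y = 1 := by linarith
    subst this
    simpa using h2
  · have := mul_lt_mul_of_pos_left h1 hx'
    have := mul_le_mul_of_nonneg_left h2.le hy
    have : x * D.lam j + y * D.lam j = D.lam j := by rw [← add_mul, hxy, one_mul]
    linarith

theorem IsVertexFrame.framePoint_zero (h : D.IsVertexFrame ν e) : D.framePoint e 0 = ν := by
  refine ((eq_framePoint_iff h.det_ne_zero).2 fun i => ?_).symm
  have : e i ∈ D.activeSet ν := h.range_eq ▸ mem_range_self i
  rw [Pi.zero_apply, add_zero]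
  exact this

theorem IsVertexFrame.zero_mem_frameCone (h : D.IsVertexFrame ν e) : 0 ∈ D.frameCone e := by
  intro j hj
  rw [h.framePoint_zero]
  rw [h.range_eq] at hj
  exact lt_of_le_of_ne (h.mem j) fun h' => hj h'.symm

theorem IsVertexFrame.zero_mem_levelDomain (h : D.IsVertexFrame ν e) : 0 ∈ D.levelDomain e := by
  have := h.zero_mem_frameCone
  simpa [levelDomain, ← Pi.zero_def] using this

theorem extend_levelSquare_mem (h : D.IsVertexFrame ν e) {z : Fin 3 → ℂ}
    (hz : z ∈ D.levelDomain e) :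
    (Function.extend e z fun j => (Real.sqrt (D.levelSquare e z j) : ℂ)) ∈ D.levelSet := by
  refine mem_levelSet_iff.2 ⟨D.framePoint e fun i => ‖z i‖ ^ 2, fun j => ?_⟩
  by_cases hj : j ∈ range e
  · obtain ⟨i, rfl⟩ := hj
    rw [h.injective.extend_apply, (eq_framePoint_iff h.det_ne_zero).1 rfl i, add_comm]
  · rw [Function.extend_apply' _ _ _ hj, Complex.norm_real, Real.norm_of_nonneg (Real.sqrt_nonneg _),
      levelSquare, Real.sq_sqrt (sub_nonneg.2 (hz j hj).le), sub_add_cancel]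

theorem levelSlice_mem (h : D.IsVertexFrame ν e) (z : Fin 3 → ℂ) :
    D.levelSlice e z ∈ D.levelSet := by
  unfold levelSlice
  split_ifs with hz
  · exact extend_levelSquare_mem h hz
  · exact extend_levelSquare_mem h h.zero_mem_levelDomain

theorem isOpen_levelDomain : IsOpen (D.levelDomain e) :=
  isOpen_frameCone.preimage (by fun_prop)

theorem contDiffOn_levelSlice (h : D.IsVertexFrame ν e) :
    ContDiffOn ℝ ∞ (D.levelSlice e) (D.levelDomain e) := by
  refine ContDiffOn.congr ?_ fun z hz => levelSlice_of_mem hz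
  refine contDiffOn_pi.2 fun j => ?_
  by_cases hj : j ∈ range e
  · obtain ⟨i, rfl⟩ := hj
    simp only [h.injective.extend_apply]
    exact (contDiff_apply ℝ ℂ i).contDiffOn
  · simp only [Function.extend_apply' _ _ _ hj]
    refine Complex.ofRealCLM.contDiff.comp_contDiffOn ?_
    exact (contDiff_levelSquare j).contDiffOn.sqrt fun z hz => (sub_pos.2 (hz j hj)).ne'

theorem differentiableAt_levelSlice (h : D.IsVertexFrame ν e) {z : Fin 3 → ℂ}
    (hz : z ∈ D.levelDomain e) : DifferentiableAt ℝ (D.levelSlice e) z :=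
  ((contDiffOn_levelSlice h).contDiffAt (isOpen_levelDomain.mem_nhds hz)).differentiableAt (by simp)

theorem levelSlice_apply_frame (h : D.IsVertexFrame ν e) {z : Fin 3 → ℂ}
    (hz : z ∈ D.levelDomain e) (i : Fin 3) : D.levelSlice e z (e i) = z i := by
  rw [levelSlice_of_mem hz, h.injective.extend_apply]

theorem exists_pos_levelSlice {z : Fin 3 → ℂ} (hz : z ∈ D.levelDomain e) {j : Fin d}
    (hj : j ∉ range e) : ∃ r : ℝ, 0 < r ∧ D.levelSlice e z j = r := by
  rw [levelSlice_of_mem hz, Function.extend_apply' _ _ _ hj]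
  exact ⟨_, Real.sqrt_pos.2 (sub_pos.2 (hz j hj)), rfl⟩

theorem fderiv_levelSlice_frame (h : D.IsVertexFrame ν e) {z : Fin 3 → ℂ}
    (hz : z ∈ D.levelDomain e) (v : Fin 3 → ℂ) (i : Fin 3) :
    fderiv ℝ (D.levelSlice e) z v (e i) = v i := by
  have h1 := hasFDerivAt_pi'.1 (differentiableAt_levelSlice h hz).hasFDerivAt (e i)
  have h2 : HasFDerivAt (fun u => D.levelSlice e u (e i))
      (ContinuousLinearMap.proj i : (Fin 3 → ℂ) →L[ℝ] ℂ) z := by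
    refine (ContinuousLinearMap.proj i : (Fin 3 → ℂ) →L[ℝ] ℂ).hasFDerivAt
      |>.congr_of_eventuallyEq ?_
    filter_upwards [isOpen_levelDomain.mem_nhds hz] with u hu
    exact levelSlice_apply_frame h hu i
  exact congrArg (fun L => L v) (h1.unique h2)

theorem im_fderiv_levelSlice (h : D.IsVertexFrame ν e) {z : Fin 3 → ℂ}
    (hz : z ∈ D.levelDomain e) (v : Fin 3 → ℂ) {j : Fin d} (hj : j ∉ range e) :
    (fderiv ℝ (D.levelSlice e) z v j).im = 0 := by
  have h1 := Complex.imCLM.hasFDerivAt.comp z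
    (hasFDerivAt_pi'.1 (differentiableAt_levelSlice h hz).hasFDerivAt j)
  have h2 : HasFDerivAt (fun u => Complex.imCLM (D.levelSlice e u j))
      (0 : (Fin 3 → ℂ) →L[ℝ] ℝ) z := by
    refine (hasFDerivAt_const (0 : ℝ) z).congr_of_eventuallyEq ?_
    filter_upwards [isOpen_levelDomain.mem_nhds hz] with u hu
    obtain ⟨r, -, hr⟩ := exists_pos_levelSlice hu hj
    rw [hr]
    simp
  exact congrArg (fun L => L v) (h1.unique h2)

/-- The frame coordinates of a point of the level set determine its `μ`, hence all moduli, and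
positivity off the frame removes the remaining ambiguity. Transversality is proved against
`N_ℂ`-orbits, not merely `N`-orbits. -/
theorem isSlice_levelSlice (h : D.IsVertexFrame ν e) :
    D.IsSlice ℝ e D.levelSet {x | ∃ r : ℝ, 0 < r ∧ x = r} (D.levelDomain e) (D.levelSlice e) where
  domain := ⟨_, isOpen_frameCone, convex_frameCone, h.zero_mem_frameCone, rfl⟩
  smooth := contDiffOn_levelSlice h
  mem := levelSlice_mem h
  apply_frame z hz i := levelSlice_apply_frame h hz i
  normal z hz j hj := exists_pos_levelSlice hz hj
  exhausts w hw hC := by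
    obtain ⟨μ, hμ⟩ := mem_levelSet_iff.1 hw
    have h1 : μ = D.framePoint e fun i => ‖(w ∘ e) i‖ ^ 2 :=
      (eq_framePoint_iff h.det_ne_zero).2 fun i => by
        rw [← hμ, add_comm]
        rfl
    have h2 : w ∘ e ∈ D.levelDomain e := by
      intro j hj
      rw [← h1, ← hμ]
      obtain ⟨r, hr, hw⟩ := hC j hj
      rw [hw, Complex.norm_real, Real.norm_of_nonneg hr.le]
      have : 0 < r ^ 2 := by positivity
      linarith
    refine ⟨w ∘ e, h2, funext fun j => ?_⟩
    rw [levelSlice_of_mem h2]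
    by_cases hj : j ∈ range e
    · obtain ⟨i, rfl⟩ := hj
      exact h.injective.extend_apply _ _ _
    · rw [Function.extend_apply' _ _ _ hj, levelSquare, ← h1, ← hμ]
      obtain ⟨r, hr, hw⟩ := hC j hj
      rw [hw, Complex.norm_real, Real.norm_of_nonneg hr.le, add_sub_cancel_right, Real.sqrt_sq hr.le]
  transverse := by
    rintro z hz v ⟨θ, hθ, hv⟩
    have hL : ∀ j, fderiv ℝ (D.levelSlice e) z v j =
        2 * Real.pi * Complex.I * D.levelSlice e z j * θ j := fun j => (congrFun hv j).symm
    have hβ := piMap_im hθ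
    -- For an orbit direction `θ`, the derivative of the moment equation paired with `Im θ ∈ ker π`
    -- is a negative multiple of `∑ (Im θ_j)² |z_j|²`. So `Im θ_j = 0` wherever the coordinate is
    -- nonzero; off the frame the slice is real, which kills `Re θ_j` as well.
    have h1 := sum_mul_re_fderiv_eq_zero (differentiableAt_levelSlice h hz)
      (Filter.Eventually.of_forall (levelSlice_mem h)) hβ v
    have h2 : ∀ j, (θ j).im * (starRingEnd ℂ (D.levelSlice e z j) *
        fderiv ℝ (D.levelSlice e) z v j).re =
        -(2 * Real.pi * ((θ j).im ^ 2 * Complex.normSq (D.levelSlice e z j))) := by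
      intro j
      rw [hL]
      simp [Complex.normSq_apply]
      ring
    simp only [h2] at h1
    rw [Finset.sum_neg_distrib, neg_eq_zero, ← Finset.mul_sum] at h1
    have h3 := (mul_eq_zero.1 h1).resolve_left Real.two_pi_pos.ne'
    rw [Finset.sum_eq_zero_iff_of_nonneg fun j _ =>
      mul_nonneg (sq_nonneg _) (Complex.normSq_nonneg _)] at h3
    have h4 : ∀ j ∉ range e, θ j = 0 := by
      intro j hj
      obtain ⟨r, hr, hw⟩ := exists_pos_levelSlice hz hj
      have h5 := h3 j (Finset.mem_univ j)
      have h6 := im_fderiv_levelSlice h hz v hj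
      rw [hL] at h6
      rw [hw] at h5 h6
      have h7 : (θ j).im = 0 := by simpa [hr.ne'] using h5
      have h8 : (θ j).re = 0 := by
        simpa [hr.ne', Real.pi_ne_zero] using h6
      exact Complex.ext h8 h7
    have h5 := eq_zero_of_piMap_eq_zero h.det_ne_zero h4 hθ
    funext i
    rw [← fderiv_levelSlice_frame h hz v i, hL, h5]
    simp

end VertexSlice

end ToricData

namespace ToricData

/-! ### The symplectic form -/

section Symplectic

variable {d : ℕ} {D : ToricData d} {e : Fin 3 → Fin d} {ν : Fin 3 → ℝ}

theorem standardForm_apply (d : ℕ) (v : Fin 2 → Fin d → ℂ) :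
    standardForm d v =
      (1 / Real.pi) * ∑ j, ((v 0 j).im * (v 1 j).re - (v 0 j).re * (v 1 j).im) := rfl

/-- Coordinates off the frame are real-valued and contribute nothing to the form; on the frame the
slice is the identity. -/
theorem standardForm_comp_fderiv_levelSlice (h : D.IsVertexFrame ν e) {z : Fin 3 → ℂ}
    (hz : z ∈ D.levelDomain e) :
    (standardForm d).compContinuousLinearMap (fderiv ℝ (D.levelSlice e) z) = standardForm 3 := by
  ext v
  rw [ContinuousAlternatingMap.compContinuousLinearMap_apply, standardForm_apply,
    standardForm_apply]
  congr 1
  refine (Fintype.sum_of_injective e h.injective _ _ (fun j hj => ?_) fun i => ?_).symm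
  · simp [im_fderiv_levelSlice h hz _ hj]
  · simp [fderiv_levelSlice_frame h hz]

theorem standardForm_nondegenerate (d : ℕ) (u : Fin d → ℂ)
    (h : ∀ v, standardForm d ![u, v] = 0) : u = 0 := by
  -- Pairing `u` with `iu` gives a nonzero multiple of `∑ |u_j|²`.
  have h1 := h fun j => Complex.I * u j
  rw [standardForm_apply] at h1
  have h2 := (mul_eq_zero.1 h1).resolve_left (by positivity)
  have h3 : ∑ j, Complex.normSq (u j) = 0 := by
    rw [← neg_eq_zero, ← Finset.sum_neg_distrib, ← h2]
    refine Finset.sum_congr rfl fun j _ => ?_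
    simp [Complex.normSq_apply]
    ring
  rw [Finset.sum_eq_zero_iff_of_nonneg fun j _ => Complex.normSq_nonneg _] at h3
  funext j
  exact Complex.normSq_eq_zero.1 (h3 j (Finset.mem_univ j))

/-- The level slices turn the claim into one about `e^{2πiΘ} s`. The unit factors preserve the form,
and the extra terms from `dΘ` vanish because `dΘ` takes values in `ker π`, on which the differential
of the moment map of the level set is zero. -/
theorem standardForm_comp_of_lift {e' : Fin 3 → Fin d} {ν' : Fin 3 → ℝ} (h : D.IsVertexFrame ν e)
    (h' : D.IsVertexFrame ν' e') {f : (Fin 3 → ℂ) → Fin 3 → ℂ} {Θ : (Fin 3 → ℂ) → Fin d → ℝ}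
    {u : Fin 3 → ℂ} (hu : u ∈ D.levelDomain e) (hfu : f u ∈ D.levelDomain e')
    (hf : DifferentiableAt ℝ f u) (hΘ : DifferentiableAt ℝ Θ u) {ξ : Fin 3 → ℝ}
    (hlift : ∀ᶠ x in 𝓝 u, D.piMap ℝ (Θ x) = ξ ∧
      D.levelSlice e' (f x) = expVec (Θ x) * D.levelSlice e x) :
    (standardForm 3).compContinuousLinearMap (fderiv ℝ f u) = standardForm 3 := by
  set s := D.levelSlice e with hs
  have hsd : DifferentiableAt ℝ s u := differentiableAt_levelSlice h hu
  have h1 : HasFDerivAt (fun x => D.levelSlice e' (f x))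
      ((fderiv ℝ (D.levelSlice e') (f u)).comp (fderiv ℝ f u)) u :=
    (differentiableAt_levelSlice h' hfu).hasFDerivAt.comp u hf.hasFDerivAt
  have h2 : ∀ j v, fderiv ℝ (D.levelSlice e') (f u) (fderiv ℝ f u v) j =
      expVec (Θ u) j * (fderiv ℝ s u v j + 2 * Real.pi * Complex.I * s u j * (fderiv ℝ Θ u v j : ℝ)) := by
    intro j v
    have h3 : HasFDerivAt (fun x => (Θ x j : ℂ)) _ u :=
      (Complex.ofRealCLM.hasFDerivAt).comp u (hasFDerivAt_pi'.1 hΘ.hasFDerivAt j)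
    have h4 := (h3.const_mul (2 * Real.pi * Complex.I : ℂ)).cexp.mul
      (hasFDerivAt_pi'.1 hsd.hasFDerivAt j)
    have h5 := (hasFDerivAt_pi'.1 h1 j).congr_of_eventuallyEq
      (hlift.mono fun x hx => (congrFun hx.2 j).symm)
    have h6 := congrArg (fun L => L v) (h4.unique h5)
    simp only [_root_.add_apply, _root_.smul_apply, ContinuousLinearMap.comp_apply,
      ContinuousLinearMap.proj_apply, smul_eq_mul, Complex.ofRealCLM_apply] at h6
    rw [← h6, expVec, Complex.coe_algebraMap]
    ring
  have h3 : ∀ v, D.piMap ℝ (fderiv ℝ Θ u v) = 0 := by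
    intro v
    have h4 : HasFDerivAt (fun x => D.piMap ℝ (Θ x))
        ((LinearMap.toContinuousLinearMap (D.piMap ℝ)).comp (fderiv ℝ Θ u)) u :=
      (LinearMap.toContinuousLinearMap (D.piMap ℝ)).hasFDerivAt.comp u hΘ.hasFDerivAt
    have h5 : HasFDerivAt (fun x => D.piMap ℝ (Θ x)) (0 : (Fin 3 → ℂ) →L[ℝ] (Fin 3 → ℝ)) u :=
      (hasFDerivAt_const ξ u).congr_of_eventuallyEq (hlift.mono fun x hx => hx.1)
    exact congrArg (fun L => L v) (h4.unique h5)
  have h4 : ∀ v w, ∑ j, fderiv ℝ Θ u v j * (starRingEnd ℂ (s u j) * fderiv ℝ s u w j).re = 0 :=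
    fun v w => sum_mul_re_fderiv_eq_zero hsd (Filter.Eventually.of_forall (levelSlice_mem h)) (h3 v) w
  rw [← standardForm_comp_fderiv_levelSlice h' hfu]
  nth_rewrite 2 [standardForm_comp_fderiv_levelSlice h' hfu]
  rw [← standardForm_comp_fderiv_levelSlice h hu]
  ext v
  simp only [ContinuousAlternatingMap.compContinuousLinearMap_apply, standardForm_apply,
    Function.comp_apply, h2]
  congr 1
  have h5 : ∀ j, (expVec (Θ u) j).re ^ 2 + (expVec (Θ u) j).im ^ 2 = 1 := by
    intro j
    have := Complex.sq_norm (expVec (Θ u) j)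
    rw [norm_expVec, Complex.normSq_apply] at this
    linarith
  -- The two mixed terms in `dΘ` and `ds`, written as a quantity known to be zero. The term
  -- quadratic in `dΘ` vanishes coordinate by coordinate.
  have h6 := congrArg₂ (fun p q : ℝ => 2 * Real.pi * (p - q)) (h4 (v 0) (v 1)) (h4 (v 1) (v 0))
  simp only [sub_self, mul_zero] at h6
  refine Eq.trans ?_ (add_zero _)
  rw [← h6, ← Finset.sum_sub_distrib, Finset.mul_sum, ← Finset.sum_add_distrib]
  refine Finset.sum_congr rfl fun j _ => ?_
  set E := expVec (Θ u) j
  simp only [← hs, Complex.mul_re, Complex.mul_im, Complex.add_re, Complex.add_im, Complex.ofReal_re,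
    Complex.ofReal_im, Complex.I_re, Complex.I_im, Complex.conj_re, Complex.conj_im, Complex.re_ofNat,
    Complex.im_ofNat]
  have h7 := h5 j
  set a := E.re
  set b := E.im
  set x := (s u j).re
  set y := (s u j).im
  -- Multiplication by the unit number `a + bi` preserves the area form on one coordinate.
  have key : ∀ P Q R T : ℝ, (a * Q + b * P) * (a * R - b * T) - (a * P - b * Q) * (a * T + b * R) =
      Q * R - P * T := by
    intro P Q R T
    linear_combination (Q * R - P * T) * h7
  rw [key]
  ring

end Symplectic

end ToricData

namespace ToricData

/-! ### The orbits of `N_ℂ` and the level set -/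

section KempfNess

variable {d : ℕ} {D : ToricData d}

theorem piMap_re_apply (θ : Fin d → ℂ) (k : Fin 3) :
    D.piMap ℝ (fun j => (θ j).re) k = (D.piMap ℂ θ k).re := by
  rw [piMap_apply, piMap_apply, Complex.re_sum]
  simp

theorem piMap_im_apply (θ : Fin d → ℂ) (k : Fin 3) :
    D.piMap ℝ (fun j => (θ j).im) k = (D.piMap ℂ θ k).im := by
  rw [piMap_apply, piMap_apply, Complex.im_sum]
  simp

theorem norm_expVec_complex (θ : Fin d → ℂ) (j : Fin d) :
    ‖expVec θ j‖ = Real.exp (-(2 * Real.pi * (θ j).im)) := by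
  rw [expVec, Complex.norm_exp]
  simp

/-- The factor `e^{-2πb}` is at most `1` for `b ≥ 0` and at least `1` for `b ≤ 0`, so the bracket
never has the sign of `b`. -/
theorem mul_sub_exp_nonpos (b r : ℝ) (hr : 0 ≤ r) :
    b * ((Real.exp (-(2 * Real.pi * b)) * r) ^ 2 - r ^ 2) ≤ 0 := by
  have hE : 0 < Real.exp (-(2 * Real.pi * b)) := Real.exp_pos _
  rcases le_total 0 b with hb | hb
  · have h1 : Real.exp (-(2 * Real.pi * b)) ≤ 1 :=
      Real.exp_le_one_iff.2 (by have := Real.pi_pos; have := mul_nonneg this.le hb; linarith)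
    have h2 : (Real.exp (-(2 * Real.pi * b)) * r) ^ 2 ≤ r ^ 2 :=
      pow_le_pow_left₀ (by positivity) (mul_le_of_le_one_left hr h1) 2
    exact mul_nonpos_of_nonneg_of_nonpos hb (by linarith)
  · have h1 : 1 ≤ Real.exp (-(2 * Real.pi * b)) :=
      Real.one_le_exp (by have := Real.pi_pos; have := mul_nonneg this.le (neg_nonneg.2 hb); linarith)
    have h2 : r ^ 2 ≤ (Real.exp (-(2 * Real.pi * b)) * r) ^ 2 :=
      pow_le_pow_left₀ hr (le_mul_of_one_le_left hr h1) 2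
    exact mul_nonpos_of_nonpos_of_nonneg hb (by linarith)

/-- The uniqueness half of Kempf–Ness. As `π(θ)` is real, `Im θ ∈ ker π`, and the moment equations
of `w` and `w'` give `∑ Im θ_j (|w'_j|² - |w_j|²) = 0`. All terms are nonpositive, so each is zero:
`Im θ_j = 0` or `w_j = 0`, and the real part of `θ` has the same effect as `θ`. -/
theorem exists_real_of_complex {w w' : Fin d → ℂ} (hw : w ∈ D.levelSet) (hw' : w' ∈ D.levelSet)
    {θ : Fin d → ℂ} (hθ : D.piMap ℂ θ ∈ D.quasilattice ℂ) (h : expVec θ * w = w') :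
    ∃ α : Fin d → ℝ, D.piMap ℝ α ∈ D.quasilattice ℝ ∧ expVec α * w = w' := by
  obtain ⟨q, hq, hqθ⟩ := mem_quasilattice.1 hθ
  refine ⟨fun j => (θ j).re, mem_quasilattice.2 ⟨q, hq, funext fun k => ?_⟩, ?_⟩
  · rw [piMap_re_apply, hqθ]
    simp
  · have hβ : D.piMap ℝ (fun j => (θ j).im) = 0 := by
      funext k
      rw [piMap_im_apply, hqθ]
      simp
    have h1 := mem_levelSet_iff_forall.1 hw _ hβ
    have h2 := mem_levelSet_iff_forall.1 hw' _ hβ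
    have h3 : ∑ j, (θ j).im * ((Real.exp (-(2 * Real.pi * (θ j).im)) * ‖w j‖) ^ 2 - ‖w j‖ ^ 2) = 0 := by
      rw [← sub_self (0 : ℝ)]
      nth_rewrite 1 [← h2]
      rw [← h1, ← Finset.sum_sub_distrib]
      refine Finset.sum_congr rfl fun j _ => ?_
      rw [← h, Pi.mul_apply, norm_mul, norm_expVec_complex]
      ring
    rw [Finset.sum_eq_zero_iff_of_nonpos fun j _ => mul_sub_exp_nonpos _ _ (norm_nonneg _)] at h3
    rw [← h]
    funext j
    rw [Pi.mul_apply, Pi.mul_apply]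
    rcases mul_eq_zero.1 (h3 j (Finset.mem_univ j)) with h4 | h4
    · congr 1
      have : ((θ j).re : ℂ) = θ j := Complex.ext (by simp) (by simp [h4])
      simp only [expVec, Complex.coe_algebraMap, this, Algebra.algebraMap_self, RingHom.id_apply]
    · by_cases hwj : w j = 0
      · rw [hwj, mul_zero, mul_zero]
      · have hn := norm_pos_iff.2 hwj
        rw [sub_eq_zero, sq_eq_sq₀ (by positivity) (by positivity)] at h4
        have h5 : Real.exp (-(2 * Real.pi * (θ j).im)) = 1 :=
          mul_right_cancel₀ hn.ne' (by rw [h4, one_mul])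
        rw [Real.exp_eq_one_iff, neg_eq_zero] at h5
        have h6 := (mul_eq_zero.1 h5).resolve_left Real.two_pi_pos.ne'
        congr 1
        have : ((θ j).re : ℂ) = θ j := Complex.ext (by simp) (by simp [h6])
        simp only [expVec, Complex.coe_algebraMap, this, Algebra.algebraMap_self, RingHom.id_apply]

/-- Linear growth in both directions. For `x ≥ 0` the linear term suffices; for `x ≤ 0` the
quadratic Taylor term of the exponential beats `2k|x|` up to a constant. -/
theorem exp_term_lower_bound {a c k x : ℝ} (hc : 0 < c) (hk : 0 ≤ k) (ha : 0 ≤ a)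
    (hak : k ≠ 0 → a ≠ 0) :
    k * |x| - 2 * k ^ 2 / (a * c) ≤ a * Real.exp (-(c * x)) / c + k * x := by
  have hE := Real.exp_pos (-(c * x))
  rcases eq_or_ne k 0 with rfl | hk0
  · simp only [zero_mul, ne_eq, OfNat.ofNat_ne_zero, not_false_eq_true, zero_pow, mul_zero,
      zero_div, sub_zero, add_zero]
    positivity
  have ha0 : 0 < a := lt_of_le_of_ne ha (hak hk0).symm
  rcases le_total 0 x with hx | hx
  · rw [abs_of_nonneg hx]
    have h1 : 0 ≤ 2 * k ^ 2 / (a * c) := by positivity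
    have h2 : 0 ≤ a * Real.exp (-(c * x)) / c := by positivity
    linarith
  · rw [abs_of_nonpos hx]
    have h1 : (-(c * x)) ^ 2 / 2 ≤ Real.exp (-(c * x)) := by
      have h2 : 0 ≤ -(c * x) := by
        have := mul_nonneg hc.le (neg_nonneg.2 hx)
        linarith
      have := Real.quadratic_le_exp_of_nonneg h2
      linarith
    have h3 : a * ((-(c * x)) ^ 2 / 2) / c ≤ a * Real.exp (-(c * x)) / c := by gcongr
    -- Completing the square is the source of the constant `2k²/(ac)`.
    have h4 : a * ((-(c * x)) ^ 2 / 2) / c + 2 * (k * x) + 2 * k ^ 2 / (a * c) =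
        a * c / 2 * (x + 2 * k / (a * c)) ^ 2 := by
      field_simp
      ring
    have h5 : 0 ≤ a * c / 2 * (x + 2 * k / (a * c)) ^ 2 := by positivity
    linarith

/-- The convex function on `ker π` whose critical points are the points of an `N_ℂ`-orbit in the
level set. -/
noncomputable def orbitPotential (a k : Fin d → ℝ) (β : Fin d → ℝ) : ℝ :=
  ∑ j, (a j * Real.exp (-(4 * Real.pi * β j)) / (4 * Real.pi) + k j * β j)

theorem continuous_orbitPotential (a k : Fin d → ℝ) : Continuous (orbitPotential a k) := by
  unfold orbitPotential
  fun_prop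

/-- The linear lower bound controls every coordinate off the frame, where `k_j > 0`, and on `ker π`
these coordinates determine the others through `adjust`. The sublevel set is therefore a closed
subset of the continuous image of a cube, hence compact. -/
theorem exists_isMin_orbitPotential {e : Fin 3 → Fin d} (he : (D.frameMatrix e).det ≠ 0)
    {a k : Fin d → ℝ} (ha : ∀ j, 0 ≤ a j) (hk : ∀ j, 0 ≤ k j)
    (hk' : ∀ j ∉ range e, k j ≠ 0) (hak : ∀ j, k j ≠ 0 → a j ≠ 0) :
    ∃ β : Fin d → ℝ, D.piMap ℝ β = 0 ∧
      ∀ β', D.piMap ℝ β' = 0 → orbitPotential a k β ≤ orbitPotential a k β' := by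
  classical
  let f := orbitPotential a k
  let c : ℝ := 4 * Real.pi
  have hc : 0 < c := by positivity
  let B : ℝ := ∑ j, 2 * k j ^ 2 / (a j * c)
  have hlow : ∀ β, ∑ j, k j * |β j| - B ≤ f β := by
    intro β
    rw [← Finset.sum_sub_distrib]
    exact Finset.sum_le_sum fun j _ => exp_term_lower_bound hc (hk j) (ha j) (hak j)
  have hlow' : ∀ β j, k j * |β j| ≤ f β + B := by
    intro β j
    have h1 := Finset.single_le_sum (f := fun j => k j * |β j|)
      (fun i _ => mul_nonneg (hk i) (abs_nonneg _)) (Finset.mem_univ j)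
    have h2 := hlow β
    linarith
  let R : ℝ := ∑ j, (f 0 + B) / k j
  have hB : 0 ≤ f 0 + B := by
    have := hlow 0
    simp only [Pi.zero_apply, abs_zero, mul_zero, Finset.sum_const_zero, zero_sub] at this
    linarith
  let K : Set (Fin d → ℝ) := {β | D.piMap ℝ β = 0 ∧ f β ≤ f 0}
  have hKc : IsCompact K := by
    have h1 : IsCompact ((fun c => D.adjust e (0 : Fin 3 → ℝ) c) '' Icc (fun _ => -R) fun _ => R) :=
      isCompact_Icc.image ((contDiff_adjust (𝕜 := ℝ) e).continuous.comp (Continuous.prodMk_right 0))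
    refine h1.of_isClosed_subset ?_ ?_
    · refine IsClosed.inter ?_ ?_
      · exact isClosed_eq (LinearMap.continuous_of_finiteDimensional _) continuous_const
      · exact isClosed_le (continuous_orbitPotential a k) continuous_const
    · rintro β ⟨hβ, hfβ⟩
      have hR : ∀ j ∉ range e, |β j| ≤ R := by
        intro j hj
        have hkj : 0 < k j := lt_of_le_of_ne (hk j) (hk' j hj).symm
        have h2 : |β j| ≤ (f 0 + B) / k j := by
          rw [le_div_iff₀ hkj, mul_comm]
          linarith [hlow' β j]
        exact h2.trans (Finset.single_le_sum (f := fun j => (f 0 + B) / k j)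
          (fun i _ => div_nonneg hB (hk i)) (Finset.mem_univ j))
      have hR0 : 0 ≤ R := Finset.sum_nonneg fun i _ => div_nonneg hB (hk i)
      refine ⟨fun j => if j ∈ range e then 0 else β j, ⟨fun j => ?_, fun j => ?_⟩, ?_⟩
      · simp only
        split_ifs with hj
        · linarith
        · exact (abs_le.1 (hR j hj)).1
      · simp only
        split_ifs with hj
        · exact hR0
        · exact (abs_le.1 (hR j hj)).2
      · rw [← sub_eq_zero]
        refine eq_zero_of_piMap_eq_zero he (fun j hj => ?_) ?_
        · simp only [Pi.sub_apply, adjust_of_notMem _ _ hj, if_neg hj, sub_self]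
        · rw [map_sub, piMap_adjust he, hβ, sub_self]
  obtain ⟨β, hβ, hmin⟩ := hKc.exists_isMinOn ⟨0, map_zero _, le_rfl⟩
    (continuous_orbitPotential a k).continuousOn
  refine ⟨β, hβ.1, fun β' hβ' => ?_⟩
  by_cases h : f β' ≤ f 0
  · exact hmin ⟨hβ', h⟩
  · exact hβ.2.trans (not_le.1 h).le

/-- The existence half of Kempf–Ness. The weights `k_j = ⟨ν, X_j⟩ - λ_j` are the slacks of the
vertex, zero exactly on the frame. Since `∑ γ_j ⟨ν, X_j⟩ = 0` for `γ ∈ ker π`, the critical equation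
of the potential is the moment equation. -/
theorem exists_expVec_mul_mem_levelSet {e : Fin 3 → Fin d} {ν : Fin 3 → ℝ}
    (h : D.IsVertexFrame ν e) {w : Fin d → ℂ} (hw : ∀ j ∉ range e, w j ≠ 0) :
    ∃ θ : Fin d → ℂ, D.piMap ℂ θ = 0 ∧ expVec θ * w ∈ D.levelSet := by
  let a : Fin d → ℝ := fun j => ‖w j‖ ^ 2
  let k : Fin d → ℝ := fun j => ν ⬝ᵥ D.X j - D.lam j
  have hk0 : ∀ j, k j ≠ 0 ↔ j ∉ range e := by
    intro j
    rw [h.range_eq]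
    exact not_congr sub_eq_zero
  obtain ⟨β, hβ, hmin⟩ := exists_isMin_orbitPotential h.det_ne_zero (a := a) (k := k)
    (fun j => by positivity) (fun j => sub_nonneg.2 (h.mem j)) (fun j hj => (hk0 j).2 hj)
    (fun j hj => by
      have := norm_pos_iff.2 (hw j ((hk0 j).1 hj))
      positivity)
  -- The imaginary phases `iβ_j` multiply `|w_j|²` by `e^{-4πβ_j}`, which explains the `4π` in the
  -- potential.
  refine ⟨fun j => Complex.I * β j, ?_, mem_levelSet_iff_forall.2 fun γ hγ => ?_⟩
  · have h1 := piMap_algebraMap (D := D) (𝕜 := ℂ) β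
    have h2 : (fun j => Complex.I * (β j : ℂ)) = Complex.I • fun j => algebraMap ℝ ℂ (β j) := rfl
    rw [h2, map_smul, h1, hβ]
    funext k
    simp
  · have hd : ∀ j, HasDerivAt (fun t : ℝ => a j * Real.exp (-(4 * Real.pi * (β j + t * γ j))) /
        (4 * Real.pi) + k j * (β j + t * γ j))
        (γ j * (k j - a j * Real.exp (-(4 * Real.pi * β j)))) 0 := by
      intro j
      have h1 : HasDerivAt (fun t : ℝ => β j + t * γ j) (γ j) 0 := by
        simpa using ((hasDerivAt_id (0 : ℝ)).mul_const (γ j)).const_add (β j)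
      have h2 := ((((h1.const_mul (4 * Real.pi)).neg.exp).const_mul (a j)).div_const
        (4 * Real.pi)).add (h1.const_mul (k j))
      refine HasDerivAt.congr_deriv h2 ?_
      have := Real.pi_ne_zero
      simp only [Pi.neg_apply, zero_mul, add_zero]
      field_simp
      ring
    have hsum : HasDerivAt (fun t : ℝ => orbitPotential a k (β + t • γ))
        (∑ j, γ j * (k j - a j * Real.exp (-(4 * Real.pi * β j)))) 0 :=
      HasDerivAt.fun_sum (u := Finset.univ) fun j _ => hd j
    have hloc : IsLocalMin (fun t : ℝ => orbitPotential a k (β + t • γ)) 0 := by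
      refine Filter.Eventually.of_forall fun t => ?_
      have := hmin (β + t • γ) (by rw [map_add, map_smul, hβ, hγ, smul_zero, add_zero])
      simpa using this
    have h0 := hloc.hasDerivAt_eq_zero hsum
    have h1 := sum_mul_dotProduct (D := D) γ ν
    rw [hγ, dotProduct_zero] at h1
    have h2 : ∀ j, γ j * (‖(expVec (fun j => Complex.I * β j) * w) j‖ ^ 2 + D.lam j) =
        γ j * (ν ⬝ᵥ D.X j) - γ j * (k j - a j * Real.exp (-(4 * Real.pi * β j))) := by
      intro j
      rw [Pi.mul_apply, norm_mul, norm_expVec_complex, mul_pow, ← Real.exp_nat_mul]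
      have : ((2 : ℕ) : ℝ) * -(2 * Real.pi * (Complex.I * β j).im) = -(4 * Real.pi * β j) := by
        simp
        ring
      rw [this]
      simp only [a, k]
      ring
    simp only [h2]
    rw [Finset.sum_sub_distrib, h1, h0, sub_zero]

end KempfNess

/-- A family of vertices with their frames, such that every face contains one of the vertices. -/
structure IsVertexSystem {d : ℕ} (D : ToricData d) {ι : Type} (ν : ι → Fin 3 → ℝ)
    (e : ι → Fin 3 → Fin d) : Prop where
  nonempty : Nonempty ι
  injective : Function.Injective ν
  frame : ∀ a, D.IsVertexFrame (ν a) (e a)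
  cover : ∀ μ ∈ D.polytope, ∃ a, D.activeSet μ ⊆ D.activeSet (ν a)

/-! ### The identification of `M_Δ` and `X_Δ` -/

section Chi

variable {d : ℕ} {D : ToricData d} {ι : Type} {ν : ι → Fin 3 → ℝ} {e : ι → Fin 3 → Fin d}

theorem IsVertexSystem.openSet_eq (h : D.IsVertexSystem ν e) :
    D.openSet = {z | ∃ a, ∀ j, j ∉ D.activeSet (ν a) → z j ≠ 0} := by
  ext z
  constructor
  · rintro ⟨μ, hμ, hz⟩
    obtain ⟨a, ha⟩ := h.cover μ hμ
    exact ⟨a, fun j hj => hz j fun h => hj (ha h)⟩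
  · rintro ⟨a, ha⟩
    exact ⟨ν a, (h.frame a).mem, ha⟩

theorem IsVertexSystem.exists_of_mem_openSet (h : D.IsVertexSystem ν e) (w : Fin d → ℂ)
    (hw : w ∈ D.openSet) : ∃ a, ∀ j ∉ range (e a), w j ≠ 0 := by
  rw [h.openSet_eq] at hw
  obtain ⟨a, ha⟩ := hw
  refine ⟨a, fun j hj => ha j ?_⟩
  rwa [(h.frame a).range_eq] at hj

theorem IsVertexSystem.eq_of_range_eq (h : D.IsVertexSystem ν e) (a b : ι)
    (hab : range (e a) = range (e b)) : a = b := by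
  refine h.injective ?_
  rw [← (h.frame a).framePoint_zero]
  refine ((eq_framePoint_iff (h.frame a).det_ne_zero).2 fun i => ?_).symm
  have h1 : e a i ∈ D.activeSet (ν b) := by
    rw [← (h.frame b).range_eq, ← hab]
    exact mem_range_self i
  rw [Pi.zero_apply, add_zero]
  exact h1

/-- The map `M_Δ → X_Δ` induced by the inclusion of the level set. -/
noncomputable def inclusionMap (D : ToricData d) : D.M → D.XΔ :=
  Quotient.map' (fun z => ⟨z.1, levelSet_subset_openSet z.2⟩) (by
    rintro z w ⟨t, ht, h⟩
    obtain ⟨θ, rfl⟩ := QuotientAddGroup.mk_surjective t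
    refine ⟨QuotientAddGroup.mk fun j => (θ j : ℂ), mk_mem_N.2 ?_, ?_⟩
    · obtain ⟨q, hq, hqθ⟩ := mem_quasilattice.1 (mk_mem_N.1 ht)
      exact mem_quasilattice.2 ⟨q, hq, (piMap_algebraMap (𝕜 := ℂ) θ).trans (by rw [hqθ]; rfl)⟩
    · exact h)

theorem continuous_inclusionMap : Continuous D.inclusionMap :=
  Continuous.quotient_map' (continuous_subtype_val.subtype_mk _) _

theorem injective_inclusionMap : Function.Injective D.inclusionMap := by
  intro x y
  refine Quotient.inductionOn₂ x y fun z w h => ?_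
  obtain ⟨θ, hθ, h⟩ := ToricData.mk_eq_mk_iff.1 h
  obtain ⟨α, hα, h'⟩ := exists_real_of_complex z.2 w.2 hθ h
  exact ToricData.mk_eq_mk_iff.2 ⟨α, hα, h'⟩

theorem IsVertexSystem.surjective_inclusionMap (hV : D.IsVertexSystem ν e) :
    Function.Surjective D.inclusionMap := by
  intro x
  obtain ⟨w, rfl⟩ := Quotient.exists_rep x
  obtain ⟨a, ha⟩ := hV.exists_of_mem_openSet w w.2
  obtain ⟨θ, hθ, h⟩ := exists_expVec_mul_mem_levelSet (hV.frame a) ha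
  refine ⟨D.mkM ⟨_, h⟩, ?_⟩
  have hθ' : D.piMap ℂ θ ∈ D.quasilattice ℂ := by
    rw [hθ]
    exact (D.quasilattice ℂ).zero_mem
  exact (ToricData.mk_eq_mk_iff (z := w) (w := ⟨expVec θ * w.1, levelSet_subset_openSet h⟩).2
    ⟨θ, hθ', rfl⟩).symm

/-- The chart of `M_Δ` at a vertex. -/
noncomputable def levelChart {e : Fin 3 → Fin d} {ν : Fin 3 → ℝ} (h : D.IsVertexFrame ν e) :
    QuasifoldChart (Fin 3 → ℂ) D.M :=
  D.sliceChart ℝ D.levelSet (D.levelDomain e) (D.chartGroup e) (D.levelSlice e) (levelSlice_mem h)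

/-- The chart of `X_Δ` at a vertex. -/
noncomputable def openChart {e : Fin 3 → Fin d} {ν : Fin 3 → ℝ} (h : D.IsVertexFrame ν e) :
    QuasifoldChart (Fin 3 → ℂ) D.XΔ :=
  D.sliceChart ℂ D.openSet univ (D.chartGroup e) (fun z => Function.extend e z fun _ => 1)
    (extend_one_mem_openSet h)

/-- `IsSlice.exists_lift` with a real source and the complex group on the target: the level slice is
transversal to the `N_ℂ`-orbits, so the lifts of the inclusion are local diffeomorphisms. -/
theorem exists_isLocalLift_inclusionMap {e e' : Fin 3 → Fin d} {ν ν' : Fin 3 → ℝ}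
    (h : D.IsVertexFrame ν e) (h' : D.IsVertexFrame ν' e') {x y : Fin 3 → ℂ}
    (hx : x ∈ D.levelDomain e) (hxy : D.inclusionMap ((levelChart h).σ x) = (openChart h').σ y) :
    ∃ f : OpenPartialHomeomorph (Fin 3 → ℂ) (Fin 3 → ℂ),
      (levelChart h).IsLocalLift ℝ (openChart h') D.inclusionMap f ∧ x ∈ f.source ∧ f x = y := by
  obtain ⟨θ, hθ, hxy⟩ := ToricData.mk_eq_mk_iff.1 hxy
  obtain ⟨f, Θ, h1, h2, h3, h4, h5, h6, h7, h8⟩ :=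
    (isSlice_extend_one h').exists_lift (𝕜 := ℂ) (𝕜' := ℝ) isPhaseSection_complex
      expVec_mul_mem_openSet h'.det_ne_zero (isSlice_levelSlice h) levelSet_subset_openSet hx
      (mem_univ y) hxy
  refine ⟨f, ⟨h1, h2, h5, h6, fun u hu => ?_⟩, h3, h4⟩
  refine (ToricData.mk_eq_mk_iff.2 ⟨Θ u, ?_, (h8 u hu).2.symm⟩).symm
  rw [(h8 u hu).1]
  exact hθ

/-- Locally the map lifts to a diffeomorphism between chart domains, and the projection of a chart
of `X_Δ` is open. -/
theorem IsVertexSystem.isOpenMap_inclusionMap (hV : D.IsVertexSystem ν e) :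
    IsOpenMap D.inclusionMap := by
  intro U hU
  rw [isOpen_iff_mem_nhds]
  rintro _ ⟨m, hm, rfl⟩
  obtain ⟨w, rfl⟩ := Quotient.exists_rep m
  obtain ⟨a, ha⟩ := hV.exists_of_mem_openSet w (levelSet_subset_openSet w.2)
  have h := hV.frame a
  obtain ⟨x, hx, hxw⟩ := (isSlice_levelSlice h).mem_image_sliceChart (G := D.chartGroup (e a))
    isPhaseSection_real expVec_mul_mem_levelSet h.det_ne_zero w ha
  obtain ⟨y, -, hy⟩ := (isSlice_extend_one h).mem_image_sliceChart (G := D.chartGroup (e a))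
    isPhaseSection_complex expVec_mul_mem_openSet h.det_ne_zero
    ⟨w.1, levelSet_subset_openSet w.2⟩ ha
  have hxy : D.inclusionMap ((levelChart h).σ x) = (openChart h).σ y :=
    (congrArg D.inclusionMap hxw).trans hy.symm
  obtain ⟨f, hf, hxf, hfx⟩ := exists_isLocalLift_inclusionMap h h hx hxy
  have hσ : ContinuousOn (levelChart h).σ f.source := by
    refine continuous_quotient_mk'.comp_continuousOn (IsInducing.subtypeVal.continuousOn_iff.2 ?_)
    exact (contDiffOn_levelSlice h).continuousOn.mono hf.source_subset
  let W := f.source ∩ (levelChart h).σ ⁻¹' U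
  have hW : IsOpen W := hσ.isOpen_inter_preimage f.open_source hU
  have hfW : IsOpen (f '' W) := f.isOpen_image_of_subset_source hW inter_subset_left
  have himg := (isSlice_extend_one h).isOpen_image isPhaseSection_complex expVec_mul_mem_openSet
    h.det_ne_zero hfW (subset_univ _)
  refine Filter.mem_of_superset (himg.mem_nhds ?_) ?_
  · refine ⟨y, ⟨x, ⟨hxf, ?_⟩, hfx⟩, hy⟩
    rw [mem_preimage]
    exact hxw.symm ▸ hm
  · rintro _ ⟨_, ⟨u, ⟨hu, huU⟩, rfl⟩, rfl⟩
    exact ⟨_, huU, (hf.lift u hu).symm⟩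

/-- The homeomorphism `M_Δ → X_Δ` induced by the inclusion of the level set. -/
noncomputable def IsVertexSystem.homeomorph (hV : D.IsVertexSystem ν e) : D.M ≃ₜ D.XΔ :=
  (Equiv.ofBijective D.inclusionMap
    ⟨injective_inclusionMap, hV.surjective_inclusionMap⟩).toHomeomorphOfContinuousOpen
    continuous_inclusionMap hV.isOpenMap_inclusionMap

theorem IsVertexSystem.isQuasifoldDiffeo (hV : D.IsVertexSystem ν e) :
    IsQuasifoldDiffeo ℝ (fun a => levelChart (hV.frame a)) (fun a => openChart (hV.frame a))
      hV.homeomorph := fun a b _ hx _ _ hxy =>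
  exists_isLocalLift_inclusionMap (hV.frame a) (hV.frame b) hx hxy

end Chi

end ToricData

namespace ToricData

/-! ### The group `N` -/

section GroupN

variable {d : ℕ} {D : ToricData d}

theorem mem_quasilattice_real {ξ : Fin 3 → ℝ} : ξ ∈ D.quasilattice ℝ ↔ ξ ∈ D.Q := by
  rw [mem_quasilattice]
  exact ⟨fun ⟨_, hq, h⟩ => h ▸ hq, fun h => ⟨ξ, h, rfl⟩⟩

/-- `Q` is generated by the normals, so it is `π(ℤ^d)`. Every element of `N` then has a
representative in `ker π`, which gives `N = exp(𝔫)`. -/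
theorem exists_int_piMap_eq (hQ : D.Q = AddSubgroup.closure (range D.X)) {q : Fin 3 → ℝ}
    (hq : q ∈ D.Q) : ∃ m ∈ intLattice ℝ d, D.piMap ℝ m = q := by
  have h : D.Q ≤ (intLattice ℝ d).map (D.piMap ℝ).toAddMonoidHom := by
    rw [hQ, AddSubgroup.closure_le]
    rintro _ ⟨j, rfl⟩
    refine ⟨Pi.single j 1, ⟨Pi.single j 1, ?_⟩, ?_⟩
    · funext i
      by_cases hi : i = j
      · subst hi
        simp
      · simp [Pi.single_eq_of_ne hi]
    · funext k
      change D.piMap ℝ (Pi.single j 1) k = D.X j k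
      simp [piMap_apply, Pi.single_apply]
  exact h hq

theorem coe_N_eq_image (hQ : D.Q = AddSubgroup.closure (range D.X)) :
    (D.N ℝ : Set (Torus ℝ d)) =
      QuotientAddGroup.mk '' (LinearMap.ker (D.piMap ℝ) : Set (Fin d → ℝ)) := by
  ext t
  constructor
  · intro ht
    obtain ⟨θ, rfl⟩ := QuotientAddGroup.mk_surjective t
    obtain ⟨m, hm, hmθ⟩ := exists_int_piMap_eq hQ (mem_quasilattice_real.1 (mk_mem_N.1 ht))
    refine ⟨θ - m, ?_, ?_⟩
    · change D.piMap ℝ (θ - m) = 0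
      rw [map_sub, hmθ, sub_self]
    · rw [QuotientAddGroup.eq]
      simpa using hm
  · rintro ⟨θ, hθ, rfl⟩
    refine mk_mem_N.2 ?_
    rw [show D.piMap ℝ θ = 0 from hθ]
    exact (D.quasilattice ℝ).zero_mem

/-- If `π(v) ≠ 0`, the uncountable line `ℝ π(v)` would be contained in the countable group `Q`. -/
theorem lieAlgebraN_eq (hQ : D.Q = AddSubgroup.closure (range D.X)) :
    D.lieAlgebraN = LinearMap.ker (D.piMap ℝ) := by
  ext v
  constructor
  · intro hv
    have h1 : ∀ t : ℝ, t • D.piMap ℝ v ∈ D.Q := fun t => by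
      rw [← map_smul]
      exact mem_quasilattice_real.1 (mk_mem_N.1 (hv t))
    change D.piMap ℝ v = 0
    by_contra hne
    have h2 : (univ : Set ℝ).Countable :=
      MapsTo.countable_of_injOn (f := fun t : ℝ => t • D.piMap ℝ v) (fun t _ => h1 t)
        ((smul_left_injective ℝ hne).injOn) (D.countable_Q hQ)
    exact Cardinal.not_countable_real h2
  · intro hv t
    refine mk_mem_N.2 ?_
    rw [map_smul, show D.piMap ℝ v = 0 from hv, smul_zero]
    exact (D.quasilattice ℝ).zero_mem

end GroupN

/-! ### The polytope -/

section Polytope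

variable {d : ℕ} {D : ToricData d}

/-- The facet of the polytope with normal `X_j`. -/
def facet (D : ToricData d) (j : Fin d) : Set (Fin 3 → ℝ) :=
  {μ | μ ∈ D.polytope ∧ μ ⬝ᵥ D.X j = D.lam j}

/-- The functional `μ ↦ ⟨μ, x⟩`. -/
noncomputable def pairing (x : Fin 3 → ℝ) : (Fin 3 → ℝ) →L[ℝ] ℝ :=
  LinearMap.toContinuousLinearMap
    { toFun := fun μ => μ ⬝ᵥ x
      map_add' := fun _ _ => add_dotProduct _ _ _
      map_smul' := fun _ _ => smul_dotProduct _ _ _ }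

theorem eventually_lt_dotProduct {p x : Fin 3 → ℝ} {c : ℝ} (h : c < p ⬝ᵥ x) (v : Fin 3 → ℝ) :
    ∀ᶠ s in 𝓝 (0 : ℝ), c < (p + s • v) ⬝ᵥ x := by
  have h1 : ContinuousAt (fun s : ℝ => (p + s • v) ⬝ᵥ x) 0 := by
    have : Continuous fun s : ℝ => pairing x (p + s • v) := by fun_prop
    exact this.continuousAt
  exact h1.eventually (lt_mem_nhds (by simpa using h))

theorem convex_polyhedron {n : ℕ} (X : Fin d → Fin n → ℝ) (lam : Fin d → ℝ) :
    Convex ℝ (polyhedron X lam) := by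
  intro a ha b hb x y hx hy hxy j
  have h1 := mul_le_mul_of_nonneg_left (ha j) hx
  have h2 := mul_le_mul_of_nonneg_left (hb j) hy
  rw [add_dotProduct, smul_dotProduct, smul_dotProduct, smul_eq_mul, smul_eq_mul]
  have : x * lam j + y * lam j = lam j := by rw [← add_mul, hxy, one_mul]
  linarith

theorem eventually_mem_polytope {p : Fin 3 → ℝ} (v : Fin 3 → ℝ)
    (hp : ∀ k, D.lam k < p ⬝ᵥ D.X k ∨ (D.lam k ≤ p ⬝ᵥ D.X k ∧ v ⬝ᵥ D.X k = 0)) :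
    ∀ᶠ s in 𝓝 (0 : ℝ), p + s • v ∈ D.polytope := by
  refine (Filter.eventually_all.2 fun k => ?_).mono fun s hs => hs
  rcases hp k with h | ⟨h, h'⟩
  · exact (eventually_lt_dotProduct h v).mono fun s hs => hs.le
  · refine Filter.Eventually.of_forall fun s => ?_
    rwa [add_dotProduct, smul_dotProduct, h', smul_zero, add_zero]

theorem exists_pos_of_eventually {q : ℝ → Prop} (h : ∀ᶠ s in 𝓝 (0 : ℝ), q s) :
    ∃ s > 0, q s ∧ q (-s) := by
  have h1 : ∀ᶠ s in 𝓝 (0 : ℝ), q (-s) :=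
    (continuous_neg.tendsto' (0 : ℝ) 0 neg_zero).eventually h
  obtain ⟨s, hs, hs'⟩ := (((h.and h1).filter_mono nhdsWithin_le_nhds).and
    (self_mem_nhdsWithin : Ioi (0 : ℝ) ∈ 𝓝[>] 0)).exists
  exact ⟨s, hs', hs.1, hs.2⟩

theorem mem_vectorSpan_of_eventually {F : Set (Fin 3 → ℝ)} {p v : Fin 3 → ℝ} (hp : p ∈ F)
    (h : ∀ᶠ s in 𝓝 (0 : ℝ), p + s • v ∈ F) : v ∈ vectorSpan ℝ F := by
  obtain ⟨s, hs, h1, -⟩ := exists_pos_of_eventually h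
  have h2 := vsub_mem_vectorSpan ℝ h1 hp
  rw [vsub_eq_sub, add_sub_cancel_left] at h2
  have h3 := (vectorSpan ℝ F).smul_mem s⁻¹ h2
  rwa [smul_smul, inv_mul_cancel₀ hs.ne', one_smul] at h3

/-- Every facet has a point that lies in no other facet. -/
structure HasGenericFacets (D : ToricData d) (p : Fin d → Fin 3 → ℝ) : Prop where
  eq : ∀ j, p j ⬝ᵥ D.X j = D.lam j
  lt : ∀ j k, k ≠ j → D.lam k < p j ⬝ᵥ D.X k
  normal_ne_zero : ∀ j, D.X j ≠ 0

variable {p : Fin d → Fin 3 → ℝ}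

theorem HasGenericFacets.mem_facet (h : D.HasGenericFacets p) (j : Fin d) : p j ∈ D.facet j :=
  ⟨fun k => by
    by_cases hk : k = j
    · rw [hk, h.eq]
    · exact (h.lt j k hk).le, h.eq j⟩

theorem HasGenericFacets.injective (h : D.HasGenericFacets p) : Function.Injective D.facet := by
  intro j k hjk
  by_contra hne
  have h1 := h.mem_facet j
  rw [hjk] at h1
  exact (h.lt j k (Ne.symm hne)).ne' h1.2

theorem HasGenericFacets.eventually_mem (h : D.HasGenericFacets p) (j : Fin d) {v : Fin 3 → ℝ}
    (hv : v ⬝ᵥ D.X j = 0) : ∀ᶠ s in 𝓝 (0 : ℝ), p j + s • v ∈ D.facet j := by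
  have h1 : ∀ᶠ s in 𝓝 (0 : ℝ), p j + s • v ∈ D.polytope := by
    refine eventually_mem_polytope v fun k => ?_
    by_cases hk : k = j
    · subst hk
      exact Or.inr ⟨(h.eq k).ge, hv⟩
    · exact Or.inl (h.lt j k hk)
  filter_upwards [h1] with s hs
  exact ⟨hs, by rw [add_dotProduct, smul_dotProduct, hv, smul_zero, add_zero, h.eq]⟩

theorem HasGenericFacets.vectorSpan_facet (h : D.HasGenericFacets p) (j : Fin d) :
    vectorSpan ℝ (D.facet j) = LinearMap.ker (pairing (D.X j) : (Fin 3 → ℝ) →ₗ[ℝ] ℝ) := by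
  refine le_antisymm ?_ fun v hv => ?_
  · rw [vectorSpan_def, Submodule.span_le]
    rintro _ ⟨x, hx, y, hy, rfl⟩
    change (x - y) ⬝ᵥ D.X j = 0
    rw [sub_dotProduct, hx.2, hy.2, sub_self]
  · exact mem_vectorSpan_of_eventually (h.mem_facet j) (h.eventually_mem j hv)

theorem HasGenericFacets.finrank_vectorSpan_facet (h : D.HasGenericFacets p) (j : Fin d) :
    Module.finrank ℝ (vectorSpan ℝ (D.facet j)) + 1 = 3 := by
  rw [h.vectorSpan_facet]
  have h1 : (pairing (D.X j) : (Fin 3 → ℝ) →ₗ[ℝ] ℝ) ≠ 0 := by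
    intro h0
    have := LinearMap.congr_fun h0 (D.X j)
    exact h.normal_ne_zero j (dotProduct_self_eq_zero.1 this)
  have := Module.Dual.finrank_ker_add_one_of_ne_zero (K := ℝ) (f := (pairing (D.X j) : (Fin 3 → ℝ) →ₗ[ℝ] ℝ)) h1
  rw [this]
  simp

theorem HasGenericFacets.isFacet_facet (h : D.HasGenericFacets p) (j : Fin d) :
    IsFacet D.polytope (D.facet j) := by
  refine ⟨⟨_, h.mem_facet j⟩, fun _ => ⟨-pairing (D.X j), ?_⟩, h.finrank_vectorSpan_facet j⟩
  ext μ
  constructor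
  · rintro ⟨hμ, h'⟩
    refine ⟨hμ, fun y hy => ?_⟩
    change -(y ⬝ᵥ D.X j) ≤ -(μ ⬝ᵥ D.X j)
    rw [h']
    exact neg_le_neg (hy j)
  · rintro ⟨hμ, h'⟩
    refine ⟨hμ, le_antisymm ?_ (hμ j)⟩
    have h1 := h' (p j) (h.mem_facet j).1
    change -(p j ⬝ᵥ D.X j) ≤ -(μ ⬝ᵥ D.X j) at h1
    rw [h.eq] at h1
    exact neg_le_neg_iff.1 h1

/-- If `F` lay in no `facet j`, averaging points of `F` chosen off each facet would give a point of
`F` satisfying all inequalities strictly; the exposing functional would be zero and `F` the whole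
polytope, of dimension 3. So `F` lies in some `facet j`, has the same direction space by dimension,
and the exposing functional is constant on that facet. -/
theorem HasGenericFacets.exists_eq_facet [NeZero d] (h : D.HasGenericFacets p) {F : Set (Fin 3 → ℝ)}
    (hF : IsFacet D.polytope F) : ∃ j, D.facet j = F := by
  obtain ⟨hne, hexp, hrank⟩ := hF
  have hconv : Convex ℝ F := hexp.convex (convex_polyhedron _ _)
  obtain ⟨l, hl⟩ := hexp hne
  have hFP : F ⊆ D.polytope := by
    rw [hl]
    exact fun x hx => hx.1
  have hsub : ∃ j, F ⊆ D.facet j := by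
    by_contra! hcon
    simp only [not_subset] at hcon
    choose q hq hq' using hcon
    have hd : (0 : ℝ) < d := by exact_mod_cast Nat.pos_of_neZero d
    have hz : ∑ j : Fin d, (1 / d : ℝ) • q j ∈ F := by
      refine hconv.sum_mem (fun _ _ => by positivity) ?_ fun j _ => hq j
      simp
    set z := ∑ j : Fin d, (1 / d : ℝ) • q j
    have hlt : ∀ k, D.lam k < z ⬝ᵥ D.X k := by
      intro k
      have h1 : z ⬝ᵥ D.X k = ∑ j, (1 / d : ℝ) * (q j ⬝ᵥ D.X k) := by
        simp only [z, sum_dotProduct, smul_dotProduct, smul_eq_mul]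
      have h2 : D.lam k = ∑ _j : Fin d, (1 / d : ℝ) * D.lam k := by
        rw [Finset.sum_const, Finset.card_univ, Fintype.card_fin, nsmul_eq_mul]
        field_simp
      rw [h1, h2]
      refine Finset.sum_lt_sum (fun j _ => ?_) ⟨k, Finset.mem_univ k, ?_⟩
      · exact mul_le_mul_of_nonneg_left (hFP (hq j) k) (by positivity)
      · refine mul_lt_mul_of_pos_left (lt_of_le_of_ne (hFP (hq k) k) fun h0 => ?_) (by positivity)
        exact hq' k ⟨hFP (hq k), h0.symm⟩
    have hev : ∀ v, ∀ᶠ s in 𝓝 (0 : ℝ), z + s • v ∈ D.polytope := fun v =>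
      eventually_mem_polytope v fun k => Or.inl (hlt k)
    have hl0 : ∀ v, l v = 0 := by
      intro v
      obtain ⟨s, hs, h1, h2⟩ := exists_pos_of_eventually (hev v)
      rw [hl] at hz
      have h3 := hz.2 _ h1
      have h4 := hz.2 _ h2
      simp only [map_add, map_smul, smul_eq_mul] at h3 h4
      have h5 : s * l v = 0 := by linarith
      exact (mul_eq_zero.1 h5).resolve_left hs.ne'
    have hFe : F = D.polytope := by
      rw [hl]
      ext x
      simp [hl0]
    have htop : vectorSpan ℝ F = ⊤ := by
      refine eq_top_iff.2 fun v _ => mem_vectorSpan_of_eventually hz ?_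
      rw [hFe]
      exact hev v
    rw [htop, finrank_top] at hrank
    simp at hrank
  obtain ⟨j, hj⟩ := hsub
  refine ⟨j, Subset.antisymm (fun y hy => ?_) hj⟩
  have hspan : vectorSpan ℝ F = vectorSpan ℝ (D.facet j) := by
    refine Submodule.eq_of_le_of_finrank_eq (vectorSpan_mono ℝ hj) ?_
    have := h.finrank_vectorSpan_facet j
    omega
  have hle : vectorSpan ℝ F ≤ LinearMap.ker (l : (Fin 3 → ℝ) →ₗ[ℝ] ℝ) := by
    rw [vectorSpan_def, Submodule.span_le]
    rintro _ ⟨x, hx, y, hy, rfl⟩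
    rw [hl] at hx hy
    change l (x - y) = 0
    rw [map_sub, sub_eq_zero]
    exact le_antisymm (hy.2 _ hx.1) (hx.2 _ hy.1)
  obtain ⟨x, hx⟩ := hne
  have h1 : y - x ∈ vectorSpan ℝ (D.facet j) := vsub_mem_vectorSpan ℝ hy (hj hx)
  rw [← hspan] at h1
  have h2 : l (y - x) = 0 := hle h1
  rw [map_sub, sub_eq_zero] at h2
  rw [hl] at hx ⊢
  exact ⟨hy.1, fun w hw => h2 ▸ hx.2 w hw⟩

theorem HasGenericFacets.setOf_isFacet [NeZero d] (h : D.HasGenericFacets p) :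
    {F | IsFacet D.polytope F} = range D.facet := by
  ext F
  exact ⟨fun hF => h.exists_eq_facet hF, by rintro ⟨j, rfl⟩; exact h.isFacet_facet j⟩

theorem HasGenericFacets.ncard_facets [NeZero d] (h : D.HasGenericFacets p) :
    {F | IsFacet D.polytope F}.ncard = d := by
  rw [h.setOf_isFacet, ← image_univ, ncard_image_of_injective _ h.injective, ncard_univ,
    Nat.card_eq_fintype_card, Fintype.card_fin]

theorem HasGenericFacets.ncard_facets_of_vertex [NeZero d] (h : D.HasGenericFacets p)
    {e : Fin 3 → Fin d} {ν : Fin 3 → ℝ} (hν : D.IsVertexFrame ν e) :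
    {F | IsFacet D.polytope F ∧ ν ∈ F}.ncard = 3 := by
  have h1 : {F | IsFacet D.polytope F ∧ ν ∈ F} = (D.facet ∘ e) '' univ := by
    rw [image_univ, range_comp, hν.range_eq]
    ext F
    constructor
    · rintro ⟨hF, hνF⟩
      obtain ⟨j, rfl⟩ := h.exists_eq_facet hF
      exact ⟨j, hνF.2, rfl⟩
    · rintro ⟨j, hj, rfl⟩
      exact ⟨h.isFacet_facet j, hν.mem, hj⟩
  rw [h1, ncard_image_of_injective _ (h.injective.comp hν.injective), ncard_univ,
    Nat.card_eq_fintype_card, Fintype.card_fin]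

theorem IsVertexFrame.mem_extremePoints {e : Fin 3 → Fin d} {ν : Fin 3 → ℝ}
    (h : D.IsVertexFrame ν e) : ν ∈ D.polytope.extremePoints ℝ := by
  have key : ∀ x, (∀ i, x ⬝ᵥ D.X (e i) = D.lam (e i)) → x = ν := by
    intro x hx
    rw [← h.framePoint_zero]
    exact (eq_framePoint_iff h.det_ne_zero).2 fun i => by rw [hx, Pi.zero_apply, add_zero]
  refine mem_extremePoints_iff_left.2 ⟨h.mem, ?_⟩
  rintro x hx y hy ⟨a, b, ha, hb, hab, hxy⟩
  refine key x fun i => ?_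
  have h1 : ν ⬝ᵥ D.X (e i) = D.lam (e i) := by
    have : e i ∈ D.activeSet ν := h.range_eq ▸ mem_range_self i
    exact this
  rw [← hxy, add_dotProduct, smul_dotProduct, smul_dotProduct, smul_eq_mul, smul_eq_mul] at h1
  have h2 := hx (e i)
  have h3 := mul_le_mul_of_nonneg_left (hy (e i)) hb.le
  have h4 : a * D.lam (e i) + b * D.lam (e i) = D.lam (e i) := by rw [← add_mul, hab, one_mul]
  have h5 : a * (x ⬝ᵥ D.X (e i)) ≤ a * D.lam (e i) := by linarith
  exact le_antisymm (le_of_mul_le_mul_left h5 ha) h2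

/-- Otherwise every point of `V` has positive slack in the sum of the inequalities active at `μ`.
Then so does the whole convex hull, although `μ` itself has slack zero. -/
theorem exists_activeSet_subset {V : Set (Fin 3 → ℝ)} (hV : D.polytope = convexHull ℝ V)
    {μ : Fin 3 → ℝ} (hμ : μ ∈ D.polytope) : ∃ ν ∈ V, D.activeSet μ ⊆ D.activeSet ν := by
  classical
  by_contra! hcon
  let J := Finset.univ.filter fun j => j ∈ D.activeSet μ
  let x := ∑ j ∈ J, D.X j
  have hx : ∀ y : Fin 3 → ℝ, y ⬝ᵥ x = ∑ j ∈ J, y ⬝ᵥ D.X j := fun y => dotProduct_sum _ _ _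
  have h1 : V ⊆ {y | ∑ j ∈ J, D.lam j < y ⬝ᵥ x} := by
    intro ν hν
    have hνP : ν ∈ D.polytope := hV ▸ subset_convexHull ℝ V hν
    obtain ⟨j, hj, hj'⟩ := not_subset.1 (hcon ν hν)
    rw [mem_ofPred_eq, hx]
    refine Finset.sum_lt_sum (fun i _ => hνP i) ⟨j, by simpa [J] using hj, ?_⟩
    exact lt_of_le_of_ne (hνP j) fun h => hj' h.symm
  have h2 : Convex ℝ {y : Fin 3 → ℝ | ∑ j ∈ J, D.lam j < y ⬝ᵥ x} :=
    convex_halfSpace_gt (pairing x).isBoundedLinearMap.toIsLinearMap _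
  have h3 := convexHull_min h1 h2 (hV ▸ hμ)
  rw [mem_ofPred_eq, hx] at h3
  refine h3.ne (Finset.sum_congr rfl fun j hj => ?_)
  have : j ∈ D.activeSet μ := by simpa [J] using hj
  exact (show μ ⬝ᵥ D.X j = D.lam j from this).symm

/-- In every description of the polytope by half-spaces, every facet normal occurs up to a factor. -/
theorem HasGenericFacets.exists_smul_eq (h : D.HasGenericFacets p) {d' : ℕ}
    {X : Fin d' → Fin 3 → ℝ} {lam : Fin d' → ℝ} (hP : D.polytope = polyhedron X lam) (j : Fin d) :
    ∃ k, ∃ c : ℝ, c ≠ 0 ∧ X k = c • D.X j := by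
  have hpP : p j ∈ polyhedron X lam := hP ▸ (h.mem_facet j).1
  -- If no nonzero `X k` were active at `p j`, small moves along `D.X j` in both directions would
  -- stay in the polytope; the backward move violates the `j`-th inequality.
  have hex : ∃ k, X k ≠ 0 ∧ p j ⬝ᵥ X k = lam k := by
    by_contra! hcon
    have h1 : ∀ᶠ s in 𝓝 (0 : ℝ), p j + s • D.X j ∈ polyhedron X lam := by
      refine (Filter.eventually_all.2 fun k => ?_).mono fun s hs => hs
      by_cases hk : X k = 0
      · refine Filter.Eventually.of_forall fun s => ?_
        have := hpP k
        rw [hk, dotProduct_zero] at this ⊢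
        exact this
      · exact (eventually_lt_dotProduct (lt_of_le_of_ne (hpP k) (hcon k hk).symm) _).mono
          fun s hs => hs.le
    obtain ⟨s, hs, -, h2⟩ := exists_pos_of_eventually h1
    rw [← hP] at h2
    have h3 := h2 j
    rw [add_dotProduct, smul_dotProduct, h.eq, smul_eq_mul] at h3
    have h4 : 0 < D.X j ⬝ᵥ D.X j :=
      lt_of_le_of_ne (by rw [dotProduct]; exact Finset.sum_nonneg fun i _ => mul_self_nonneg _)
        fun h0 => h.normal_ne_zero j (dotProduct_self_eq_zero.1 h0.symm)
    have := mul_pos hs h4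
    linarith
  obtain ⟨k, hk, hk'⟩ := hex
  -- Moves within the facet in both directions keep `⟨·, X k⟩` above its value at `p j`, so `X k` is
  -- orthogonal to the facet and hence parallel to `D.X j`.
  have horth : ∀ v : Fin 3 → ℝ, v ⬝ᵥ D.X j = 0 → v ⬝ᵥ X k = 0 := by
    intro v hv
    obtain ⟨s, hs, h1, h2⟩ := exists_pos_of_eventually (h.eventually_mem j hv)
    have h3 := (hP ▸ h1.1 : p j + s • v ∈ polyhedron X lam) k
    have h4 := (hP ▸ h2.1 : p j + (-s) • v ∈ polyhedron X lam) k
    rw [add_dotProduct, smul_dotProduct, hk', smul_eq_mul] at h3 h4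
    have h5 : s * (v ⬝ᵥ X k) = 0 := by linarith
    exact (mul_eq_zero.1 h5).resolve_left hs.ne'
  have h0 : D.X j ⬝ᵥ D.X j ≠ 0 := fun h0 => h.normal_ne_zero j (dotProduct_self_eq_zero.1 h0)
  let c := (X k ⬝ᵥ D.X j) / (D.X j ⬝ᵥ D.X j)
  have h1 : (X k - c • D.X j) ⬝ᵥ D.X j = 0 := by
    rw [sub_dotProduct, smul_dotProduct, smul_eq_mul, div_mul_cancel₀ _ h0, sub_self]
  have h2 : (X k - c • D.X j) ⬝ᵥ (X k - c • D.X j) = 0 := by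
    rw [dotProduct_sub, horth _ h1, dotProduct_smul, h1, smul_zero, sub_zero]
  have h3 : X k = c • D.X j := sub_eq_zero.1 (dotProduct_self_eq_zero.1 h2)
  refine ⟨k, c, fun hc => hk ?_, h3⟩
  rw [h3, hc, zero_smul]

end Polytope

end ToricData

/-! ### Lattices and rational coordinates -/

/-- The coordinates of a lattice vector with respect to a basis of lattice vectors are rational. -/
theorem exists_rat_of_mem_lattice {L : AddSubgroup (Fin 3 → ℝ)} (hL : IsLatticeIn L)
    {u : Fin 3 → Fin 3 → ℝ} (hu : ∀ i, u i ∈ L) (hdet : (Matrix.of u).det ≠ 0) {v : Fin 3 → ℝ}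
    (hv : v ∈ L) {x : Fin 3 → ℝ} (hx : v = ∑ i, x i • u i) (i : Fin 3) : ∃ q : ℚ, x i = q := by
  obtain ⟨b, rfl⟩ := hL
  have hint : ∀ w ∈ AddSubgroup.closure (range b), ∃ n : Fin 3 → ℤ, w = ∑ k, (n k : ℝ) • b k := by
    intro w hw
    have : AddSubgroup.closure (range b) ≤ (Fintype.linearCombination ℤ b).toAddMonoidHom.range := by
      rw [AddSubgroup.closure_le]
      rintro _ ⟨j, rfl⟩
      exact ⟨Pi.single j 1, by simp⟩
    obtain ⟨n, rfl⟩ := this hw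
    refine ⟨n, ?_⟩
    change Fintype.linearCombination ℤ b n = _
    simp only [Fintype.linearCombination_apply, Int.cast_smul_eq_zsmul]
  obtain ⟨n, hn⟩ := hint v hv
  choose m hm using fun i => hint (u i) (hu i)
  let A : Matrix (Fin 3) (Fin 3) ℤ := Matrix.of m
  have hA : Matrix.of u = A.map (Int.cast : ℤ → ℝ) * Matrix.of b := by
    ext i k
    rw [Matrix.mul_apply, Matrix.of_apply, hm]
    simp [A]
  have hAdet : (A.map (Int.cast : ℤ → ℝ)).det ≠ 0 := by
    intro h
    rw [hA, Matrix.det_mul, h, zero_mul] at hdet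
    exact hdet rfl
  have hAd : (A.map (Int.cast : ℤ → ℝ)).det = (A.det : ℝ) := (Int.cast_det A).symm
  have hxA : x ᵥ* A.map (Int.cast : ℤ → ℝ) = fun k => (n k : ℝ) := by
    have h1 : ∑ k, ((x ᵥ* A.map (Int.cast : ℤ → ℝ)) k - n k) • b k = 0 := by
      simp only [sub_smul, Finset.sum_sub_distrib]
      rw [← hn, hx, sub_eq_zero]
      simp only [Matrix.vecMul, dotProduct, Finset.sum_smul, Matrix.map_apply, A, Matrix.of_apply]
      rw [Finset.sum_comm]
      refine Finset.sum_congr rfl fun i _ => ?_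
      conv_rhs => rw [hm i]
      rw [Finset.smul_sum]
      exact Finset.sum_congr rfl fun k _ => by rw [smul_smul]
    funext k
    exact sub_eq_zero.1 (Fintype.linearIndependent_iff.1 b.linearIndependent _ h1 k)
  -- Cramer's rule: the integral adjugate turns the integral vector `x A` into `det A · x`.
  have h2 : x ᵥ* A.map (Int.cast : ℤ → ℝ) ᵥ* (A.map (Int.cast : ℤ → ℝ)).adjugate =
      (A.det : ℝ) • x := by
    rw [Matrix.vecMul_vecMul, Matrix.mul_adjugate, Matrix.vecMul_smul, Matrix.vecMul_one, hAd]
  have h3 : (A.map (Int.cast : ℤ → ℝ)).adjugate = A.adjugate.map (Int.cast : ℤ → ℝ) :=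
    ((Int.castRingHom ℝ).map_adjugate A).symm
  rw [hxA, h3] at h2
  have h4 := congrFun h2 i
  rw [hAd] at hAdet
  refine ⟨((∑ k, n k * A.adjugate k i : ℤ) : ℚ) / ((A.det : ℤ) : ℚ), ?_⟩
  rw [Rat.cast_div, Rat.cast_intCast, Rat.cast_intCast, eq_div_iff hAdet, mul_comm]
  simp only [Pi.smul_apply, smul_eq_mul] at h4
  rw [← h4]
  simp [Matrix.vecMul, dotProduct]

/-! ### The ring `ℤ[φ]` and the coordinates of the dodecahedron -/

/-- The ring `ℤ[φ]`, with `⟨a, b⟩ = a + b φ`. -/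
abbrev GoldenInt : Type := QuadraticAlgebra ℤ 1 1

theorem one_div_goldenRatio : 1 / φ = φ - 1 := by
  rw [div_eq_iff Real.goldenRatio_ne_zero]
  linear_combination -Real.goldenRatio_sq

theorem one_div_goldenRatio_sq : 1 / φ ^ 2 = 2 - φ := by
  have h1 := Real.goldenRatio_sq
  have h2 := Real.goldenRatio_ne_zero
  rw [div_eq_iff (pow_ne_zero 2 h2)]
  linear_combination (φ - 1) * h1

/-- The embedding of `ℤ[φ]` in `ℝ`. -/
noncomputable def goldenHom : GoldenInt →+* ℝ where
  toFun x := x.re + x.im * φ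
  map_zero' := by
    change ((0 : ℤ) : ℝ) + ((0 : ℤ) : ℝ) * φ = 0
    rw [Int.cast_zero, zero_mul, zero_add]
  map_one' := by
    change ((1 : ℤ) : ℝ) + ((0 : ℤ) : ℝ) * φ = 1
    rw [Int.cast_zero, Int.cast_one, zero_mul, add_zero]
  map_add' x y := by
    simp only [QuadraticAlgebra.re_add, QuadraticAlgebra.im_add]
    push_cast
    ring
  map_mul' x y := by
    simp only [QuadraticAlgebra.re_mul, QuadraticAlgebra.im_mul]
    push_cast
    linear_combination -(x.im * y.im : ℝ) * Real.goldenRatio_sq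

theorem goldenHom_mk (a b : ℤ) : goldenHom ⟨a, b⟩ = a + b * φ := rfl

/-- This is the irrationality of `φ`. It transfers equality and nonvanishing in `ℝ` to integer
pairs, where finite tables can be decided. -/
theorem goldenHom_injective : Function.Injective goldenHom := by
  rw [injective_iff_map_eq_zero]
  rintro ⟨a, b⟩ h
  rw [goldenHom_mk] at h
  have hb : b = 0 := by
    by_contra hb
    refine Real.goldenRatio_irrational.ne_rat (-a / b) ?_
    have : (b : ℝ) ≠ 0 := by exact_mod_cast hb
    push_cast
    rw [eq_div_iff this]
    linear_combination h
  subst hb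
  have ha : a = 0 := by simpa using h
  subst ha
  rfl

/-- The normals of the dodecahedron. -/
def goldenNormal : Fin 12 → Fin 3 → GoldenInt :=
  ![
    ![⟨2, -1⟩, ⟨-1, 1⟩, ⟨0, 0⟩], ![⟨0, 0⟩, ⟨2, -1⟩, ⟨-1, 1⟩], ![⟨-1, 1⟩, ⟨0, 0⟩, ⟨2, -1⟩],
    ![⟨-2, 1⟩, ⟨-1, 1⟩, ⟨0, 0⟩], ![⟨0, 0⟩, ⟨-2, 1⟩, ⟨-1, 1⟩], ![⟨-1, 1⟩, ⟨0, 0⟩, ⟨-2, 1⟩],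
    ![⟨-2, 1⟩, ⟨1, -1⟩, ⟨0, 0⟩], ![⟨0, 0⟩, ⟨-2, 1⟩, ⟨1, -1⟩], ![⟨1, -1⟩, ⟨0, 0⟩, ⟨-2, 1⟩],
    ![⟨2, -1⟩, ⟨1, -1⟩, ⟨0, 0⟩], ![⟨0, 0⟩, ⟨2, -1⟩, ⟨1, -1⟩], ![⟨1, -1⟩, ⟨0, 0⟩, ⟨2, -1⟩]]

/-- The vertices of the dodecahedron. -/
def goldenVertex : Fin 20 → Fin 3 → GoldenInt :=
  ![
    ![⟨-1, 0⟩, ⟨-1, 0⟩, ⟨-1, 0⟩], ![⟨-1, 0⟩, ⟨-1, 0⟩, ⟨1, 0⟩], ![⟨-1, 0⟩, ⟨1, 0⟩, ⟨-1, 0⟩],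
    ![⟨-1, 0⟩, ⟨1, 0⟩, ⟨1, 0⟩], ![⟨1, 0⟩, ⟨-1, 0⟩, ⟨-1, 0⟩], ![⟨1, 0⟩, ⟨-1, 0⟩, ⟨1, 0⟩],
    ![⟨1, 0⟩, ⟨1, 0⟩, ⟨-1, 0⟩], ![⟨1, 0⟩, ⟨1, 0⟩, ⟨1, 0⟩], ![⟨0, 0⟩, ⟨0, -1⟩, ⟨1, -1⟩],
    ![⟨0, 0⟩, ⟨0, -1⟩, ⟨-1, 1⟩], ![⟨0, 0⟩, ⟨0, 1⟩, ⟨1, -1⟩], ![⟨0, 0⟩, ⟨0, 1⟩, ⟨-1, 1⟩],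
    ![⟨1, -1⟩, ⟨0, 0⟩, ⟨0, -1⟩], ![⟨1, -1⟩, ⟨0, 0⟩, ⟨0, 1⟩], ![⟨-1, 1⟩, ⟨0, 0⟩, ⟨0, -1⟩],
    ![⟨-1, 1⟩, ⟨0, 0⟩, ⟨0, 1⟩], ![⟨0, -1⟩, ⟨1, -1⟩, ⟨0, 0⟩], ![⟨0, -1⟩, ⟨-1, 1⟩, ⟨0, 0⟩],
    ![⟨0, 1⟩, ⟨1, -1⟩, ⟨0, 0⟩], ![⟨0, 1⟩, ⟨-1, 1⟩, ⟨0, 0⟩]]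

/-- The indices of the three facets through a vertex. -/
def dodecahedronFrame : Fin 20 → Fin 3 → Fin 12 :=
  ![
    ![0, 1, 2], ![0, 5, 10], ![2, 4, 9], ![5, 7, 9], ![1, 3, 11], ![3, 8, 10], ![4, 6, 11], ![6, 7, 8],
    ![0, 1, 3], ![0, 3, 10], ![4, 6, 9], ![6, 7, 9], ![1, 2, 4], ![5, 7, 10], ![1, 4, 11], ![7, 8, 10],
    ![0, 2, 5], ![2, 5, 9], ![3, 8, 11], ![6, 8, 11]]

theorem icosahedralY_eq : icosahedralY =
    ![![2 - φ, φ - 1, 0], ![0, 2 - φ, φ - 1], ![φ - 1, 0, 2 - φ],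
      ![-(2 - φ), φ - 1, 0], ![0, -(2 - φ), φ - 1], ![φ - 1, 0, -(2 - φ)]] := by
  simp only [icosahedralY, one_div_goldenRatio, one_div_goldenRatio_sq]

theorem dodecahedronNormals_eq (j : Fin 12) :
    dodecahedronNormals j = goldenHom ∘ goldenNormal j := by
  funext k
  fin_cases j <;> fin_cases k <;>
    simp [dodecahedronNormals, icosahedralY_eq, goldenNormal, goldenHom_mk] <;> ring

/-- The vertices of the dodecahedron. -/
noncomputable def dodecahedronVertex (k : Fin 20) : Fin 3 → ℝ := goldenHom ∘ goldenVertex k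

theorem injective_dodecahedronVertex : Function.Injective dodecahedronVertex := by
  intro k l h
  have h1 : goldenVertex k = goldenVertex l := goldenHom_injective.comp_left h
  have h2 : ∀ k l, goldenVertex k = goldenVertex l → k = l := by decide +kernel
  exact h2 k l h1

theorem dodecahedronVertex_dotProduct (k : Fin 20) (j : Fin 12) :
    dodecahedronVertex k ⬝ᵥ dodecahedronNormals j = goldenHom (goldenVertex k ⬝ᵥ goldenNormal j) := by
  rw [dodecahedronNormals_eq, RingHom.map_dotProduct]
  rfl

theorem range_dodecahedronVertex : range dodecahedronVertex = dodecahedronVertices := by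
  have h1 : ∀ k, ∃ a ∈ ({1, -1} : Finset ℤ), ∃ b ∈ ({1, -1} : Finset ℤ),
      ∃ c ∈ ({1, -1} : Finset ℤ), goldenVertex k = ![⟨a, 0⟩, ⟨b, 0⟩, ⟨c, 0⟩] ∨
        goldenVertex k = ![0, ⟨0, a⟩, ⟨-b, b⟩] ∨ goldenVertex k = ![⟨-a, a⟩, 0, ⟨0, b⟩] ∨
        goldenVertex k = ![⟨0, a⟩, ⟨-b, b⟩, 0] := by decide +kernel
  have h2 : ∀ a ∈ ({1, -1} : Finset ℤ), ∀ b ∈ ({1, -1} : Finset ℤ), ∀ c ∈ ({1, -1} : Finset ℤ),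
      (∃ k, goldenVertex k = ![⟨a, 0⟩, ⟨b, 0⟩, ⟨c, 0⟩]) ∧
        (∃ k, goldenVertex k = ![0, ⟨0, a⟩, ⟨-b, b⟩]) ∧
        (∃ k, goldenVertex k = ![⟨-a, a⟩, 0, ⟨0, b⟩]) ∧
        ∃ k, goldenVertex k = ![⟨0, a⟩, ⟨-b, b⟩, 0] := by decide +kernel
  have e1 : ∀ a b c : ℤ, goldenHom ∘ ![⟨a, 0⟩, ⟨b, 0⟩, ⟨c, 0⟩] = ![(a : ℝ), b, c] := by
    intro a b c
    funext i
    fin_cases i <;> simp [goldenHom_mk]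
  have hdiv : ∀ b : ℝ, b / φ = -b + b * φ := by
    intro b
    rw [div_eq_mul_one_div, one_div_goldenRatio]
    ring
  have e2 : ∀ a b : ℤ, goldenHom ∘ ![0, ⟨0, a⟩, ⟨-b, b⟩] = ![0, (a : ℝ) * φ, b / φ] := by
    intro a b
    funext i
    fin_cases i <;> simp [goldenHom_mk, hdiv]
  have e3 : ∀ a b : ℤ, goldenHom ∘ ![⟨-a, a⟩, 0, ⟨0, b⟩] = ![(a : ℝ) / φ, 0, b * φ] := by
    intro a b
    funext i
    fin_cases i <;> simp [goldenHom_mk, hdiv]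
  have e4 : ∀ a b : ℤ, goldenHom ∘ ![⟨0, a⟩, ⟨-b, b⟩, 0] = ![(a : ℝ) * φ, b / φ, 0] := by
    intro a b
    funext i
    fin_cases i <;> simp [goldenHom_mk, hdiv]
  have hs : ∀ a ∈ ({1, -1} : Finset ℤ), (a : ℝ) ∈ ({1, -1} : Set ℝ) := by
    intro a ha
    rcases Finset.mem_insert.1 ha with rfl | ha
    · simp
    · rw [Finset.mem_singleton.1 ha]
      simp
  have hs' : ∀ x ∈ ({1, -1} : Set ℝ), ∃ a ∈ ({1, -1} : Finset ℤ), x = a := by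
    rintro x (rfl | rfl)
    · exact ⟨1, by simp, by simp⟩
    · exact ⟨-1, by simp, by simp⟩
  ext v
  constructor
  · rintro ⟨k, rfl⟩
    obtain ⟨a, ha, b, hb, c, hc, h⟩ := h1 k
    refine ⟨a, hs a ha, b, hs b hb, c, hs c hc, ?_⟩
    unfold dodecahedronVertex
    rw [← e1, ← e2, ← e3, ← e4]
    rcases h with h | h | h | h <;> rw [h] <;> simp
  · rintro ⟨x, hx, y, hy, z, hz, h⟩
    obtain ⟨a, ha, rfl⟩ := hs' x hx
    obtain ⟨b, hb, rfl⟩ := hs' y hy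
    obtain ⟨c, hc, rfl⟩ := hs' z hz
    rw [← e1, ← e2, ← e3, ← e4] at h
    obtain ⟨⟨k1, g1⟩, ⟨k2, g2⟩, ⟨k3, g3⟩, ⟨k4, g4⟩⟩ := h2 a ha b hb c hc
    rcases h with rfl | rfl | rfl | rfl
    · exact ⟨k1, by rw [dodecahedronVertex, g1]⟩
    · exact ⟨k2, by rw [dodecahedronVertex, g2]⟩
    · exact ⟨k3, by rw [dodecahedronVertex, g3]⟩
    · exact ⟨k4, by rw [dodecahedronVertex, g4]⟩

theorem ncard_dodecahedronVertices : dodecahedronVertices.ncard = 20 := by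
  rw [← range_dodecahedronVertex, ← image_univ,
    ncard_image_of_injective _ injective_dodecahedronVertex, ncard_univ, Nat.card_eq_fintype_card,
    Fintype.card_fin]

/-- The 240 pairings take in `ℤ[φ]` only the values `-1`, exactly on the frames, and `1`, `±(2φ -
3)`, which exceed `-1` because `1 < φ < 2`. -/
theorem dodecahedronVertex_cases (k : Fin 20) (j : Fin 12) :
    (dodecahedronVertex k ⬝ᵥ dodecahedronNormals j = -1 ∧ j ∈ range (dodecahedronFrame k)) ∨
      (-1 < dodecahedronVertex k ⬝ᵥ dodecahedronNormals j ∧ j ∉ range (dodecahedronFrame k)) := by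
  have h : ∀ k j, (goldenVertex k ⬝ᵥ goldenNormal j = -1 ∧ ∃ i, dodecahedronFrame k i = j) ∨
      ((goldenVertex k ⬝ᵥ goldenNormal j = 1 ∨ goldenVertex k ⬝ᵥ goldenNormal j = ⟨-3, 2⟩ ∨
        goldenVertex k ⬝ᵥ goldenNormal j = ⟨3, -2⟩) ∧ ¬∃ i, dodecahedronFrame k i = j) := by
    decide +kernel
  have h1 := Real.one_lt_goldenRatio
  have h2 := Real.goldenRatio_lt_two
  rw [dodecahedronVertex_dotProduct]
  rcases h k j with ⟨h, h'⟩ | ⟨h | h | h, h'⟩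
  · exact Or.inl ⟨by rw [h, map_neg, map_one], h'⟩
  · exact Or.inr ⟨by rw [h, map_one]; norm_num, h'⟩
  · refine Or.inr ⟨?_, h'⟩
    rw [h, goldenHom_mk]
    push_cast
    linarith
  · refine Or.inr ⟨?_, h'⟩
    rw [h, goldenHom_mk]
    push_cast
    linarith

theorem isVertexFrame_dodecahedron (k : Fin 20) :
    dodecahedronData.IsVertexFrame (dodecahedronVertex k) (dodecahedronFrame k) where
  mem j := by
    rcases dodecahedronVertex_cases k j with h | h
    · exact h.1.ge
    · exact h.1.le
  range_eq := by
    ext j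
    rcases dodecahedronVertex_cases k j with h | h
    · exact iff_of_true h.2 h.1
    · exact iff_of_false h.2 h.1.ne'
  det_ne_zero := by
    have h : ∀ k, (Matrix.of fun i => goldenNormal (dodecahedronFrame k i)).det ≠ 0 := by
      simp only [Matrix.det_fin_three, Matrix.of_apply]
      decide +kernel
    have h1 : dodecahedronData.frameMatrix (dodecahedronFrame k) =
        goldenHom.mapMatrix (Matrix.of fun i => goldenNormal (dodecahedronFrame k i)) := by
      ext i l
      exact congrFun (dodecahedronNormals_eq (dodecahedronFrame k i)) l
    rw [h1, ← RingHom.map_det, map_ne_zero_iff _ goldenHom_injective]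
    exact h k

/-- The bound `5/3` is precisely what `2φ - 3 < 7 - 4φ` requires when inner products of normals are
compared with their squared length. -/
theorem goldenRatio_lt_five_thirds : φ < 5 / 3 := by
  nlinarith [Real.goldenRatio_sq, Real.goldenRatio_pos]

/-- The witness is the foot of the perpendicular from the origin, `-X_j / |X_j|²` with `|X_j|² = 7 -
4φ`. Strictness at the other facets says `⟨X_j, X_k⟩ < |X_j|²`; the inner products are `±(2φ - 3)`
and `-|X_j|²`. -/
theorem hasGenericFacets_dodecahedron : dodecahedronData.HasGenericFacets fun j =>
    -(1 / (7 - 4 * φ)) • dodecahedronNormals j := by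
  have hself : ∀ j, dodecahedronNormals j ⬝ᵥ dodecahedronNormals j = 7 - 4 * φ := by
    have h : ∀ j, goldenNormal j ⬝ᵥ goldenNormal j = ⟨7, -4⟩ := by decide +kernel
    intro j
    rw [dodecahedronNormals_eq, ← RingHom.map_dotProduct, h, goldenHom_mk]
    push_cast
    ring
  have hpos : 0 < 7 - 4 * φ := by linarith [goldenRatio_lt_five_thirds]
  have hne : ∀ j k, k ≠ j → dodecahedronNormals j ⬝ᵥ dodecahedronNormals k < 7 - 4 * φ := by
    have h : ∀ j k, k ≠ j → goldenNormal j ⬝ᵥ goldenNormal k = ⟨-3, 2⟩ ∨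
        goldenNormal j ⬝ᵥ goldenNormal k = ⟨3, -2⟩ ∨ goldenNormal j ⬝ᵥ goldenNormal k = ⟨-7, 4⟩ := by
      decide +kernel
    intro j k hjk
    have h1 := Real.one_lt_goldenRatio
    have h2 := goldenRatio_lt_five_thirds
    rw [dodecahedronNormals_eq, dodecahedronNormals_eq, ← RingHom.map_dotProduct]
    rcases h j k hjk with h | h | h <;> rw [h, goldenHom_mk] <;> push_cast <;> linarith
  refine ⟨fun j => ?_, fun j k hjk => ?_, fun j h0 => ?_⟩
  · change (-(1 / (7 - 4 * φ)) • dodecahedronNormals j) ⬝ᵥ dodecahedronNormals j = -1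
    rw [smul_dotProduct, hself, smul_eq_mul, neg_mul, one_div,
      inv_mul_cancel₀ hpos.ne']
  · change -1 < (-(1 / (7 - 4 * φ)) • dodecahedronNormals j) ⬝ᵥ dodecahedronNormals k
    rw [smul_dotProduct, smul_eq_mul, neg_mul, neg_lt_neg_iff, one_div, inv_mul_lt_iff₀ hpos, mul_one]
    exact hne j k hjk
  · have h1 := hself j
    rw [show dodecahedronNormals j = 0 from h0, dotProduct_zero] at h1
    exact hpos.ne h1

/-! ### The dodecahedron as a cube with six roofs -/

theorem Convex.vec_mem_of_abs_le {Q : Set (Fin 3 → ℝ)} (hQ : Convex ℝ Q) {u w : Fin 3 → ℝ}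
    {B y : ℝ} (hy : |y| ≤ B) (h1 : u + B • w ∈ Q) (h2 : u + (-B) • w ∈ Q) : u + y • w ∈ Q := by
  have hconv : Convex ℝ {t : ℝ | u + t • w ∈ Q} := by
    intro a ha b hb p q hp hq hpq
    have h := hQ ha hb hp hq hpq
    have e : p • (u + a • w) + q • (u + b • w) = u + (p • a + q • b) • w := by
      rw [smul_add, smul_add, add_add_add_comm, ← add_smul, hpq, one_smul, add_smul, smul_assoc,
        smul_assoc]
    rwa [e] at h
  obtain ⟨h3, h4⟩ := abs_le.1 hy
  exact hconv.ordConnected.out h2 h1 ⟨h3, h4⟩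

theorem Convex.mem_of_abs_snd_le {Q : Set (Fin 3 → ℝ)} (hQ : Convex ℝ Q) {x y z B : ℝ}
    (hy : |y| ≤ B) (h1 : ![x, B, z] ∈ Q) (h2 : ![x, -B, z] ∈ Q) : ![x, y, z] ∈ Q := by
  have e : ∀ t : ℝ, ![x, t, z] = ![x, 0, z] + t • ![0, 1, 0] := by
    intro t
    funext i
    fin_cases i <;> simp
  rw [e] at h1 h2 ⊢
  exact hQ.vec_mem_of_abs_le hy h1 h2

theorem Convex.mem_of_abs_trd_le {Q : Set (Fin 3 → ℝ)} (hQ : Convex ℝ Q) {x y z B : ℝ}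
    (hz : |z| ≤ B) (h1 : ![x, y, B] ∈ Q) (h2 : ![x, y, -B] ∈ Q) : ![x, y, z] ∈ Q := by
  have e : ∀ t : ℝ, ![x, y, t] = ![x, y, 0] + t • ![0, 0, 1] := by
    intro t
    funext i
    fin_cases i <;> simp
  rw [e] at h1 h2 ⊢
  exact hQ.vec_mem_of_abs_le hz h1 h2

theorem Convex.mem_of_abs_fst_le {Q : Set (Fin 3 → ℝ)} (hQ : Convex ℝ Q) {x y z B : ℝ}
    (hx : |x| ≤ B) (h1 : ![B, y, z] ∈ Q) (h2 : ![-B, y, z] ∈ Q) : ![x, y, z] ∈ Q := by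
  have e : ∀ t : ℝ, ![t, y, z] = ![0, y, z] + t • ![1, 0, 0] := by
    intro t
    funext i
    fin_cases i <;> simp
  rw [e] at h1 h2 ⊢
  exact hQ.vec_mem_of_abs_le hx h1 h2

/-- The part of the dodecahedron over a face of the cube `[-1, 1]³`. -/
theorem Convex.mem_of_one_le_abs {Q : Set (Fin 3 → ℝ)} (hQ : Convex ℝ Q)
    (hcube : ∀ a ∈ ({1, -1} : Set ℝ), ∀ b ∈ ({1, -1} : Set ℝ), ∀ c ∈ ({1, -1} : Set ℝ),
      ![a, b, c] ∈ Q)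
    (hroof : ∀ a ∈ ({1, -1} : Set ℝ), ∀ b ∈ ({1, -1} : Set ℝ), ![a * φ, b / φ, 0] ∈ Q)
    {x y z : ℝ} (hx : 1 ≤ |x|) (hxz : (2 - φ) * |z| + (φ - 1) * |x| ≤ 1)
    (hxy : (2 - φ) * |x| + (φ - 1) * |y| ≤ 1) : ![x, y, z] ∈ Q := by
  have hφ := Real.goldenRatio_sq
  have h1 := Real.one_lt_goldenRatio
  have h2 := Real.goldenRatio_lt_two
  obtain ⟨a, ha, hxa⟩ : ∃ a ∈ ({1, -1} : Set ℝ), x = a * |x| := by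
    rcases abs_cases x with ⟨h, -⟩ | ⟨h, -⟩
    · exact ⟨1, by simp, by rw [h, one_mul]⟩
    · exact ⟨-1, by simp, by rw [h]; ring⟩
  set r := |x|
  have hr : r ≤ φ := by
    have h3 : 0 ≤ (2 - φ) * |z| := mul_nonneg (by linarith) (abs_nonneg z)
    have h4 : (φ - 1) * r ≤ (φ - 1) * φ := by nlinarith
    exact le_of_mul_le_mul_left h4 (by linarith)
  -- Height in the roof: `t = 0` on the face of the cube and `t = 1` on the ridge `|x| = φ`.
  let t := (r - 1) / (φ - 1)
  have ht : t * (φ - 1) = r - 1 := div_mul_cancel₀ _ (by linarith)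
  have ht0 : 0 ≤ t := div_nonneg (by linarith) (by linarith)
  have ht1 : t ≤ 1 := (div_le_one (by linarith)).2 (by linarith)
  -- Combining a cube vertex with a ridge vertex gives a corner of the rectangle in which the roof
  -- is cut at this height.
  have hcorner : ∀ b ∈ ({1, -1} : Set ℝ), ∀ c ∈ ({1, -1} : Set ℝ),
      ![x, b * (1 - t + t * (φ - 1)), c * (1 - t)] ∈ Q := by
    intro b hb c hc
    have h := hQ (hcube a ha b hb c hc) (hroof a ha b hb) (sub_nonneg.2 ht1) ht0 (by ring)
    convert h using 1
    have hbφ : b / φ = b * (φ - 1) := by rw [div_eq_mul_one_div, one_div_goldenRatio]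
    funext i
    fin_cases i
    · simp
      rw [hxa]
      linear_combination (-a) * ht
    · simp [hbφ]
      ring
    · simp
      ring
  have hy : |y| ≤ 1 - t + t * (φ - 1) := by
    have h3 : (φ - 1) * |y| ≤ (φ - 1) * (1 - t + t * (φ - 1)) := by nlinarith
    exact le_of_mul_le_mul_left h3 (by linarith)
  have hz : |z| ≤ 1 - t := by
    have h3 : (2 - φ) * |z| ≤ (2 - φ) * (1 - t) := by nlinarith
    exact le_of_mul_le_mul_left h3 (by linarith)
  have hmid : ∀ c ∈ ({1, -1} : Set ℝ), ![x, y, c * (1 - t)] ∈ Q := by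
    intro c hc
    refine hQ.mem_of_abs_snd_le hy ?_ ?_
    · simpa using hcorner 1 (by simp) c hc
    · simpa using hcorner (-1) (by simp) c hc
  refine hQ.mem_of_abs_trd_le hz ?_ ?_
  · simpa using hmid 1 (by simp)
  · simpa using hmid (-1) (by simp)

/-- A point of the intersection is either in the cube `[-1, 1]³` or has a coordinate of absolute
value at least `1`, and then lies in the roof over that face. Cyclic permutation of the coordinates
reduces the roofs to one case. -/
theorem dodecahedron_eq_polyhedron :
    dodecahedron = polyhedron dodecahedronNormals fun _ => -1 := by
  refine Subset.antisymm ?_ fun μ hμ => ?_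
  · refine convexHull_min ?_ (ToricData.convex_polyhedron _ _)
    rw [← range_dodecahedronVertex]
    rintro _ ⟨k, rfl⟩
    exact (isVertexFrame_dodecahedron k).mem
  · have hQ : Convex ℝ dodecahedron := convex_convexHull ℝ _
    have hV : ∀ v ∈ dodecahedronVertices, v ∈ dodecahedron := fun v hv => subset_convexHull ℝ _ hv
    have hcube : ∀ a ∈ ({1, -1} : Set ℝ), ∀ b ∈ ({1, -1} : Set ℝ), ∀ c ∈ ({1, -1} : Set ℝ),
        ![a, b, c] ∈ dodecahedron := fun a ha b hb c hc =>
      hV _ ⟨a, ha, b, hb, c, hc, Or.inl rfl⟩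
    have hμ' := fun j => hμ j
    obtain ⟨x, y, z, rfl⟩ : ∃ x y z, μ = ![x, y, z] :=
      ⟨μ 0, μ 1, μ 2, by funext i; fin_cases i <;> rfl⟩
    -- The twelve inequalities group into three sets of four, each equivalent to one inequality in
    -- the absolute values of two coordinates.
    have hA := And.intro (hμ' 0) (And.intro (hμ' 3) (And.intro (hμ' 6) (hμ' 9)))
    have hB := And.intro (hμ' 1) (And.intro (hμ' 4) (And.intro (hμ' 7) (hμ' 10)))
    have hC := And.intro (hμ' 2) (And.intro (hμ' 5) (And.intro (hμ' 8) (hμ' 11)))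
    simp only [dodecahedronNormals, icosahedralY, dotProduct, Fin.sum_univ_three, Pi.neg_apply,
      Fin.isValue, Matrix.cons_val, one_div_goldenRatio, one_div_goldenRatio_sq, mul_zero, neg_zero,
      add_zero, zero_add] at hA hB hC
    have hxy : (2 - φ) * |x| + (φ - 1) * |y| ≤ 1 := by
      rcases abs_cases x with ⟨h, -⟩ | ⟨h, -⟩ <;> rcases abs_cases y with ⟨h', -⟩ | ⟨h', -⟩ <;>
        rw [h, h'] <;> linarith [hA.1, hA.2.1, hA.2.2.1, hA.2.2.2]
    have hyz : (2 - φ) * |y| + (φ - 1) * |z| ≤ 1 := by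
      rcases abs_cases y with ⟨h, -⟩ | ⟨h, -⟩ <;> rcases abs_cases z with ⟨h', -⟩ | ⟨h', -⟩ <;>
        rw [h, h'] <;> linarith [hB.1, hB.2.1, hB.2.2.1, hB.2.2.2]
    have hzx : (2 - φ) * |z| + (φ - 1) * |x| ≤ 1 := by
      rcases abs_cases z with ⟨h, -⟩ | ⟨h, -⟩ <;> rcases abs_cases x with ⟨h', -⟩ | ⟨h', -⟩ <;>
        rw [h, h'] <;> linarith [hC.1, hC.2.1, hC.2.2.1, hC.2.2.2]
    have hone : (1 : ℝ) ∈ ({1, -1} : Set ℝ) := by simp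
    rcases le_total 1 |x| with hx | hx
    · exact hQ.mem_of_one_le_abs hcube (fun a ha b hb =>
        hV _ ⟨a, ha, b, hb, 1, hone, Or.inr (Or.inr (Or.inr rfl))⟩) hx hzx hxy
    rcases le_total 1 |y| with hy | hy
    · let T : (Fin 3 → ℝ) →ₗ[ℝ] Fin 3 → ℝ := LinearMap.funLeft ℝ ℝ ![2, 0, 1]
      have hT : ∀ a b c : ℝ, T ![a, b, c] = ![c, a, b] := by
        intro a b c
        funext i
        fin_cases i <;> rfl
      have h := (hQ.linear_preimage T).mem_of_one_le_abs
        (fun a ha b hb c hc => by rw [mem_preimage, hT]; exact hcube c hc a ha b hb)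
        (fun a ha b hb => by
          rw [mem_preimage, hT]
          exact hV _ ⟨a, ha, b, hb, 1, hone, Or.inr (Or.inl rfl)⟩) hy hxy hyz
      rwa [mem_preimage, hT] at h
    rcases le_total 1 |z| with hz | hz
    · let T : (Fin 3 → ℝ) →ₗ[ℝ] Fin 3 → ℝ := LinearMap.funLeft ℝ ℝ ![1, 2, 0]
      have hT : ∀ a b c : ℝ, T ![a, b, c] = ![b, c, a] := by
        intro a b c
        funext i
        fin_cases i <;> rfl
      have h := (hQ.linear_preimage T).mem_of_one_le_abs
        (fun a ha b hb c hc => by rw [mem_preimage, hT]; exact hcube b hb c hc a ha)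
        (fun a ha b hb => by
          rw [mem_preimage, hT]
          exact hV _ ⟨b, hb, a, ha, 1, hone, Or.inr (Or.inr (Or.inl rfl))⟩) hz hyz hzx
      rwa [mem_preimage, hT] at h
    have hneg : (-1 : ℝ) ∈ ({1, -1} : Set ℝ) := by simp
    have h1 : ∀ b ∈ ({1, -1} : Set ℝ), ∀ c ∈ ({1, -1} : Set ℝ), ![x, b, c] ∈ dodecahedron :=
      fun b hb c hc => hQ.mem_of_abs_fst_le hx (hcube 1 hone b hb c hc) (hcube (-1) hneg b hb c hc)
    have h2 : ∀ c ∈ ({1, -1} : Set ℝ), ![x, y, c] ∈ dodecahedron :=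
      fun c hc => hQ.mem_of_abs_snd_le hy (h1 1 hone c hc) (h1 (-1) hneg c hc)
    exact hQ.mem_of_abs_trd_le hz (h2 1 hone) (h2 (-1) hneg)

/-! ### Generalities on the level set, the kernel and transversality -/

namespace ToricData

variable {d : ℕ} (D : ToricData d)

theorem piMap_single (j : Fin d) : D.piMap ℝ (Pi.single j 1) = D.X j := by
  funext k
  rw [piMap_apply, Finset.sum_eq_single j (fun i _ hi => by rw [Pi.single_eq_of_ne hi, zero_mul])
    (fun h => absurd (Finset.mem_univ j) h), Pi.single_eq_same, one_mul]
  rfl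

theorem J_single (z : Fin d → ℂ) (j : Fin d) : D.J z (Pi.single j 1) = ‖z j‖ ^ 2 + D.lam j := by
  rw [J, Fintype.linearCombination_apply_single, one_smul]

theorem mem_levelSet_iff_of_ker_eq_span {ι : Type} {v : ι → Fin d → ℝ}
    (hv : LinearMap.ker (D.piMap ℝ) = Submodule.span ℝ (range v)) {z : Fin d → ℂ} :
    z ∈ D.levelSet ↔ ∀ i, D.J z (v i) = 0 := by
  constructor
  · intro h i
    exact LinearMap.congr_fun (h : D.Ψ z = 0) ⟨v i, hv ▸ Submodule.subset_span (mem_range_self i)⟩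
  · intro h
    have h1 : LinearMap.ker (D.piMap ℝ) ≤ LinearMap.ker (D.J z) := by
      rw [hv, Submodule.span_le]
      rintro _ ⟨i, rfl⟩
      exact h i
    exact LinearMap.ext fun θ => h1 θ.2

theorem isClosed_levelSet : IsClosed D.levelSet := by
  have h : D.levelSet = ⋂ (θ : Fin d → ℝ) (_ : D.piMap ℝ θ = 0),
      {z | ∑ j, θ j * (‖z j‖ ^ 2 + D.lam j) = 0} := by
    ext z
    simp only [mem_levelSet_iff_forall, mem_iInter, mem_ofPred_eq]
  rw [h]
  exact isClosed_iInter fun θ => isClosed_iInter fun _ =>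
    isClosed_eq (by fun_prop) continuous_const

theorem finrank_ker_piMap {e : Fin 3 → Fin d} (he : (D.frameMatrix e).det ≠ 0) :
    Module.finrank ℝ (LinearMap.ker (D.piMap ℝ)) + 3 = d := by
  have h1 := LinearMap.finrank_range_add_finrank_ker (D.piMap ℝ)
  have h2 : LinearMap.range (D.piMap ℝ) = ⊤ :=
    LinearMap.range_eq_top.2 fun ξ => ⟨_, piMap_frameSection he ξ⟩
  rw [h2, finrank_top, Module.finrank_fin_fun, Module.finrank_fin_fun] at h1
  omega

/-- The tangent space of the slice and that of the orbit are complementary. -/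
theorem isCompl_orbitTangent {e : Fin 3 → Fin d} (he : (D.frameMatrix e).det ≠ 0)
    {w : Fin d → ℂ} (hw : ∀ j ∉ range e, w j ≠ 0) :
    IsCompl (D.orbitTangent w) (Submodule.span ℂ (range fun i => Pi.single (e i) 1)) := by
  have hmem : ∀ v ∈ Submodule.span ℂ (range fun i => (Pi.single (e i) 1 : Fin d → ℂ)),
      ∀ j ∉ range e, v j = 0 := by
    intro v hv j hj
    induction hv using Submodule.span_induction with
    | mem x hx =>
      obtain ⟨i, rfl⟩ := hx
      exact Pi.single_eq_of_ne (fun h => hj ⟨i, h.symm⟩) _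
    | zero => rfl
    | add x y _ _ hx hy => rw [Pi.add_apply, hx, hy, add_zero]
    | smul a x _ hx => rw [Pi.smul_apply, hx, smul_zero]
  have hpi : (2 * Real.pi * Complex.I : ℂ) ≠ 0 := Complex.two_pi_I_ne_zero
  refine IsCompl.of_eq ?_ ?_
  · rw [Submodule.eq_bot_iff]
    rintro _ ⟨⟨θ, hθ, rfl⟩, h2⟩
    have h3 : θ = 0 := by
      refine eq_zero_of_piMap_eq_zero he (fun j hj => ?_) hθ
      have h4 : (2 * Real.pi * Complex.I * w j) * θ j = 0 := hmem _ h2 j hj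
      exact (mul_eq_zero.1 h4).resolve_left (mul_ne_zero hpi (hw j hj))
    rw [h3, map_zero]
  · rw [eq_top_iff]
    rintro v -
    -- Off the frame `θ` is chosen so that the orbit direction agrees with `v`. `adjust` restores
    -- `π(θ) = 0`, and the difference is supported on the frame.
    set c : Fin d → ℂ := fun j => v j / (2 * Real.pi * Complex.I * w j)
    set θ := D.adjust e 0 c
    set u : Fin d → ℂ := fun j => (2 * Real.pi * Complex.I * w j) * θ j
    have hu : u ∈ D.orbitTangent w := ⟨θ, piMap_adjust he 0 c, rfl⟩
    have hvu : v - u = ∑ i, (v - u) (e i) • (Pi.single (e i) 1 : Fin d → ℂ) := by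
      funext j
      rw [Finset.sum_apply]
      by_cases hj : j ∈ range e
      · obtain ⟨i, rfl⟩ := hj
        rw [Finset.sum_eq_single i]
        · simp
        · intro k _ hk
          rw [Pi.smul_apply, Pi.single_eq_of_ne, smul_zero]
          exact fun h => hk (injective_of_det_frameMatrix he h).symm
        · exact fun h => absurd (Finset.mem_univ i) h
      · rw [Finset.sum_eq_zero]
        · have h1 : θ j = v j / (2 * Real.pi * Complex.I * w j) := adjust_of_notMem 0 c hj
          have h2 : u j = v j := by
            change (2 * Real.pi * Complex.I * w j) * θ j = v j
            rw [h1, mul_div_cancel₀ _ (mul_ne_zero hpi (hw j hj))]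
          rw [Pi.sub_apply, h2, sub_self]
        · intro i _
          rw [Pi.smul_apply, Pi.single_eq_of_ne (fun h => hj ⟨i, h.symm⟩), smul_zero]
    have h1 : v - u ∈ Submodule.span ℂ (range fun i => (Pi.single (e i) 1 : Fin d → ℂ)) := by
      rw [hvu]
      exact Submodule.sum_mem _ fun i _ =>
        Submodule.smul_mem _ _ (Submodule.subset_span (mem_range_self i))
    rw [← add_sub_cancel u v]
    exact Submodule.add_mem_sup hu h1

end ToricData

/-! ### The quasilattice, the kernel and the level set of the dodecahedron -/

theorem mem_icosahedralP (j : Fin 12) : dodecahedronNormals j ∈ icosahedralP :=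
  dodecahedronData.mem j

theorem icosahedralP_eq_closure :
    icosahedralP = AddSubgroup.closure (range dodecahedronNormals) := by
  refine le_antisymm ?_ ?_
  · refine AddSubgroup.closure_mono ?_
    rintro _ ⟨i, rfl⟩
    exact ⟨Fin.castAdd 6 i, by fin_cases i <;> rfl⟩
  · rw [AddSubgroup.closure_le]
    rintro _ ⟨j, rfl⟩
    exact mem_icosahedralP j

/-- The relation `φ(Y_3 + Y_4) = Y_1 + Y_2` solved for `Y_4`. With its two cyclic images it
expresses all generators in the frame `Y_1, Y_2, Y_3`; the kernel of `π`, the group `Γ` and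
non-rationality all rest on it. -/
theorem icosahedralY_three :
    icosahedralY 3 = (φ - 1) • (icosahedralY 0 + icosahedralY 1) - icosahedralY 2 := by
  have h := Real.goldenRatio_sq
  rw [icosahedralY_eq]
  generalize φ = x at h ⊢
  funext k
  fin_cases k <;> simp <;> first | linear_combination h | linear_combination -h | ring

theorem icosahedralY_four :
    icosahedralY 4 = (φ - 1) • (icosahedralY 1 + icosahedralY 2) - icosahedralY 0 := by
  have h := Real.goldenRatio_sq
  rw [icosahedralY_eq]
  generalize φ = x at h ⊢
  funext k
  fin_cases k <;> simp <;> first | linear_combination h | linear_combination -h | ring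

theorem icosahedralY_five :
    icosahedralY 5 = (φ - 1) • (icosahedralY 0 + icosahedralY 2) - icosahedralY 1 := by
  have h := Real.goldenRatio_sq
  rw [icosahedralY_eq]
  generalize φ = x at h ⊢
  funext k
  fin_cases k <;> simp <;> first | linear_combination h | linear_combination -h | ring

theorem det_frameMatrix_dodecahedron : (dodecahedronData.frameMatrix ![0, 1, 2]).det ≠ 0 :=
  (isVertexFrame_dodecahedron 0).det_ne_zero

theorem goldenRatio_mul_sub_one : φ * (φ - 1) = 1 := by
  linear_combination Real.goldenRatio_sq

theorem ker_piMap_dodecahedron : LinearMap.ker (dodecahedronData.piMap ℝ) =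
    Submodule.span ℝ (range dodecahedronKernelVectors) := by
  have hX : ∀ j, dodecahedronData.piMap ℝ (Pi.single j 1) = dodecahedronNormals j :=
    dodecahedronData.piMap_single
  have hle : Submodule.span ℝ (range dodecahedronKernelVectors) ≤
      LinearMap.ker (dodecahedronData.piMap ℝ) := by
    have h (a b c : Fin 3 → ℝ) : a + b - φ • (c + ((φ - 1) • (a + b) - c)) = 0 := by
      rw [add_sub_cancel, smul_smul, goldenRatio_mul_sub_one, one_smul, sub_self]
    rw [Submodule.span_le]
    rintro _ ⟨i, rfl⟩
    change dodecahedronData.piMap ℝ (dodecahedronKernelVectors i) = 0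
    fin_cases i
    · change dodecahedronData.piMap ℝ (Pi.single 0 1 + Pi.single 6 1) = 0
      rw [map_add, hX, hX]
      exact add_neg_cancel (icosahedralY 0)
    · change dodecahedronData.piMap ℝ (Pi.single 1 1 + Pi.single 7 1) = 0
      rw [map_add, hX, hX]
      exact add_neg_cancel (icosahedralY 1)
    · change dodecahedronData.piMap ℝ (Pi.single 2 1 + Pi.single 8 1) = 0
      rw [map_add, hX, hX]
      exact add_neg_cancel (icosahedralY 2)
    · change dodecahedronData.piMap ℝ (Pi.single 3 1 + Pi.single 9 1) = 0
      rw [map_add, hX, hX]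
      exact add_neg_cancel (icosahedralY 3)
    · change dodecahedronData.piMap ℝ (Pi.single 4 1 + Pi.single 10 1) = 0
      rw [map_add, hX, hX]
      exact add_neg_cancel (icosahedralY 4)
    · change dodecahedronData.piMap ℝ (Pi.single 5 1 + Pi.single 11 1) = 0
      rw [map_add, hX, hX]
      exact add_neg_cancel (icosahedralY 5)
    · change dodecahedronData.piMap ℝ
        (Pi.single 0 1 + Pi.single 1 1 - φ • (Pi.single 2 1 + Pi.single 3 1)) = 0
      rw [map_sub, map_smul, map_add, map_add, hX, hX, hX, hX]
      change icosahedralY 0 + icosahedralY 1 - φ • (icosahedralY 2 + icosahedralY 3) = 0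
      rw [icosahedralY_three, h]
    · change dodecahedronData.piMap ℝ
        (Pi.single 1 1 + Pi.single 2 1 - φ • (Pi.single 0 1 + Pi.single 4 1)) = 0
      rw [map_sub, map_smul, map_add, map_add, hX, hX, hX, hX]
      change icosahedralY 1 + icosahedralY 2 - φ • (icosahedralY 0 + icosahedralY 4) = 0
      rw [icosahedralY_four, h]
    · change dodecahedronData.piMap ℝ
        (Pi.single 0 1 + Pi.single 2 1 - φ • (Pi.single 1 1 + Pi.single 5 1)) = 0
      rw [map_sub, map_smul, map_add, map_add, hX, hX, hX, hX]
      change icosahedralY 0 + icosahedralY 2 - φ • (icosahedralY 1 + icosahedralY 5) = 0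
      rw [icosahedralY_five, h]
  refine le_antisymm (fun θ hθ => ?_) hle
  -- The first six coefficients clear the coordinates 6 to 11. The last three clear 3, 4, 5, where
  -- the kernel vectors have entry `-φ` and `1/φ = φ - 1`. The remainder lies in `ker π` and is
  -- supported on the frame, hence is zero.
  let c : Fin 9 → ℝ := ![θ 6, θ 7, θ 8, θ 9, θ 10, θ 11, -(φ - 1) * (θ 3 - θ 9),
    -(φ - 1) * (θ 4 - θ 10), -(φ - 1) * (θ 5 - θ 11)]
  have hc : ∑ i, c i • dodecahedronKernelVectors i ∈
      Submodule.span ℝ (range dodecahedronKernelVectors) :=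
    Submodule.sum_mem _ fun i _ => Submodule.smul_mem _ _ (Submodule.subset_span (mem_range_self i))
  have h0 : θ - ∑ i, c i • dodecahedronKernelVectors i = 0 := by
    refine ToricData.eq_zero_of_piMap_eq_zero det_frameMatrix_dodecahedron (fun j hj => ?_)
      (Submodule.sub_mem _ hθ (hle hc))
    have hφ := goldenRatio_mul_sub_one
    rw [Pi.sub_apply, Finset.sum_apply]
    fin_cases j
    · exact absurd ⟨0, rfl⟩ hj
    · exact absurd ⟨1, rfl⟩ hj
    · exact absurd ⟨2, rfl⟩ hj
    all_goals simp [Fin.sum_univ_succ, c, dodecahedronKernelVectors]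
    · linear_combination -(θ 3 - θ 9) * hφ
    · linear_combination -(θ 4 - θ 10) * hφ
    · linear_combination -(θ 5 - θ 11) * hφ
  rw [sub_eq_zero.1 h0]
  exact hc

theorem mem_levelSet_dodecahedron {z : Fin 12 → ℂ} : z ∈ dodecahedronData.levelSet ↔
    (∀ i : Fin 6, ‖z (Fin.castAdd 6 i)‖ ^ 2 + ‖z (Fin.natAdd 6 i)‖ ^ 2 = 2) ∧
      ‖z 0‖ ^ 2 + ‖z 1‖ ^ 2 - φ * (‖z 2‖ ^ 2 + ‖z 3‖ ^ 2) = -(2 / φ) ∧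
      ‖z 1‖ ^ 2 + ‖z 2‖ ^ 2 - φ * (‖z 0‖ ^ 2 + ‖z 4‖ ^ 2) = -(2 / φ) ∧
      ‖z 0‖ ^ 2 + ‖z 2‖ ^ 2 - φ * (‖z 1‖ ^ 2 + ‖z 5‖ ^ 2) = -(2 / φ) := by
  have hJ : ∀ j, dodecahedronData.J z (Pi.single j 1) = ‖z j‖ ^ 2 + -1 :=
    dodecahedronData.J_single z
  have h1 : ∀ i j, dodecahedronData.J z (Pi.single i 1 + Pi.single j 1) = 0 ↔
      ‖z i‖ ^ 2 + ‖z j‖ ^ 2 = 2 := by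
    intro i j
    rw [map_add, hJ, hJ]
    constructor <;> intro h <;> linarith
  have h2 : ∀ i j k l, dodecahedronData.J z
      (Pi.single i 1 + Pi.single j 1 - φ • (Pi.single k 1 + Pi.single l 1)) = 0 ↔
      ‖z i‖ ^ 2 + ‖z j‖ ^ 2 - φ * (‖z k‖ ^ 2 + ‖z l‖ ^ 2) = -(2 / φ) := by
    intro i j k l
    have h3 : 2 / φ = 2 * (φ - 1) := by rw [← one_div_goldenRatio, mul_one_div]
    rw [map_sub, map_smul, map_add, map_add, hJ, hJ, hJ, hJ, h3, smul_eq_mul]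
    constructor <;> intro h <;> linear_combination h
  rw [dodecahedronData.mem_levelSet_iff_of_ker_eq_span ker_piMap_dodecahedron]
  constructor
  · intro h
    exact ⟨fun i => (h1 _ _).1 (by fin_cases i; exacts [h 0, h 1, h 2, h 3, h 4, h 5]),
      (h2 0 1 2 3).1 (h 6), (h2 1 2 0 4).1 (h 7), (h2 0 2 1 5).1 (h 8)⟩
  · rintro ⟨h, h6, h7, h8⟩ i
    fin_cases i
    exacts [(h1 0 6).2 (h 0), (h1 1 7).2 (h 1), (h1 2 8).2 (h 2), (h1 3 9).2 (h 3),
      (h1 4 10).2 (h 4), (h1 5 11).2 (h 5), (h2 0 1 2 3).2 h6, (h2 1 2 0 4).2 h7,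
      (h2 0 2 1 5).2 h8]

/-- The equations `|z_i|² + |z_{6+i}|² = 2` bound every coordinate, and the level set is closed. -/
theorem isCompact_levelSet_dodecahedron : IsCompact dodecahedronData.levelSet := by
  refine Metric.isCompact_of_isClosed_isBounded dodecahedronData.isClosed_levelSet
    ((Metric.isBounded_closedBall (x := (0 : Fin 12 → ℂ)) (r := 2)).subset fun z hz => ?_)
  rw [mem_closedBall_zero_iff, pi_norm_le_iff_of_nonneg two_pos.le]
  have h := (mem_levelSet_dodecahedron.1 hz).1
  intro j
  refine abs_le_of_sq_le_sq' ?_ two_pos.le |>.2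
  induction j using Fin.addCases (m := 6) (n := 6) with
  | left i => linarith [h i, sq_nonneg ‖z (Fin.natAdd 6 i)‖]
  | right i => linarith [h i, sq_nonneg ‖z (Fin.castAdd 6 i)‖]

/-! ### The dodecahedron as a polytope -/

theorem polytope_dodecahedronData : dodecahedronData.polytope = dodecahedron :=
  dodecahedron_eq_polyhedron.symm

theorem finite_dodecahedronVertices : dodecahedronVertices.Finite := by
  rw [← range_dodecahedronVertex]
  exact finite_range _

theorem isConvexPolytope_dodecahedron : IsConvexPolytope dodecahedron := by
  refine ⟨⟨finite_dodecahedronVertices.toFinset, ?_⟩, 0, ?_⟩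
  · rw [finite_dodecahedronVertices.coe_toFinset]
    rfl
  · rw [mem_interior_iff_mem_nhds, dodecahedron_eq_polyhedron]
    have h : ∀ j, ∀ᶠ μ : Fin 3 → ℝ in 𝓝 0, -1 ≤ μ ⬝ᵥ dodecahedronNormals j := fun j => by
      have h1 : Continuous fun μ : Fin 3 → ℝ => μ ⬝ᵥ dodecahedronNormals j :=
        (ToricData.pairing (dodecahedronNormals j)).continuous
      have h2 : (-1 : ℝ) < (0 : Fin 3 → ℝ) ⬝ᵥ dodecahedronNormals j := by
        rw [zero_dotProduct]
        norm_num
      exact (h1.continuousAt.eventually (lt_mem_nhds h2)).mono fun μ hμ => hμ.le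
    exact Filter.eventually_all.2 h

theorem extremePoints_dodecahedron : dodecahedron.extremePoints ℝ = dodecahedronVertices := by
  refine Subset.antisymm extremePoints_convexHull_subset ?_
  rw [← range_dodecahedronVertex]
  rintro _ ⟨k, rfl⟩
  rw [← polytope_dodecahedronData]
  exact (isVertexFrame_dodecahedron k).mem_extremePoints

theorem ncard_facets_dodecahedron : {F | IsFacet dodecahedron F}.ncard = 12 := by
  rw [← polytope_dodecahedronData]
  exact hasGenericFacets_dodecahedron.ncard_facets

theorem isSimplePolytope_dodecahedron : IsSimplePolytope dodecahedron := by
  intro v hv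
  rw [extremePoints_dodecahedron, ← range_dodecahedronVertex] at hv
  obtain ⟨k, rfl⟩ := hv
  rw [← polytope_dodecahedronData]
  exact hasGenericFacets_dodecahedron.ncard_facets_of_vertex (isVertexFrame_dodecahedron k)

theorem isQuasilattice_icosahedralP : IsQuasilattice icosahedralP := by
  refine ⟨6, icosahedralY, ?_, rfl⟩
  rw [eq_top_iff]
  rintro ξ -
  have h := ToricData.piMap_frameSection (𝕜 := ℝ) det_frameMatrix_dodecahedron ξ
  rw [← ToricData.sum_smul_eq_piMap
    (ToricData.injective_of_det_frameMatrix det_frameMatrix_dodecahedron)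
    (fun j hj => ToricData.frameSection_of_notMem ξ hj)] at h
  rw [← h]
  refine Submodule.sum_mem _ fun i _ => Submodule.smul_mem _ _ (Submodule.subset_span ?_)
  fin_cases i
  exacts [⟨0, rfl⟩, ⟨1, rfl⟩, ⟨2, rfl⟩]

theorem isQuasirational_dodecahedron : IsQuasirational dodecahedron icosahedralP := by
  refine ⟨fun j => dodecahedronNormals (j.cast ncard_facets_dodecahedron), fun _ => -1,
    fun j => mem_icosahedralP _, ?_⟩
  refine dodecahedron_eq_polyhedron.trans ?_
  ext μ
  exact ⟨fun h j => h _, fun h j => by simpa using h (j.cast ncard_facets_dodecahedron.symm)⟩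

/-- In any description by half-spaces with lattice normals, suitable multiples `c_j X_j` lie in the
lattice. Expressing those of `Y_4` and `Y_5` in those of `Y_1, Y_2, Y_3` gives rational
coefficients; in the combination `ps/(qr)` the unknown `c_j` cancel and `(φ - 1)² = 2 - φ` remains.
-/
theorem not_isRationalPolytope_dodecahedron : ¬ IsRationalPolytope dodecahedron := by
  rintro ⟨L, hL, X, lam, hX, hP⟩
  have key : ∀ j, ∃ c : ℝ, c ≠ 0 ∧ c • dodecahedronNormals j ∈ L := fun j => by
    obtain ⟨k, c, hc, hk⟩ :=
      hasGenericFacets_dodecahedron.exists_smul_eq (polytope_dodecahedronData.trans hP) j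
    exact ⟨c, hc, hk ▸ hX k⟩
  choose c hc hcL using key
  have hdet : (Matrix.of fun i => c (![0, 1, 2] i) • dodecahedronNormals (![0, 1, 2] i)).det ≠ 0 := by
    have h := Matrix.det_mul_column (fun i => c (![0, 1, 2] i))
      (dodecahedronData.frameMatrix ![0, 1, 2])
    refine ne_of_eq_of_ne h (mul_ne_zero (Finset.prod_ne_zero_iff.2 fun i _ => hc _)
      det_frameMatrix_dodecahedron)
  have h3 := exists_rat_of_mem_lattice hL (fun i => hcL (![0, 1, 2] i)) hdet (hcL 3)
    (x := ![c 3 * (φ - 1) / c 0, c 3 * (φ - 1) / c 1, -c 3 / c 2]) (by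
      have e : dodecahedronNormals 3 = _ := icosahedralY_three
      rw [e, Fin.sum_univ_three]
      change _ = (c 3 * (φ - 1) / c 0) • c 0 • icosahedralY 0 +
        (c 3 * (φ - 1) / c 1) • c 1 • icosahedralY 1 + (-c 3 / c 2) • c 2 • icosahedralY 2
      rw [smul_smul, smul_smul, smul_smul, div_mul_cancel₀ _ (hc 0), div_mul_cancel₀ _ (hc 1),
        div_mul_cancel₀ _ (hc 2)]
      module)
  have h4 := exists_rat_of_mem_lattice hL (fun i => hcL (![0, 1, 2] i)) hdet (hcL 4)
    (x := ![-c 4 / c 0, c 4 * (φ - 1) / c 1, c 4 * (φ - 1) / c 2]) (by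
      have e : dodecahedronNormals 4 = _ := icosahedralY_four
      rw [e, Fin.sum_univ_three]
      change _ = (-c 4 / c 0) • c 0 • icosahedralY 0 +
        (c 4 * (φ - 1) / c 1) • c 1 • icosahedralY 1 + (c 4 * (φ - 1) / c 2) • c 2 • icosahedralY 2
      rw [smul_smul, smul_smul, smul_smul, div_mul_cancel₀ _ (hc 0), div_mul_cancel₀ _ (hc 1),
        div_mul_cancel₀ _ (hc 2)]
      module)
  obtain ⟨p, hp⟩ : ∃ p : ℚ, c 3 * (φ - 1) / c 0 = p := h3 0
  obtain ⟨q, hq⟩ : ∃ q : ℚ, -c 3 / c 2 = q := h3 2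
  obtain ⟨r, hr⟩ : ∃ r : ℚ, -c 4 / c 0 = r := h4 0
  obtain ⟨s, hs⟩ : ∃ s : ℚ, c 4 * (φ - 1) / c 2 = s := h4 2
  have hqr : (q * r : ℝ) ≠ 0 := by
    rw [← hq, ← hr]
    exact mul_ne_zero (div_ne_zero (neg_ne_zero.2 (hc 3)) (hc 2))
      (div_ne_zero (neg_ne_zero.2 (hc 4)) (hc 0))
  have hps : (p * s : ℝ) = (φ - 1) ^ 2 * (q * r) := by
    rw [← hp, ← hq, ← hr, ← hs]
    ring
  refine Real.goldenRatio_irrational.ne_rat (2 - p * s / (q * r)) ?_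
  push_cast
  rw [hps, mul_div_cancel_right₀ _ hqr]
  linear_combination Real.goldenRatio_sq

/-! ### The symplectic form on the atlas of `M_Δ` -/

namespace ToricData

section SymplecticAtlas

variable {d : ℕ} {D : ToricData d} {ι : Type} {ν : ι → Fin 3 → ℝ} {e : ι → Fin 3 → Fin d}

theorem standardForm_comp_fderiv_smul {G : Subgroup (Fin 3 → Circle)} (γ : G) (x : Fin 3 → ℂ) :
    (standardForm 3).compContinuousLinearMap (fderiv ℝ (fun u : Fin 3 → ℂ => γ • u) x) =
      standardForm 3 := by
  have h1 : HasFDerivAt (fun u : Fin 3 → ℂ => γ • u) (ContinuousLinearMap.pi fun i =>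
      (γ.1 i : ℂ) • (ContinuousLinearMap.proj i : (Fin 3 → ℂ) →L[ℝ] ℂ)) x :=
    hasFDerivAt_pi.2 fun i =>
      ((ContinuousLinearMap.proj i : (Fin 3 → ℂ) →L[ℝ] ℂ).hasFDerivAt).const_smul (γ.1 i : ℂ)
  rw [h1.fderiv]
  ext v
  rw [ContinuousAlternatingMap.compContinuousLinearMap_apply, standardForm_apply,
    standardForm_apply]
  refine congrArg (1 / Real.pi * ·) (Finset.sum_congr rfl fun i _ => ?_)
  have h2 : (γ.1 i : ℂ).re * (γ.1 i : ℂ).re + (γ.1 i : ℂ).im * (γ.1 i : ℂ).im = 1 := by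
    rw [← Complex.normSq_apply, Circle.normSq_coe]
  change ((γ.1 i : ℂ) * v 0 i).im * ((γ.1 i : ℂ) * v 1 i).re -
    ((γ.1 i : ℂ) * v 0 i).re * ((γ.1 i : ℂ) * v 1 i).im = _
  simp only [Complex.mul_re, Complex.mul_im]
  linear_combination ((v 0 i).im * (v 1 i).re - (v 0 i).re * (v 1 i).im) * h2

/-- The form is the constant standard form in every chart, so only compatibility with changes of
charts uses the moment equations. -/
theorem IsVertexSystem.isQuasifoldSymplecticForm (hV : D.IsVertexSystem ν e) :
    IsQuasifoldSymplecticForm (fun a => levelChart (hV.frame a)) fun _ _ => standardForm 3 where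
  smooth _ := contDiffOn_const
  closed _ x _ := by
    simp only [extDeriv, fderiv_fun_const, Pi.zero_apply]
    exact map_zero (ContinuousAlternatingMap.alternatizeUncurryFinCLM ℝ (Fin 3 → ℂ) ℝ)
  nondegenerate _ _ _ := standardForm_nondegenerate 3
  invariant _ γ x _ := standardForm_comp_fderiv_smul γ x
  compatible a b x hx y hy hxy := by
    obtain ⟨f, Θ, hf, hxf, hfx, hΘ, ξ, hlift⟩ :=
      (isSlice_levelSlice (hV.frame b)).exists_isLocalLift isPhaseSection_real
        expVec_mul_mem_levelSet (hV.frame b).det_ne_zero (isSlice_levelSlice (hV.frame a))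
        (G := D.chartGroup (e b)) (G' := D.chartGroup (e a)) hx hy hxy
    refine ⟨f, hf, hxf, hfx, fun u hu => ?_⟩
    have hu' : f.source ∈ 𝓝 u := f.open_source.mem_nhds hu
    exact standardForm_comp_of_lift (hV.frame a) (hV.frame b) (hf.source_subset hu)
      (hf.target_subset (f.map_source hu))
      ((hf.smooth.contDiffAt hu').differentiableAt (by simp))
      ((hΘ.contDiffAt hu').differentiableAt (by simp))
      (Filter.eventually_of_mem hu' hlift)

end SymplecticAtlas

end ToricData

/-! ### The charts of the dodecahedron -/

/-- The indices of the facets through a vertex. -/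
noncomputable def vertexFrame (ν : dodecahedronVertices) : Fin 3 → Fin 12 :=
  dodecahedronFrame (range_dodecahedronVertex.ge ν.2).choose

theorem isVertexFrame_vertexFrame (ν : dodecahedronVertices) :
    dodecahedronData.IsVertexFrame ν.1 (vertexFrame ν) := by
  have h := isVertexFrame_dodecahedron (range_dodecahedronVertex.ge ν.2).choose
  rwa [(range_dodecahedronVertex.ge ν.2).choose_spec] at h

theorem dodecahedronVertex_zero : dodecahedronVertex 0 = ![-1, -1, -1] := by
  funext i
  fin_cases i <;> simp [dodecahedronVertex, goldenVertex, goldenHom_mk]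

theorem vertexFrame_eq {ν : dodecahedronVertices} (hν : ν.1 = ![-1, -1, -1]) :
    vertexFrame ν = ![0, 1, 2] := by
  have h : (range_dodecahedronVertex.ge ν.2).choose = 0 := injective_dodecahedronVertex
    ((range_dodecahedronVertex.ge ν.2).choose_spec.trans (hν.trans dodecahedronVertex_zero.symm))
  rw [vertexFrame, h]
  rfl

theorem isVertexSystem_dodecahedron :
    dodecahedronData.IsVertexSystem (fun ν : dodecahedronVertices => ν.1) vertexFrame where
  nonempty := ⟨⟨dodecahedronVertex 0, range_dodecahedronVertex.le ⟨0, rfl⟩⟩⟩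
  injective := Subtype.val_injective
  frame := isVertexFrame_vertexFrame
  cover μ hμ := by
    obtain ⟨ν, hν, h⟩ := ToricData.exists_activeSet_subset polytope_dodecahedronData hμ
    exact ⟨⟨ν, hν⟩, h⟩

theorem activeSet_dodecahedron : dodecahedronData.activeSet ![-1, -1, -1] = {0, 1, 2} := by
  rw [← dodecahedronVertex_zero, ← (isVertexFrame_dodecahedron 0).range_eq]
  ext j
  exact (Fin.exists_fin_succ.trans (or_congr eq_comm (Fin.exists_fin_two.trans
    (or_congr eq_comm eq_comm))) : (∃ i, ![(0 : Fin 12), 1, 2] i = j) ↔ _)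

theorem extend_eq_dodecahedronSlice (z : Fin 3 → ℂ) :
    Function.extend ![(0 : Fin 12), 1, 2] z (fun _ => 1) = dodecahedronSlice z := by
  have hi := ToricData.injective_of_det_frameMatrix det_frameMatrix_dodecahedron
  have h1 : ∀ j : Fin 12, 3 ≤ j → ¬∃ i, ![(0 : Fin 12), 1, 2] i = j := by decide
  funext j
  fin_cases j
  · exact hi.extend_apply z _ 0
  · exact hi.extend_apply z _ 1
  · exact hi.extend_apply z _ 2
  all_goals exact Function.extend_apply' z _ _ (h1 _ (by decide))

theorem mem_icosahedralP_iff {ξ : Fin 3 → ℝ} : ξ ∈ icosahedralP ↔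
    ∃ m : Fin 6 → ℤ, ξ = ∑ i, m i • icosahedralY i := by
  rw [icosahedralP, ← Submodule.span_int_eq_addSubgroupClosure, Submodule.mem_toAddSubgroup,
    Submodule.mem_span_range_iff_exists_fun]
  exact exists_congr fun m => eq_comm

theorem sum_smul_icosahedralY (m : Fin 6 → ℤ) : ∑ i, m i • icosahedralY i =
    (m 0 + (φ - 1) * (m 3 + m 5) - m 4 : ℝ) • icosahedralY 0 +
    (m 1 + (φ - 1) * (m 3 + m 4) - m 5 : ℝ) • icosahedralY 1 +
    (m 2 + (φ - 1) * (m 4 + m 5) - m 3 : ℝ) • icosahedralY 2 := by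
  rw [Fin.sum_univ_six, icosahedralY_three, icosahedralY_four, icosahedralY_five]
  module

/-- In the frame `Y_1, Y_2, Y_3` the coordinates of an element of `P` are, modulo integers, `φ(h +
l)`, `φ(h + k)`, `φ(k + l)`, where `h, k, l` are its coefficients at `Y_4, Y_5, Y_6`. -/
theorem dodecahedronΓ_eq : dodecahedronΓ = dodecahedronData.chartGroup ![0, 1, 2] := by
  have hsum : ∀ a : Fin 3 → ℝ, ∑ i, a i • dodecahedronData.X (![0, 1, 2] i) =
      a 0 • icosahedralY 0 + a 1 • icosahedralY 1 + a 2 • icosahedralY 2 := fun a =>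
    Fin.sum_univ_three _
  have hexp : ∀ (x : ℝ) (n : ℤ), Circle.exp (2 * Real.pi * (x + n)) = Circle.exp (2 * Real.pi * x) := by
    intro x n
    rw [mul_add, Circle.exp_add, mul_comm _ (n : ℝ), Circle.exp_int_mul_two_pi, mul_one]
  ext t
  constructor
  · rintro ⟨h, k, l, rfl⟩
    refine ⟨![φ * (h + l), φ * (h + k), φ * (k + l)], ?_, ?_⟩
    · rw [hsum]
      -- The first three coefficients cancel the integral parts: `(h + l + k) + (φ - 1)(h + l) - k =
      -- φ(h + l)`, and similarly for the others.
      refine mem_icosahedralP_iff.2 ⟨![h + l + k, h + k + l, k + l + h, h, k, l], ?_⟩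
      rw [sum_smul_icosahedralY]
      simp only [Matrix.cons_val]
      push_cast
      module
    · funext i
      fin_cases i <;> rfl
  · rintro ⟨a, ha, rfl⟩
    rw [hsum] at ha
    obtain ⟨m, hm⟩ := mem_icosahedralP_iff.1 ha
    rw [sum_smul_icosahedralY] at hm
    refine ⟨m 3, m 4, m 5, ?_⟩
    have hdet := det_frameMatrix_dodecahedron
    have h0 : (a - ![(m 0 + (φ - 1) * (m 3 + m 5) - m 4 : ℝ),
        (m 1 + (φ - 1) * (m 3 + m 4) - m 5 : ℝ), (m 2 + (φ - 1) * (m 4 + m 5) - m 3 : ℝ)]) = 0 := by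
      refine Matrix.eq_zero_of_vecMul_eq_zero hdet ?_
      rw [Matrix.sub_vecMul, Matrix.vecMul_eq_sum, Matrix.vecMul_eq_sum, sub_eq_zero,
        Fin.sum_univ_three, Fin.sum_univ_three]
      exact hm
    rw [sub_eq_zero] at h0
    subst h0
    funext i
    fin_cases i
    · refine Eq.trans (congrArg Circle.exp ?_) (hexp _ (m 0 - m 3 - m 4 - m 5))
      simp only [Fin.zero_eta, Matrix.cons_val]
      push_cast
      ring
    · refine Eq.trans (congrArg Circle.exp ?_) (hexp _ (m 1 - m 3 - m 4 - m 5))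
      simp only [Fin.mk_one, Matrix.cons_val]
      push_cast
      ring
    · refine Eq.trans (congrArg Circle.exp ?_) (hexp _ (m 2 - m 3 - m 4 - m 5))
      simp only [Fin.reduceFinMk, Matrix.cons_val]
      push_cast
      ring

theorem openChart_eq_dodecahedronChart {ν : dodecahedronVertices} (hν : ν.1 = ![-1, -1, -1]) :
    ToricData.openChart (isVertexFrame_vertexFrame ν) = dodecahedronChart := by
  -- Stated for a variable frame, because `vertexFrame ν` rests on a choice and its equality with
  -- `![0, 1, 2]` can be substituted only into a variable.
  have h : ∀ e (he : dodecahedronData.IsVertexFrame ν.1 e), e = ![0, 1, 2] →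
      ToricData.openChart he = dodecahedronChart := by
    rintro _ he rfl
    unfold ToricData.openChart ToricData.sliceChart dodecahedronChart
    rw [← dodecahedronΓ_eq]
    simp only [extend_eq_dodecahedronSlice]
    rfl
  exact h _ _ (vertexFrame_eq hν)

theorem isCompl_orbitTangent_dodecahedronSlice (z : Fin 3 → ℂ) :
    IsCompl (dodecahedronData.orbitTangent (dodecahedronSlice z))
      (Submodule.span ℂ {Pi.single 0 1, Pi.single 1 1, Pi.single 2 1}) := by
  have hi := ToricData.injective_of_det_frameMatrix det_frameMatrix_dodecahedron
  have h := dodecahedronData.isCompl_orbitTangent det_frameMatrix_dodecahedron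
    (w := dodecahedronSlice z) fun j hj => by
      rw [← extend_eq_dodecahedronSlice, Function.extend_apply' _ _ _ hj]
      exact one_ne_zero
  convert h using 2
  ext v
  exact (Fin.exists_fin_succ.trans (or_congr eq_comm (Fin.exists_fin_two.trans
    (or_congr eq_comm eq_comm))) :
      (∃ i, (Pi.single (![(0 : Fin 12), 1, 2] i) 1 : Fin 12 → ℂ) = v) ↔ _).symm

/-- The open embedding of the chart, corestricted to its range. A class lies in the range exactly
when its coordinates off the frame are nonzero, since then they can be scaled to `1`. -/
theorem exists_homeomorph_dodecahedronChart :
    ∃ U : Set dodecahedronData.XΔ, IsOpen U ∧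
      U = dodecahedronData.mkX '' {w | ∀ j : Fin 12, 3 ≤ j → w.1 j ≠ 0} ∧
      ∃ τ : dodecahedronChart.Model ≃ₜ U,
        ∀ z : dodecahedronChart.V, (τ (Quotient.mk _ z) : dodecahedronData.XΔ) =
          dodecahedronData.mkX ⟨dodecahedronSlice z, dodecahedronSlice_mem z⟩ := by
  let ν : dodecahedronVertices := ⟨dodecahedronVertex 0, range_dodecahedronVertex.le ⟨0, rfl⟩⟩
  have hν := isVertexFrame_vertexFrame ν
  have he : vertexFrame ν = ![0, 1, 2] := vertexFrame_eq dodecahedronVertex_zero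
  have hc := (ToricData.isSlice_extend_one hν).isChart icosahedralP_eq_closure
    isPhaseSection_complex ToricData.expVec_mul_mem_openSet hν.det_ne_zero
  have hB : ToricData.openChart hν = dodecahedronChart :=
    openChart_eq_dodecahedronChart dodecahedronVertex_zero
  change (ToricData.openChart hν).IsChart ℂ at hc
  rw [hB] at hc
  obtain ⟨τ, hτ, hτ'⟩ := hc.homeo
  refine ⟨range τ, hτ.isOpen_range, ?_, hτ.toIsEmbedding.toHomeomorph, hτ'⟩
  refine Subset.antisymm ?_ ?_
  · rintro _ ⟨x, rfl⟩
    obtain ⟨z, rfl⟩ := Quotient.exists_rep x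
    refine ⟨⟨dodecahedronSlice z, dodecahedronSlice_mem z⟩, fun j hj => ?_, (hτ' z).symm⟩
    have h1 : ∀ j : Fin 12, 3 ≤ j → ¬∃ i, ![(0 : Fin 12), 1, 2] i = j := by decide
    change dodecahedronSlice z j ≠ 0
    rw [← extend_eq_dodecahedronSlice, Function.extend_apply' _ _ _ (h1 j hj)]
    exact one_ne_zero
  · rintro _ ⟨w, hw, rfl⟩
    have h1 : ∀ j : Fin 12, (¬∃ i, ![(0 : Fin 12), 1, 2] i = j) → 3 ≤ j := by decide
    have h2 : dodecahedronData.mkX w ∈ (ToricData.openChart hν).image :=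
      (ToricData.isSlice_extend_one hν).mem_image_sliceChart isPhaseSection_complex
        ToricData.expVec_mul_mem_openSet hν.det_ne_zero w fun j hj => hw j (h1 j (he ▸ hj))
    rw [hB] at h2
    obtain ⟨z, hz, h3⟩ := h2
    exact ⟨Quotient.mk _ ⟨z, hz⟩, (hτ' ⟨z, hz⟩).trans h3⟩

/-! ### Equivariance of `χ` -/

namespace ToricData

/-- The frame section lifts a real `ξ` to a real vector. Viewed in `ℂ^d` this vector lifts the
complexification of `ξ`, and both act on points by the same multiplication. -/
theorem inclusionMap_vadd {d : ℕ} {D : ToricData d} {e : Fin 3 → Fin d}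
    (he : (D.frameMatrix e).det ≠ 0) [AddAction (D.Quasitorus ℝ) D.M]
    [AddAction (D.Quasitorus ℂ) D.XΔ]
    (hM : ∀ (t : Torus ℝ d) (z w : D.levelSet), w.1 = t +ᵥ z.1 →
      D.bigPi ℝ t +ᵥ D.mkM z = D.mkM w)
    (hX : ∀ (t : Torus ℂ d) (z w : D.openSet), w.1 = t +ᵥ z.1 →
      D.bigPi ℂ t +ᵥ D.mkX z = D.mkX w) (ξ : Fin 3 → ℝ) (m : D.M) :
    D.inclusionMap ((QuotientAddGroup.mk ξ : D.Quasitorus ℝ) +ᵥ m) =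
      (QuotientAddGroup.mk (fun i => (ξ i : ℂ)) : D.Quasitorus ℂ) +ᵥ D.inclusionMap m := by
  obtain ⟨z, rfl⟩ := Quotient.exists_rep m
  have h1 := mk_vadd_mk expVec_mul_mem_levelSet hM (D.frameSection ℝ e ξ) z
  have h2 := mk_vadd_mk expVec_mul_mem_openSet hX (fun j => (D.frameSection ℝ e ξ j : ℂ))
    ⟨z.1, levelSet_subset_openSet z.2⟩
  have h3 : D.piMap ℂ (fun j => (D.frameSection ℝ e ξ j : ℂ)) = fun i => (ξ i : ℂ) := by
    refine (piMap_algebraMap (𝕜 := ℂ) (D.frameSection ℝ e ξ)).trans ?_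
    rw [piMap_frameSection he]
    rfl
  rw [piMap_frameSection he] at h1
  rw [h3] at h2
  exact (congrArg D.inclusionMap h1).trans h2.symm

end ToricData

/-! ### The theorem -/

theorem mainTheorem3 :
    -- the dodecahedron is a simple polytope with 20 vertices and 12 facets
    IsConvexPolytope dodecahedron ∧
    dodecahedron.extremePoints ℝ = dodecahedronVertices ∧
    dodecahedronVertices.ncard = 20 ∧
    {F | IsFacet dodecahedron F}.ncard = 12 ∧
    IsSimplePolytope dodecahedron ∧
    -- it is not rational, but quasirational with respect to the simple icosahedral quasilattice
    ¬ IsRationalPolytope dodecahedron ∧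
    IsQuasilattice icosahedralP ∧
    IsQuasirational dodecahedron icosahedralP ∧
    dodecahedron = polyhedron dodecahedronNormals (fun _ => -1) ∧
    -- the group `N` and its Lie algebra
    dodecahedronData.lieAlgebraN = LinearMap.ker (dodecahedronData.piMap ℝ) ∧
    LinearMap.ker (dodecahedronData.piMap ℝ) =
      Submodule.span ℝ (range dodecahedronKernelVectors) ∧
    Module.finrank ℝ (LinearMap.ker (dodecahedronData.piMap ℝ)) = 9 ∧
    (dodecahedronData.N ℝ : Set (Torus ℝ 12)) =
      QuotientAddGroup.mk '' (LinearMap.ker (dodecahedronData.piMap ℝ) : Set (Fin 12 → ℝ)) ∧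
    -- the level set `Ψ⁻¹(0)`
    IsCompact dodecahedronData.levelSet ∧
    dodecahedronData.levelSet = {z | (∀ i : Fin 6,
        ‖z (Fin.castAdd 6 i)‖ ^ 2 + ‖z (Fin.natAdd 6 i)‖ ^ 2 = 2) ∧
      ‖z 0‖ ^ 2 + ‖z 1‖ ^ 2 - φ * (‖z 2‖ ^ 2 + ‖z 3‖ ^ 2) = -(2 / φ) ∧
      ‖z 1‖ ^ 2 + ‖z 2‖ ^ 2 - φ * (‖z 0‖ ^ 2 + ‖z 4‖ ^ 2) = -(2 / φ) ∧
      ‖z 0‖ ^ 2 + ‖z 2‖ ^ 2 - φ * (‖z 1‖ ^ 2 + ‖z 5‖ ^ 2) = -(2 / φ)} ∧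
    -- the open set `ℂ¹²_Δ` is the union of the 20 open sets of the vertices
    IsOpen dodecahedronData.openSet ∧
    dodecahedronData.openSet = {z | ∃ ν ∈ dodecahedronVertices,
      ∀ j, j ∉ dodecahedronData.activeSet ν → z j ≠ 0} ∧
    dodecahedronData.levelSet ⊆ dodecahedronData.openSet ∧
    -- the quasitorus actions, the atlases `A` of `M_Δ` and `B` of `X_Δ` (one chart per vertex), the
    -- symplectic form `η` on `M_Δ`, and the identification `χ`
    ∃ (_ : AddAction (dodecahedronData.Quasitorus ℝ) dodecahedronData.M)
      (_ : AddAction (dodecahedronData.Quasitorus ℂ) dodecahedronData.XΔ)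
      (A : dodecahedronVertices → QuasifoldChart (Fin 3 → ℂ) dodecahedronData.M)
      (B : dodecahedronVertices → QuasifoldChart (Fin 3 → ℂ) dodecahedronData.XΔ)
      (η : dodecahedronVertices → (Fin 3 → ℂ) → (Fin 3 → ℂ) [⋀^Fin 2]→L[ℝ] ℝ)
      (χ : dodecahedronData.M ≃ₜ dodecahedronData.XΔ),
      -- the actions are induced by those of the tori `ℝ¹²/ℤ¹²` and `ℂ¹²/ℤ¹²`
      (∀ (t : Torus ℝ 12) (z w : dodecahedronData.levelSet), (w : Fin 12 → ℂ) = t +ᵥ z.1 →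
        dodecahedronData.bigPi ℝ t +ᵥ dodecahedronData.mkM z = dodecahedronData.mkM w) ∧
      (∀ (t : Torus ℂ 12) (z w : dodecahedronData.openSet), (w : Fin 12 → ℂ) = t +ᵥ z.1 →
        dodecahedronData.bigPi ℂ t +ᵥ dodecahedronData.mkX z = dodecahedronData.mkX w) ∧
      -- `M_Δ` is a symplectic quasifold with a smooth action of `ℝ³/P`; each of the 20 charts is
      -- centred at a different fixed point, and the symplectic form is induced by that of `ℂ¹²`
      IsQuasifoldAtlas ℝ A ∧
      IsQuasifoldSymplecticForm A η ∧
      IsSmoothQuasitorusAction ℝ (Q := dodecahedronData.quasilattice ℝ) A ∧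
      (∀ ν, (0 : Fin 3 → ℂ) ∈ (A ν).V) ∧
      BijOn (fun ν => (A ν).σ 0) univ
        {m | ∀ ξ : dodecahedronData.Quasitorus ℝ, ξ +ᵥ m = m} ∧
      (∀ ν : dodecahedronVertices, ∃ (e : Fin 3 → Fin 12) (s : (Fin 3 → ℂ) → Fin 12 → ℂ),
        Function.Injective e ∧ range e = dodecahedronData.activeSet ν ∧
        ContDiffOn ℝ ∞ s (A ν).V ∧
        ∀ z ∈ (A ν).V, (∀ i, s z (e i) = z i) ∧
          (∀ j, j ∉ dodecahedronData.activeSet ν → ∃ r : ℝ, 0 < r ∧ s z j = r) ∧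
          (∃ h : s z ∈ dodecahedronData.levelSet,
            (A ν).σ z = dodecahedronData.mkM ⟨s z, h⟩) ∧
          η ν z = (standardForm 12).compContinuousLinearMap (fderiv ℝ s z)) ∧
      -- `X_Δ` is a complex quasifold with a holomorphic action of `ℂ³/P` that has a dense open
      -- orbit; each of the 20 charts is centred at a different fixed point
      IsQuasifoldAtlas ℂ B ∧
      IsSmoothQuasitorusAction ℂ (Q := dodecahedronData.quasilattice ℂ) B ∧
      (∃ x : dodecahedronData.XΔ,
        IsOpen (AddAction.orbit (dodecahedronData.Quasitorus ℂ) x) ∧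
        Dense (AddAction.orbit (dodecahedronData.Quasitorus ℂ) x)) ∧
      BijOn (fun ν => (B ν).σ 0) univ
        {x | ∀ ξ : dodecahedronData.Quasitorus ℂ, ξ +ᵥ x = x} ∧
      (∀ ν : dodecahedronVertices, ∃ e : Fin 3 → Fin 12,
        Function.Injective e ∧ range e = dodecahedronData.activeSet ν ∧
        (B ν).V = univ ∧
        ∀ z, ∃ h : Function.extend e z (fun _ => 1) ∈ dodecahedronData.openSet,
          (B ν).σ z = dodecahedronData.mkX ⟨Function.extend e z (fun _ => 1), h⟩) ∧
      -- the chart at the vertex `(-1, -1, -1)`: the slice is transversal to the `N_ℂ`-orbits and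
      -- induces a homeomorphism of `ℂ³/Γ` onto an open subset
      (∀ ν : dodecahedronVertices, ν.1 = ![-1, -1, -1] → B ν = dodecahedronChart) ∧
      dodecahedronData.activeSet ![-1, -1, -1] = {0, 1, 2} ∧
      (∀ z, IsCompl (dodecahedronData.orbitTangent (dodecahedronSlice z))
        (Submodule.span ℂ {Pi.single 0 1, Pi.single 1 1, Pi.single 2 1})) ∧
      (∃ U : Set dodecahedronData.XΔ, IsOpen U ∧
        U = dodecahedronData.mkX '' {w | ∀ j : Fin 12, 3 ≤ j → w.1 j ≠ 0} ∧
        ∃ τ : dodecahedronChart.Model ≃ₜ U,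
          ∀ z : dodecahedronChart.V, (τ (Quotient.mk _ z) : dodecahedronData.XΔ) =
            dodecahedronData.mkX ⟨dodecahedronSlice z, dodecahedronSlice_mem z⟩) ∧
      -- the inclusion of `Ψ⁻¹(0)` in `ℂ¹²_Δ` induces an equivariant diffeomorphism `M_Δ → X_Δ`
      (∀ (z : dodecahedronData.levelSet) (h : z.1 ∈ dodecahedronData.openSet),
        χ (dodecahedronData.mkM z) = dodecahedronData.mkX ⟨z.1, h⟩) ∧
      IsQuasifoldDiffeo ℝ A B χ ∧
      (∀ (ξ : Fin 3 → ℝ) (m : dodecahedronData.M),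
        χ ((QuotientAddGroup.mk ξ : dodecahedronData.Quasitorus ℝ) +ᵥ m) =
          (QuotientAddGroup.mk (fun i => (ξ i : ℂ)) : dodecahedronData.Quasitorus ℂ) +ᵥ χ m) :=
  by
  have hV := isVertexSystem_dodecahedron
  have hQ := icosahedralP_eq_closure
  have hdet := det_frameMatrix_dodecahedron
  have he : ∀ ν, (dodecahedronData.frameMatrix (vertexFrame ν)).det ≠ 0 := fun ν =>
    (hV.frame ν).det_ne_zero
  have hR := fun ν => ToricData.isSlice_levelSlice (hV.frame ν)
  have hC := fun ν => ToricData.isSlice_extend_one (hV.frame ν)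
  have hlev := ToricData.expVec_mul_mem_levelSet (D := dodecahedronData)
  have hopen := ToricData.expVec_mul_mem_openSet (D := dodecahedronData)
  have hcov := hV.exists_of_mem_openSet
  have hcov' : ∀ w ∈ dodecahedronData.levelSet, ∃ a, ∀ j ∉ range (vertexFrame a), w j ≠ 0 :=
    fun w hw => hcov w (ToricData.levelSet_subset_openSet hw)
  refine ⟨isConvexPolytope_dodecahedron, extremePoints_dodecahedron, ncard_dodecahedronVertices,
    ncard_facets_dodecahedron, isSimplePolytope_dodecahedron, not_isRationalPolytope_dodecahedron,
    isQuasilattice_icosahedralP, isQuasirational_dodecahedron, dodecahedron_eq_polyhedron,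
    ToricData.lieAlgebraN_eq hQ, ker_piMap_dodecahedron,
    Nat.add_right_cancel (dodecahedronData.finrank_ker_piMap hdet), ToricData.coe_N_eq_image hQ,
    isCompact_levelSet_dodecahedron, ext fun _ => mem_levelSet_dodecahedron,
    ToricData.isOpen_openSet, hV.openSet_eq.trans (ext fun z => by simp),
    ToricData.levelSet_subset_openSet, ?_⟩
  let actM : AddAction (dodecahedronData.Quasitorus ℝ) dodecahedronData.M :=
    ToricData.quasitorusAction hdet hlev
  let actX : AddAction (dodecahedronData.Quasitorus ℂ) dodecahedronData.XΔ :=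
    ToricData.quasitorusAction hdet hopen
  have hM : ∀ (t : Torus ℝ 12) (z w : dodecahedronData.levelSet), (w : Fin 12 → ℂ) = t +ᵥ z.1 →
      dodecahedronData.bigPi ℝ t +ᵥ dodecahedronData.mkM z = dodecahedronData.mkM w :=
    ToricData.bigPi_vadd_mk hdet hlev
  have hX : ∀ (t : Torus ℂ 12) (z w : dodecahedronData.openSet), (w : Fin 12 → ℂ) = t +ᵥ z.1 →
      dodecahedronData.bigPi ℂ t +ᵥ dodecahedronData.mkX z = dodecahedronData.mkX w :=
    ToricData.bigPi_vadd_mk hdet hopen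
  refine ⟨actM, actX, fun ν => ToricData.levelChart (hV.frame ν),
    fun ν => ToricData.openChart (hV.frame ν), fun _ _ => standardForm 3, hV.homeomorph, hM, hX,
    ToricData.isQuasifoldAtlas_sliceChart hQ isPhaseSection_real hR hlev he hcov',
    hV.isQuasifoldSymplecticForm,
    ToricData.isSmoothQuasitorusAction_sliceChart isPhaseSection_real hR hlev he hM,
    fun ν => (hV.frame ν).zero_mem_levelDomain,
    ToricData.bijOn_fixedPoints hQ isPhaseSection_real hR hlev he hM hcov' hV.eq_of_range_eq,
    fun ν => ⟨vertexFrame ν, dodecahedronData.levelSlice (vertexFrame ν),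
      (hV.frame ν).injective, (hV.frame ν).range_eq, ToricData.contDiffOn_levelSlice (hV.frame ν),
      fun z hz => ⟨ToricData.levelSlice_apply_frame (hV.frame ν) hz, fun j hj => ?_,
        ⟨ToricData.levelSlice_mem (hV.frame ν) z, rfl⟩,
        (ToricData.standardForm_comp_fderiv_levelSlice (hV.frame ν) hz).symm⟩⟩,
    ToricData.isQuasifoldAtlas_sliceChart hQ isPhaseSection_complex hC hopen he hcov,
    ToricData.isSmoothQuasitorusAction_sliceChart isPhaseSection_complex hC hopen he hX,
    ToricData.exists_dense_open_orbit ToricData.isOpen_openSet hopen ?_ hdet hX,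
    ToricData.bijOn_fixedPoints hQ isPhaseSection_complex hC hopen he hX hcov hV.eq_of_range_eq,
    fun ν => ⟨vertexFrame ν, (hV.frame ν).injective, (hV.frame ν).range_eq, rfl,
      fun z => ⟨ToricData.extend_one_mem_openSet (hV.frame ν) z, rfl⟩⟩,
    fun ν hν => openChart_eq_dodecahedronChart hν, activeSet_dodecahedron,
    isCompl_orbitTangent_dodecahedronSlice, exists_homeomorph_dodecahedronChart,
    fun z h => rfl, hV.isQuasifoldDiffeo, ToricData.inclusionMap_vadd hdet hM hX⟩
  · rw [← (hV.frame ν).range_eq] at hj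
    exact ToricData.exists_pos_levelSlice hz hj
  -- The point `(1, …, 1)`, whose class generates the dense orbit, satisfies the condition at any
  -- vertex.
  · obtain ⟨ν⟩ := hV.nonempty
    exact ⟨ν, (hV.frame ν).mem, fun _ _ => one_ne_zero⟩
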